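/- Let $M$ be a $C^\infty$ $2$-manifold with boundary (Hausdorff, second countable), and let $\mathrm{Emb}(M,\mathbf R^3)$ be the space of $C^\infty$ embeddings $f:M\to\mathbf R^3$ with the Whitney $C^\infty$ topology. An embedding $f$ is regarded as the surface $S=f(M)$ with boundary $\gamma=f(\partial M)$. Call $(S,\gamma)$ generic if, for a regular local parametrisation $\gamma(t)$ of the boundary near any of its points, $\gamma'(t)$ and $\gamma''(t)$ are linearly independent; the osculating plane of $\gamma$ is then the plane spanned by them. A point $p\in\gamma$ is an osculating-tangent point if $T_pS$ is the osculating plane of $\gamma$ at $p$. For an open set $U\ni p$ of $\mathbf R^3$, a flat $C^1$ extension of $S$ in $U$ is an embedded $C^1$ surface $\widetilde S\subset U$ without boundary in $U$ (i.e. every point of $\widetilde S$ has a neighbourhood in $\widetilde S$ regularly $C^1$-parametrised by an open subset of the plane) such that $S\cap U\subset\widetilde S$ and such that $\widetilde S\setminus(S\setminus\gamma)$ is a $C^\infty$ surface with boundary $\gamma\cap U$ whose Gaussian curvature vanishes identically. For a subset $N\subset\partial M$, the boundary-envelope over $N$ is the envelope of the tangent planes of $S$ along $f(N)$: the set of all $x\in\mathbf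 R^3$ for which there is a point $\gamma(t)$ of $f(N)$ with $\langle x-\gamma(t),n(t)\rangle=0$ and $\frac{\partial}{\partial t}\langle x-\gamma(t),n(t)\rangle=0$, where $n$ is a smooth nowhere vanishing field of normal vectors of $S$ along $\gamma$. (a) The generic embeddings form an open and dense subset of $\mathrm{Emb}(M,\mathbf R^3)$. (b) Let $(S,\gamma)$ be generic, and let $p=f(m)\in\gamma$ be a point that is not an osculating-tangent point. Then: (1) (existence) $S$ has a flat $C^1$ extension in some open neighbourhood $U$ of $p$ in $\mathbf R^3$; (2) (uniqueness) any two flat $C^1$ extensions of $S$ in neighbourhoods of $p$ coincide in some neighbourhood of $p$; (3) (the extension is the boundary-envelope) if $\widetilde S$ is a flat $C^1$ extension of $S$ in a neighbourhood of $p$, then there are arbitrarily small neighbourhoods $N$ of $m$ in $\partial M$ with the following property: for some open neighbourhood $V$ of $p$ in $\mathbf R^3$, the part in $V$ of the boundary-envelope over $N$ is a $C^\infty$ surface without boundary in $V$, with vanishing Gaussian curvature, and it contains $(\widetilde S\setminus(S\setminus\gamma))\cap V$. -/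

import Mathlib

open scoped Manifold ContDiff Topology
open Set

namespace FlatExt

noncomputable section

/-- The parameter plane. -/
abbrev E2 : Type := EuclideanSpace ℝ (Fin 2)

/-- Euclidean 3-space. -/
abbrev E3 : Type := EuclideanSpace ℝ (Fin 3)

/-- The vector product of Euclidean 3-space. -/
def cross (a b : E3) : E3 := WithLp.toLp 2 (crossProduct (WithLp.ofLp a) (WithLp.ofLp b))

/-! ### Surfaces with boundary as subsets of Euclidean 3-space -/

/-- The closed half plane. -/
def halfPlane : Set E2 := {u | 0 ≤ u 0}

/-- The boundary line of the half plane. -/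
def edge : Set E2 := {u | u 0 = 0}

/-- `φ`, restricted to the relatively open subset `W ∩ halfPlane` of the half plane, is a regular
`C^n` parametrisation of the part in the open set `V` of the set `S` with boundary `Γ`.
Around a point off `Γ` one takes `W` disjoint from the edge. -/
structure IsLocalParam (n : WithTop ℕ∞) (S Γ V : Set E3) (W : Set E2) (φ : E2 → E3) : Prop where
  isOpen_target : IsOpen V
  isOpen_source : IsOpen W
  contDiffOn : ContDiffOn ℝ n φ (W ∩ halfPlane)
  immersive : ∀ u ∈ W ∩ halfPlane,
    Function.Injective (fderivWithin ℝ φ (W ∩ halfPlane) u)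
  isEmbedding : Topology.IsEmbedding ((W ∩ halfPlane).domRestrict φ)
  image_eq : φ '' (W ∩ halfPlane) = S ∩ V
  image_edge_eq : φ '' (W ∩ edge) = Γ ∩ V

/-- `S` is an embedded `C^n` surface in Euclidean 3-space, with boundary `Γ`
(a surface without boundary if `Γ = ∅`). -/
def IsSurface (n : WithTop ℕ∞) (S Γ : Set E3) : Prop :=
  Γ ⊆ S ∧ ∀ x ∈ S, ∃ (V : Set E3) (W : Set E2) (φ : E2 → E3),
    x ∈ V ∧ IsLocalParam n S Γ V W φ

/-- The partial derivative of `φ` in the `i`-th coordinate direction, within `D`. -/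
def partialD (D : Set E2) (i : Fin 2) (φ : E2 → E3) (u : E2) : E3 :=
  fderivWithin ℝ φ D u (EuclideanSpace.single i 1)

/-- A normal vector of the parametrised surface `φ : D → ℝ³`. -/
def normalVec (D : Set E2) (φ : E2 → E3) (u : E2) : E3 :=
  cross (partialD D 0 φ u) (partialD D 1 φ u)

/-- Coefficients of the first fundamental form. -/
def firstForm (D : Set E2) (φ : E2 → E3) (u : E2) (i j : Fin 2) : ℝ :=
  inner ℝ (partialD D i φ u) (partialD D j φ u)

/-- Coefficients of the second fundamental form. -/
def secondForm (D : Set E2) (φ : E2 → E3) (u : E2) (i j : Fin 2) : ℝ :=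
  inner ℝ (partialD D i (partialD D j φ) u) (‖normalVec D φ u‖⁻¹ • normalVec D φ u)

/-- The Gaussian curvature `(L N - M ^ 2) / (E G - F ^ 2)` of a parametrised surface. -/
def gaussCurvature (D : Set E2) (φ : E2 → E3) (u : E2) : ℝ :=
  (secondForm D φ u 0 0 * secondForm D φ u 1 1 - secondForm D φ u 0 1 ^ 2) /
    (firstForm D φ u 0 0 * firstForm D φ u 1 1 - firstForm D φ u 0 1 ^ 2)

/-- `S` is a `C^∞` surface with boundary `Γ` whose Gaussian curvature vanishes identically. -/
def IsFlatSurface (S Γ : Set E3) : Prop :=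
  Γ ⊆ S ∧ ∀ x ∈ S, ∃ (V : Set E3) (W : Set E2) (φ : E2 → E3),
    x ∈ V ∧ IsLocalParam ∞ S Γ V W φ ∧
      ∀ u ∈ W ∩ halfPlane, gaussCurvature (W ∩ halfPlane) φ u = 0

/-- `T` is, in the open set `U`, a flat `C^1` extension across `Γ` of the surface `S` with
boundary `Γ`: it is a `C^1` surface without boundary in `U` which contains `S ∩ U`, and the
complement in `T` of the interior `S \ Γ` of `S` is a flat `C^∞` surface with boundary `Γ ∩ U`. -/
structure IsFlatExtension (S Γ U T : Set E3) : Prop where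
  isOpen : IsOpen U
  subset : T ⊆ U
  extends_surface : S ∩ U ⊆ T
  isSurface : IsSurface 1 T ∅
  flat : IsFlatSurface (T \ (S \ Γ)) (Γ ∩ U)

/-! ### Spaces of embedded surfaces -/

section Surfaces

variable (M : Type*) [TopologicalSpace M] [ChartedSpace (EuclideanHalfSpace 2) M]

/-- The `C^∞` maps from the 2-manifold with boundary `M` to Euclidean 3-space. -/
abbrev SmoothMaps : Type _ := ContMDiffMap (𝓡∂ 2) 𝓘(ℝ, E3) M E3 ∞

variable {M}

/-- The maps `g` whose derivatives of order at most `r` differ from those of `f` by less than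
`ε i` on `K i`, all measured in the chart `e i`. -/
def whitneyNhd (f : SmoothMaps M) (r : ℕ) (e : ℕ → OpenPartialHomeomorph M (EuclideanHalfSpace 2))
    (K : ℕ → Set M) (ε : ℕ → ℝ) : Set (SmoothMaps M) :=
  {g | ∀ i, ∀ x ∈ K i, ∀ j ≤ r,
    ‖iteratedFDerivWithin ℝ j
      (fun u => g (((e i).extend (𝓡∂ 2)).symm u) - f (((e i).extend (𝓡∂ 2)).symm u))
      (range (𝓡∂ 2)) ((e i).extend (𝓡∂ 2) x)‖ < ε i}

variable (M)

/-- The Whitney (strong) `C^∞` topology: it is generated by the sets `whitneyNhd f r e K ε`, where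
`r` is a natural number and `K` is a locally finite sequence of compact sets, `K i` lying in the
domain of the smooth chart `e i`. -/
@[reducible] def whitneyTopology : TopologicalSpace (SmoothMaps M) :=
  TopologicalSpace.generateFrom
    {N | ∃ (f : SmoothMaps M) (r : ℕ)
      (e : ℕ → OpenPartialHomeomorph M (EuclideanHalfSpace 2)) (K : ℕ → Set M) (ε : ℕ → ℝ),
      (∀ i, e i ∈ IsManifold.maximalAtlas (𝓡∂ 2) ∞ M) ∧
      (∀ i, IsCompact (K i) ∧ K i ⊆ (e i).source) ∧
      LocallyFinite K ∧ (∀ i, 0 < ε i) ∧ N = whitneyNhd f r e K ε}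

/-- The space of `C^∞` embeddings of `M` in Euclidean 3-space, i.e. of embedded surfaces with
boundary `(S, γ)`, where `S` and `γ` are the images of `M` and of its boundary. -/
def Surface : Type _ :=
  {f : SmoothMaps M // Topology.IsEmbedding f ∧
    ∀ x : M, Function.Injective (mfderiv (𝓡∂ 2) 𝓘(ℝ, E3) f x)}

instance : TopologicalSpace (Surface M) :=
  TopologicalSpace.induced Subtype.val (whitneyTopology M)

variable {M}

namespace Surface

/-- The underlying map. -/
def toMap (f : Surface M) : M → E3 := f.1

/-- The surface as a subset of space. -/
def carrier (f : Surface M) : Set E3 := range f.toMap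

/-- The boundary of the surface as a subset of space. -/
def bdry (f : Surface M) : Set E3 := f.toMap '' (𝓡∂ 2).boundary M

/-- The surface, parametrised by the preferred chart at `p`. -/
def localParam (f : Surface M) (p : M) : E2 → E3 :=
  fun u => f.toMap ((extChartAt (𝓡∂ 2) p).symm u)

/-- The coordinates, in the preferred chart at `p`, of the point with parameter `t` on the line
through `p` which is parallel to the boundary line. -/
def edgePoint (p : M) (t : ℝ) : E2 :=
  extChartAt (𝓡∂ 2) p p + t • EuclideanSpace.single 1 1

/-- For a boundary point `p`: a regular parametrisation, for `t` near `0`, of the boundary curve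
near `p = p(0)`. -/
def bdryCurve (f : Surface M) (p : M) (t : ℝ) : E3 := f.localParam p (edgePoint p t)

/-- A nowhere vanishing normal field of the surface along `bdryCurve`, for `t` near `0`. -/
def bdryNormal (f : Surface M) (p : M) (t : ℝ) : E3 :=
  normalVec halfPlane (f.localParam p) (edgePoint p t)

/-- The (direction of the) tangent plane of the surface at `p`. -/
def tangentPlane (f : Surface M) (p : M) : Submodule ℝ E3 :=
  LinearMap.range (mfderiv (𝓡∂ 2) 𝓘(ℝ, E3) f.toMap p : E2 →L[ℝ] E3).toLinearMap

/-- The first two derivatives of the boundary curve at `p` are linearly independent, so that it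
has an osculating plane there, the one which these derivatives span. -/
def HasOsculatingPlane (f : Surface M) (p : M) : Prop :=
  LinearIndependent ℝ ![deriv (f.bdryCurve p) 0, iteratedDeriv 2 (f.bdryCurve p) 0]

/-- The (direction of the) osculating plane of the boundary curve at `p`. -/
def osculatingPlane (f : Surface M) (p : M) : Submodule ℝ E3 :=
  Submodule.span ℝ {deriv (f.bdryCurve p) 0, iteratedDeriv 2 (f.bdryCurve p) 0}

/-- `p` is an osculating-tangent point. -/
def IsOsculatingTangent (f : Surface M) (p : M) : Prop :=
  f.tangentPlane p = f.osculatingPlane p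

/-- The genericity condition: the boundary curve has an osculating plane at each of its points. -/
def IsGeneric (f : Surface M) : Prop :=
  ∀ p ∈ (𝓡∂ 2).boundary M, f.HasOsculatingPlane p

/-- The characteristic set at the boundary point `p` of the family of tangent planes
`{x | G(t, x) = 0}`, `G(t, x) = ⟨x - γ(t), n(t)⟩`, of the surface along its boundary curve `γ`:
it is given by `G = ∂G/∂t = 0`. -/
def characteristic (f : Surface M) (p : M) : Set E3 :=
  {x | inner ℝ (x - f.bdryCurve p 0) (f.bdryNormal p 0) = 0 ∧
    deriv (fun t => (inner ℝ (x - f.bdryCurve p t) (f.bdryNormal p t) : ℝ)) 0 = 0}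

/-- The boundary-envelope over the part of the boundary in `N`: the envelope of the tangent planes
of the surface at the boundary points in `N`. -/
def boundaryEnvelope (f : Surface M) (N : Set M) : Set E3 :=
  ⋃ p ∈ N ∩ (𝓡∂ 2).boundary M, f.characteristic p

end Surface

end Surfaces

end

end FlatExt

namespace FlatExt
noncomputable section

/-! ### Vector algebra in Euclidean 3-space -/

/-! Part (b) is local. Along the edge of a patch let γ be the boundary curve and n the normal of S.
Differentiating ⟨γ', n⟩ = 0 gives ⟨γ'', n⟩ = -⟨γ', n'⟩; as γ' and γ'' are independent, ⟨γ', n'⟩ = 0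
would make the tangent plane osculating (`edgeParam_mem_regularParams`). So ⟨γ', n'⟩ ≠ 0 at p and
nearby. Then n and n' are independent, and the characteristic set at γ(t) is a line through γ(t)
(`edgeChar_eq`) whose direction ξ(t) spans the tangent plane of S together with γ'. The ruled
surface γ + s ξ is regular near γ and tangent to S along γ. It satisfies ⟨ξ', ξ × γ'⟩ = 0, hence is
flat (`gaussCurvature_ruled`).

Existence: one half of the ruled surface, reparametrised so that first derivatives match along the
edge, is glued to S (`exists_isFlatExtension`).

Uniqueness: the extension is C^1, so its flat part has the tangent planes of S along γ. Zero
curvature makes the two derivatives of the unit normal ν proportional, so that the tangent plane,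
recorded as (ν, ⟨φ, ν⟩), is a map of rank one and is constant on curves that reach the edge
(`exists_edge_point_of_rank_one`). Therefore each nearby point of the flat part satisfies the two
equations of a characteristic line (`exists_mem_edgeChar_of_flat`) and lies on the ruled surface. It
cannot leave γ towards S, because interior points of S would then belong to the flat part
(`fderivWithin_ne_of_isFlatExtension`); and it fills the whole of the other half
(`exists_mem_iff_envelope`). Statement (3) combines the same containment with the regularity of the
ruled surface (`exists_isFlatSurface_envelope`).

Part (a): genericity is an open condition on 2-jets along the boundary, so a locally finite compact
cover gives openness. For density, f is composed with maps y + Σ (H l v₁ + H (l² / 2) v₂) of space,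
H being a cut-off and l an affine function with nonzero derivative along the curve. The bad pairs
(v₁, v₂) lie in the C^1 image of a 5-dimensional set in a 6-dimensional space, so good pairs are
dense (`dense_setOf_deriv_ne`). The pairs are chosen one after another, each small enough to keep
what was achieved before, to remain in the given neighbourhood, and to leave the map an embedding.
-/

theorem inner_eq_sum (a b : E3) : inner ℝ a b = a 0 * b 0 + a 1 * b 1 + a 2 * b 2 := by
  simp [PiLp.inner_apply, Fin.sum_univ_three, mul_comm]

theorem cross_zero (a b : E3) : cross a b 0 = a 1 * b 2 - a 2 * b 1 := by
  simp [cross, cross_apply]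

theorem cross_one (a b : E3) : cross a b 1 = a 2 * b 0 - a 0 * b 2 := by
  simp [cross, cross_apply]

theorem cross_two (a b : E3) : cross a b 2 = a 0 * b 1 - a 1 * b 0 := by
  simp [cross, cross_apply]

theorem E3_ext {a b : E3} (h0 : a 0 = b 0) (h1 : a 1 = b 1) (h2 : a 2 = b 2) : a = b := by
  ext i; fin_cases i <;> assumption

/-- The vector product as a continuous bilinear map. -/
def crossL : E3 →L[ℝ] E3 →L[ℝ] E3 :=
  LinearMap.toContinuousLinearMap
    ((LinearMap.toContinuousLinearMap : (E3 →ₗ[ℝ] E3) ≃ₗ[ℝ] (E3 →L[ℝ] E3)).toLinearMap ∘ₗ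
      LinearMap.mk₂ ℝ cross
        (fun a b c => by apply E3_ext <;> simp [cross_zero, cross_one, cross_two] <;> ring)
        (fun r a b => by apply E3_ext <;> simp [cross_zero, cross_one, cross_two] <;> ring)
        (fun a b c => by apply E3_ext <;> simp [cross_zero, cross_one, cross_two] <;> ring)
        (fun r a b => by apply E3_ext <;> simp [cross_zero, cross_one, cross_two] <;> ring))

theorem crossL_apply (a b : E3) : crossL a b = cross a b := rfl

theorem inner_cross_self_left (a b : E3) : inner ℝ (cross a b) a = 0 := by
  simp only [inner_eq_sum, cross_zero, cross_one, cross_two]; ring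

theorem inner_cross_self_right (a b : E3) : inner ℝ (cross a b) b = 0 := by
  simp only [inner_eq_sum, cross_zero, cross_one, cross_two]; ring

theorem inner_self_cross_left (a b : E3) : inner ℝ a (cross a b) = 0 := by
  rw [real_inner_comm, inner_cross_self_left]

theorem inner_self_cross_right (a b : E3) : inner ℝ b (cross a b) = 0 := by
  rw [real_inner_comm, inner_cross_self_right]

theorem cross_add_left (a b c : E3) : cross (a + b) c = cross a c + cross b c := by
  simp [← crossL_apply]

theorem cross_add_right (a b c : E3) : cross a (b + c) = cross a b + cross a c := by
  simp [← crossL_apply]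

theorem cross_smul_left (r : ℝ) (a b : E3) : cross (r • a) b = r • cross a b := by
  simp [← crossL_apply]

theorem cross_smul_right (r : ℝ) (a b : E3) : cross a (r • b) = r • cross a b := by
  simp [← crossL_apply]

theorem cross_self (a : E3) : cross a a = 0 := by
  apply E3_ext <;> simp [cross_zero, cross_one, cross_two] <;> ring

theorem linearIndependent_iff_cross_ne_zero (a b : E3) :
    LinearIndependent ℝ ![a, b] ↔ cross a b ≠ 0 := by
  have h : LinearIndependent ℝ ![a, b] ↔ LinearIndependent ℝ ![WithLp.ofLp a, WithLp.ofLp b] := by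
    rw [← LinearMap.linearIndependent_iff (WithLp.linearEquiv 2 ℝ (Fin 3 → ℝ)).toLinearMap
      (LinearEquiv.ker _)]
    have : ((WithLp.linearEquiv 2 ℝ (Fin 3 → ℝ)).toLinearMap ∘ ![a, b]) =
        ![WithLp.ofLp a, WithLp.ofLp b] := by
      ext i; fin_cases i <;> rfl
    rw [this]
  rw [h, ← crossProduct_ne_zero_iff_linearIndependent]
  simp only [cross, ne_eq]
  rw [WithLp.toLp_eq_zero]

/-- Lagrange's identity for the triple product. -/
theorem cross_cross (a b c : E3) :
    cross (cross a b) c = (inner ℝ a c : ℝ) • b - (inner ℝ b c : ℝ) • a := by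
  apply E3_ext <;> simp [inner_eq_sum, cross_zero, cross_one, cross_two] <;> ring

/-- A vector orthogonal to `a` and `b` is a multiple of `cross a b`. -/
theorem eq_smul_cross_of_inner_eq_zero {a b x : E3} (h : cross a b ≠ 0)
    (ha : inner ℝ x a = 0) (hb : inner ℝ x b = 0) :
    x = ((inner ℝ x (cross a b) : ℝ) / inner ℝ (cross a b) (cross a b)) • cross a b := by
  have h0 : (inner ℝ (cross a b) (cross a b) : ℝ) ≠ 0 := by simpa using h
  have h1 : cross (cross a b) x = 0 := by
    rw [cross_cross, real_inner_comm, ha, real_inner_comm, hb]; simp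
  have h2 := cross_cross (cross a b) x (cross a b)
  rw [h1] at h2
  have h3 : (inner ℝ (cross a b) (cross a b) : ℝ) • x = (inner ℝ x (cross a b) : ℝ) • cross a b := by
    have : cross (0 : E3) (cross a b) = 0 := by simp [← crossL_apply]
    rw [this] at h2
    exact (sub_eq_zero.1 h2.symm)
  rw [div_eq_inv_mul, mul_smul, ← h3, smul_smul, inv_mul_cancel₀ h0, one_smul]

/-- Expansion of a vector in the frame `a`, `b`, `cross a b`. -/
theorem inner_cross_smul_eq (a b x : E3) : (inner ℝ (cross a b) (cross a b) : ℝ) • x =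
    (inner ℝ (cross b (cross a b)) x : ℝ) • a + (inner ℝ (cross (cross a b) a) x : ℝ) • b +
      (inner ℝ x (cross a b) : ℝ) • cross a b := by
  apply E3_ext <;>
    simp only [inner_eq_sum, cross_zero, cross_one, cross_two, PiLp.add_apply, PiLp.smul_apply,
      smul_eq_mul] <;> ring

/-- Coordinates of a vector orthogonal to `m` in the frame `a`, `b` of the orthogonal complement
of `m`. -/
theorem eq_smul_add_smul_of_inner_eq_zero {a b m x : E3} (h : cross a b ≠ 0) (hm : m ≠ 0)
    (ha : inner ℝ a m = 0) (hb : inner ℝ b m = 0) (hx : inner ℝ x m = 0) :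
    ∃ r s : ℝ, x = r • a + s • b := by
  have hm' := eq_smul_cross_of_inner_eq_zero h (by rwa [real_inner_comm]) (by rwa [real_inner_comm])
  set k : ℝ := (inner ℝ m (cross a b) : ℝ) / inner ℝ (cross a b) (cross a b)
  have hk : k ≠ 0 := by rintro hk; rw [hk, zero_smul] at hm'; exact hm hm'
  -- `m` is a nonzero multiple of `cross a b`, so the third term in the expansion of `x` drops out.
  have hx' : inner ℝ x (cross a b) = 0 := by
    rw [hm', inner_smul_right] at hx; exact (mul_eq_zero.1 hx).resolve_left hk
  have h0 : (inner ℝ (cross a b) (cross a b) : ℝ) ≠ 0 := by simpa using h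
  have e := inner_cross_smul_eq a b x
  rw [hx', zero_smul, add_zero] at e
  refine ⟨(inner ℝ (cross b (cross a b)) x : ℝ) / inner ℝ (cross a b) (cross a b),
    (inner ℝ (cross (cross a b) a) x : ℝ) / inner ℝ (cross a b) (cross a b), ?_⟩
  rw [div_eq_inv_mul, div_eq_inv_mul, mul_smul, mul_smul, ← smul_add, ← e,
    smul_smul, inv_mul_cancel₀ h0, one_smul]

theorem inner_self_cross_pos {a b : E3} (h : cross a b ≠ 0) :
    0 < (inner ℝ (cross a b) (cross a b) : ℝ) := by
  rw [real_inner_self_eq_norm_sq]; positivity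

/-! ### Points of the parameter plane -/

/-- The point of the parameter plane with given coordinates. -/
def pt (s t : ℝ) : E2 := !₂[s, t]

@[simp] theorem pt_zero (s t : ℝ) : pt s t 0 = s := rfl
@[simp] theorem pt_one (s t : ℝ) : pt s t 1 = t := rfl

theorem E2_ext {u v : E2} (h0 : u 0 = v 0) (h1 : u 1 = v 1) : u = v := by
  ext i; fin_cases i <;> assumption

theorem pt_eta (u : E2) : pt (u 0) (u 1) = u := E2_ext rfl rfl

/-- The coordinate vectors of the parameter plane. -/
abbrev ee (i : Fin 2) : E2 := EuclideanSpace.single i 1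

theorem E2_eq (u : E2) : u = u 0 • ee 0 + u 1 • ee 1 := by
  apply E2_ext <;> simp

theorem pt_eq (s t : ℝ) : pt s t = s • ee 0 + t • ee 1 := by
  apply E2_ext <;> simp

theorem map_E2 {F : Type*} [NormedAddCommGroup F] [NormedSpace ℝ F] (A : E2 →L[ℝ] F) (u : E2) :
    A u = u 0 • A (ee 0) + u 1 • A (ee 1) := by
  conv_lhs => rw [E2_eq u]
  simp

theorem E2_clm_ext {F : Type*} [NormedAddCommGroup F] [NormedSpace ℝ F] {A B : E2 →L[ℝ] F}
    (h0 : A (ee 0) = B (ee 0)) (h1 : A (ee 1) = B (ee 1)) : A = B := by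
  ext u; rw [map_E2, map_E2 B, h0, h1]

/-- The coordinate functionals of the parameter plane. -/
abbrev cc (i : Fin 2) : E2 →L[ℝ] ℝ := EuclideanSpace.proj i

theorem contDiff_pt : ContDiff ℝ ω (fun x : ℝ × ℝ => pt x.1 x.2) := by
  simp only [pt_eq]; fun_prop

theorem contDiff_coord (i : Fin 2) : ContDiff ℝ ω (fun u : E2 => u i) :=
  (cc i).contDiff

theorem injective_iff_cross_ne_zero (A : E2 →L[ℝ] E3) :
    Function.Injective A ↔ cross (A (ee 0)) (A (ee 1)) ≠ 0 := by
  rw [← linearIndependent_iff_cross_ne_zero, LinearIndependent.pair_iff]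
  constructor
  · intro h s t hst
    have : A (pt s t) = A 0 := by rw [map_E2]; simpa using hst
    have := h this
    exact ⟨by simpa using congrArg (fun u : E2 => u 0) this,
      by simpa using congrArg (fun u : E2 => u 1) this⟩
  · intro h
    rw [injective_iff_map_eq_zero]
    intro u hu
    rw [map_E2] at hu
    obtain ⟨h0, h1⟩ := h _ _ hu
    exact E2_ext h0 h1

theorem halfPlane_eq_range : halfPlane = range (𝓡∂ 2) :=
  (range_modelWithCornersEuclideanHalfSpace 2).symm

theorem uniqueDiffOn_halfPlane : UniqueDiffOn ℝ halfPlane := by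
  rw [halfPlane_eq_range]; exact (𝓡∂ 2).uniqueDiffOn

theorem uniqueDiffOn_inter_halfPlane {W : Set E2} (hW : IsOpen W) :
    UniqueDiffOn ℝ (W ∩ halfPlane) := by
  rw [inter_comm]; exact uniqueDiffOn_halfPlane.inter hW

theorem edge_subset_halfPlane : edge ⊆ halfPlane := fun u (hu : u 0 = 0) => hu.ge

theorem pt_mem_edge (t : ℝ) : pt 0 t ∈ edge := rfl

theorem eq_pt_of_mem_edge {u : E2} (hu : u ∈ edge) : u = pt 0 (u 1) :=
  E2_ext hu rfl

/-- The definitions differentiate within `W ∩ halfPlane`, most of the proof within `halfPlane`; the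
open set `W` makes no difference. -/
theorem fderivWithin_inter_halfPlane {F : Type*} [NormedAddCommGroup F] [NormedSpace ℝ F]
    {W : Set E2} (hW : IsOpen W) {u : E2} (hu : u ∈ W) (φ : E2 → F) :
    fderivWithin ℝ φ (W ∩ halfPlane) u = fderivWithin ℝ φ halfPlane u := by
  rw [inter_comm]; exact fderivWithin_inter (hW.mem_nhds hu)

theorem partialD_inter_halfPlane {W : Set E2} (hW : IsOpen W) {u : E2} (hu : u ∈ W) (i : Fin 2)
    (φ : E2 → E3) : partialD (W ∩ halfPlane) i φ u = partialD halfPlane i φ u := by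
  simp only [partialD, fderivWithin_inter_halfPlane hW hu]

theorem normalVec_inter_halfPlane {W : Set E2} (hW : IsOpen W) {u : E2} (hu : u ∈ W)
    (φ : E2 → E3) : normalVec (W ∩ halfPlane) φ u = normalVec halfPlane φ u := by
  simp only [normalVec, partialD_inter_halfPlane hW hu]

theorem contDiffOn_partialD {W : Set E2} (hW : IsOpen W) {φ : E2 → E3}
    (h : ContDiffOn ℝ ∞ φ (W ∩ halfPlane)) (i : Fin 2) :
    ContDiffOn ℝ ∞ (partialD (W ∩ halfPlane) i φ) (W ∩ halfPlane) :=
  (h.fderivWithin (uniqueDiffOn_inter_halfPlane hW) (by simp)).clm_apply contDiffOn_const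

theorem contDiffOn_normalVec {W : Set E2} (hW : IsOpen W) {φ : E2 → E3}
    (h : ContDiffOn ℝ ∞ φ (W ∩ halfPlane)) :
    ContDiffOn ℝ ∞ (normalVec (W ∩ halfPlane) φ) (W ∩ halfPlane) :=
  (crossL.contDiff.comp_contDiffOn (contDiffOn_partialD hW h 0)).clm_apply
    (contDiffOn_partialD hW h 1)

end
end FlatExt

namespace FlatExt
noncomputable section

/-! ### Gluing and extending maps across the edge -/

/-- The closed half plane opposite to `halfPlane`. -/
def negHalfPlane : Set E2 := {u | u 0 ≤ 0}

theorem halfPlane_union_negHalfPlane : halfPlane ∪ negHalfPlane = univ :=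
  eq_univ_of_forall fun u => le_total 0 (u 0)

theorem uniqueDiffOn_negHalfPlane : UniqueDiffOn ℝ negHalfPlane := by
  apply uniqueDiffOn_convex
  · exact (convex_halfSpace_le (f := fun u : E2 => u 0) ((cc 0).toLinearMap.isLinear) 0)
  · refine ⟨pt (-1) 0, mem_interior_iff_mem_nhds.2 ?_⟩
    have : ∀ᶠ u : E2 in 𝓝 (pt (-1) 0), u 0 < 0 :=
      (contDiff_coord 0).continuous.continuousAt.eventually_lt_const (by simp)
    filter_upwards [this] with u hu using hu.le

section Glue

variable {F : Type*} [NormedAddCommGroup F] [NormedSpace ℝ F]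

/-- The map equal to `f` on `halfPlane` and to `g` on the rest of the plane. -/
def glue (f g : E2 → F) : E2 → F := fun u => if 0 ≤ u 0 then f u else g u

theorem glue_of_mem {F : Type*} {f g : E2 → F} {u : E2} (hu : u ∈ halfPlane) : glue f g u = f u :=
  if_pos hu

theorem glue_of_neg {F : Type*} {f g : E2 → F} {u : E2} (hu : u 0 < 0) : glue f g u = g u :=
  if_neg (not_le.2 hu)

theorem glue_of_mem_neg {F : Type*} {f g : E2 → F} {u : E2} (hu : u ∈ negHalfPlane)
    (h : u ∈ edge → f u = g u) : glue f g u = g u := by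
  rcases lt_or_eq_of_le (show u 0 ≤ 0 from hu) with h0 | h0
  · exact glue_of_neg h0
  · rw [glue_of_mem (show (0 : ℝ) ≤ u 0 from h0.ge), h h0]

/-- Off the edge one branch governs a whole neighbourhood; on the edge the two closed half planes
cover the plane, and continuity within each is enough. -/
theorem continuousAt_glue {F : Type*} [NormedAddCommGroup F] {f g : E2 → F} {W : Set E2} (hW : IsOpen W)
    (hf : ContinuousOn f (W ∩ halfPlane)) (hg : ContinuousOn g (W ∩ negHalfPlane))
    (h0 : ∀ u ∈ W ∩ edge, f u = g u) {u : E2} (hu : u ∈ W) : ContinuousAt (glue f g) u := by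
  have hWu := hW.mem_nhds hu
  rcases lt_trichotomy (u 0) 0 with h | h | h
  · have hn : ∀ᶠ v : E2 in 𝓝 u, v 0 < 0 :=
      (contDiff_coord 0).continuous.continuousAt.eventually_lt_const h
    have : ContinuousAt g u := (hg u ⟨hu, h.le⟩).continuousAt (by
      filter_upwards [hWu, hn] with v hv hv' using ⟨hv, hv'.le⟩)
    refine this.congr ?_
    filter_upwards [hn] with v hv using (glue_of_neg hv).symm
  · rw [← continuousWithinAt_univ, ← halfPlane_union_negHalfPlane]
    apply ContinuousWithinAt.union
    · have := hf u ⟨hu, h.ge⟩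
      rw [inter_comm, continuousWithinAt_inter hWu] at this
      exact this.congr (fun v hv => glue_of_mem hv) (glue_of_mem h.ge)
    · have := hg u ⟨hu, h.le⟩
      have h' : ContinuousWithinAt (glue f g) (W ∩ negHalfPlane) u :=
        this.congr (fun v hv => glue_of_mem_neg hv.2 fun he => h0 v ⟨hv.1, he⟩)
          (glue_of_mem_neg h.le fun he => h0 u ⟨hu, he⟩)
      rwa [inter_comm, continuousWithinAt_inter hWu] at h'
  · have hn : ∀ᶠ v : E2 in 𝓝 u, 0 < v 0 :=
      (contDiff_coord 0).continuous.continuousAt.eventually_const_lt h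
    have : ContinuousAt f u := (hf u ⟨hu, h.le⟩).continuousAt (by
      filter_upwards [hWu, hn] with v hv hv' using ⟨hv, hv'.le⟩)
    refine this.congr ?_
    filter_upwards [hn] with v hv using (glue_of_mem (show (0 : ℝ) ≤ v 0 from hv.le)).symm

/-- The derivative is again a glued map, so its continuity can be read off from `continuousAt_glue`.
-/
theorem hasFDerivAt_glue {f g : E2 → F} {f' g' : E2 → E2 →L[ℝ] F} {W : Set E2} (hW : IsOpen W)
    (hf : ∀ u ∈ W ∩ halfPlane, HasFDerivWithinAt f (f' u) (W ∩ halfPlane) u)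
    (hg : ∀ u ∈ W ∩ negHalfPlane, HasFDerivWithinAt g (g' u) (W ∩ negHalfPlane) u)
    (h0 : ∀ u ∈ W ∩ edge, f u = g u) (h1 : ∀ u ∈ W ∩ edge, f' u = g' u) {u : E2} (hu : u ∈ W) :
    HasFDerivAt (glue f g) (glue f' g' u) u := by
  have hWu := hW.mem_nhds hu
  rcases lt_trichotomy (u 0) 0 with h | h | h
  · have hn : ∀ᶠ v : E2 in 𝓝 u, v 0 < 0 :=
      (contDiff_coord 0).continuous.continuousAt.eventually_lt_const h
    have := (hg u ⟨hu, h.le⟩).hasFDerivAt (by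
      filter_upwards [hWu, hn] with v hv hv' using ⟨hv, hv'.le⟩)
    rw [glue_of_neg h]
    refine this.congr_of_eventuallyEq ?_
    filter_upwards [hn] with v hv using (glue_of_neg hv)
  · rw [← hasFDerivWithinAt_univ, ← halfPlane_union_negHalfPlane]
    apply HasFDerivWithinAt.union
    · have := hf u ⟨hu, h.ge⟩
      rw [inter_comm, hasFDerivWithinAt_inter hWu] at this
      rw [glue_of_mem h.ge]
      exact this.congr (fun v hv => glue_of_mem hv) (glue_of_mem h.ge)
    · have := hg u ⟨hu, h.le⟩
      have h' : HasFDerivWithinAt (glue f g) (g' u) (W ∩ negHalfPlane) u :=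
        this.congr (fun v hv => glue_of_mem_neg hv.2 fun he => h0 v ⟨hv.1, he⟩)
          (glue_of_mem_neg h.le fun he => h0 u ⟨hu, he⟩)
      rw [glue_of_mem_neg h.le fun he => h1 u ⟨hu, he⟩]
      rwa [inter_comm, hasFDerivWithinAt_inter hWu] at h'
  · have hn : ∀ᶠ v : E2 in 𝓝 u, 0 < v 0 :=
      (contDiff_coord 0).continuous.continuousAt.eventually_const_lt h
    have := (hf u ⟨hu, h.le⟩).hasFDerivAt (by
      filter_upwards [hWu, hn] with v hv hv' using ⟨hv, hv'.le⟩)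
    rw [glue_of_mem (show (0 : ℝ) ≤ u 0 from h.le)]
    refine this.congr_of_eventuallyEq ?_
    filter_upwards [hn] with v hv using (glue_of_mem (show (0 : ℝ) ≤ v 0 from hv.le))

theorem contDiffOn_one_of_hasFDerivAt {E : Type*} [NormedAddCommGroup E] [NormedSpace ℝ E]
    {f : E → F} {f' : E → E →L[ℝ] F} {W : Set E} (hW : IsOpen W)
    (h : ∀ u ∈ W, HasFDerivAt f (f' u) u) (hc : ContinuousOn f' W) : ContDiffOn ℝ 1 f W := by
  have := contDiffOn_succ_iff_fderiv_of_isOpen (𝕜 := ℝ) (n := 0) (f := f) hW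
  rw [zero_add] at this
  refine this.2 ⟨fun u hu => (h u hu).differentiableAt.differentiableWithinAt, by simp, ?_⟩
  exact contDiffOn_zero.2 (hc.congr fun u hu => (h u hu).fderiv)

/-- Two `C^1` maps on opposite half planes with the same values and derivatives along the edge
form a `C^1` map. -/
theorem contDiffOn_glue {f g : E2 → F} {W : Set E2} (hW : IsOpen W)
    (hf : ContDiffOn ℝ 1 f (W ∩ halfPlane)) (hg : ContDiffOn ℝ 1 g (W ∩ negHalfPlane))
    (h0 : ∀ u ∈ W ∩ edge, f u = g u)
    (h1 : ∀ u ∈ W ∩ edge, fderivWithin ℝ f (W ∩ halfPlane) u =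
      fderivWithin ℝ g (W ∩ negHalfPlane) u) : ContDiffOn ℝ 1 (glue f g) W := by
  have hg1 : UniqueDiffOn ℝ (W ∩ negHalfPlane) := by
    rw [inter_comm]; exact uniqueDiffOn_negHalfPlane.inter hW
  refine contDiffOn_one_of_hasFDerivAt hW (fun u hu => hasFDerivAt_glue hW
    (fun u hu => (hf.differentiableOn one_ne_zero u hu).hasFDerivWithinAt)
    (fun u hu => (hg.differentiableOn one_ne_zero u hu).hasFDerivWithinAt) h0 h1 hu) ?_
  exact fun u hu => (continuousAt_glue hW
    (hf.continuousOn_fderivWithin (uniqueDiffOn_inter_halfPlane hW) le_rfl)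
    (hg.continuousOn_fderivWithin hg1 le_rfl) h1 hu).continuousWithinAt

theorem fderivWithin_halfPlane_eq_fderiv {φ ψ : E2 → F} {u : E2} (hu : u ∈ halfPlane)
    (hψ : DifferentiableAt ℝ ψ u) (h : φ =ᶠ[𝓝[halfPlane] u] ψ) :
    fderivWithin ℝ φ halfPlane u = fderiv ℝ ψ u := by
  rw [h.fderivWithin_eq_of_mem hu, hψ.fderivWithin (uniqueDiffOn_halfPlane u hu)]

/-- The projection to the edge. -/
def edgeProj : E2 →L[ℝ] E2 := (cc 1).smulRight (ee 1)

/-- The reflection in the edge. -/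
def edgeRefl : E2 →L[ℝ] E2 := (cc 1).smulRight (ee 1) - (cc 0).smulRight (ee 0)

@[simp] theorem edgeProj_zero (u : E2) : edgeProj u 0 = 0 := by simp [edgeProj]
@[simp] theorem edgeProj_one (u : E2) : edgeProj u 1 = u 1 := by simp [edgeProj]
@[simp] theorem edgeRefl_zero (u : E2) : edgeRefl u 0 = - u 0 := by simp [edgeRefl]
@[simp] theorem edgeRefl_one (u : E2) : edgeRefl u 1 = u 1 := by simp [edgeRefl]

theorem edgeProj_of_mem {u : E2} (hu : u ∈ edge) : edgeProj u = u :=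
  E2_ext (by simpa using (show u 0 = 0 from hu).symm) (by simp)

theorem edgeRefl_of_mem {u : E2} (hu : u ∈ edge) : edgeRefl u = u :=
  E2_ext (by simp [show u 0 = 0 from hu]) (by simp)

/-- The extension of a map from `halfPlane` to the plane which is odd with respect to the values
on the edge. -/
def oddExt (φ : E2 → F) : E2 → F := glue φ fun u => (2 : ℝ) • φ (edgeProj u) - φ (edgeRefl u)

theorem oddExt_of_mem {φ : E2 → F} {u : E2} (hu : u ∈ halfPlane) : oddExt φ u = φ u :=
  glue_of_mem hu

theorem oddExt_of_neg {φ : E2 → F} {u : E2} (hu : u 0 < 0) :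
    oddExt φ u = (2 : ℝ) • φ (edgeProj u) - φ (edgeRefl u) :=
  glue_of_neg hu

/-- On the edge the reflected branch has the right derivative: in the direction `ee 1` it is twice
that of φ minus once; in the direction `ee 0` the projection contributes nothing and the two minus
signs cancel. Oddness keeps the derivative, so regular maps of half discs become accessible to the
inverse function theorem. -/
theorem contDiffOn_oddExt {φ : E2 → F} {W : Set E2} (hW : IsOpen W)
    (hφ : ContDiffOn ℝ 1 φ (W ∩ halfPlane)) :
    ContDiffOn ℝ 1 (oddExt φ) (W ∩ edgeProj ⁻¹' W ∩ edgeRefl ⁻¹' W) := by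
  set B := W ∩ edgeProj ⁻¹' W ∩ edgeRefl ⁻¹' W with hBdef
  have hB : IsOpen B := (hW.inter (hW.preimage edgeProj.continuous)).inter
    (hW.preimage edgeRefl.continuous)
  have mP : MapsTo edgeProj (B ∩ negHalfPlane) (W ∩ halfPlane) := fun u hu =>
    ⟨hu.1.1.2, by simp [halfPlane]⟩
  have mR : MapsTo edgeRefl (B ∩ negHalfPlane) (W ∩ halfPlane) := fun u hu =>
    ⟨hu.1.2, by simpa [halfPlane] using (show u 0 ≤ 0 from hu.2)⟩
  have hB' : UniqueDiffOn ℝ (B ∩ negHalfPlane) := by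
    rw [inter_comm]; exact uniqueDiffOn_negHalfPlane.inter hB
  refine contDiffOn_glue hB (hφ.mono (inter_subset_inter_left _ (fun u hu => hu.1.1))) ?_ ?_ ?_
  · exact ((hφ.comp edgeProj.contDiff.contDiffOn mP).const_smul (2 : ℝ)).sub
      (hφ.comp edgeRefl.contDiff.contDiffOn mR)
  · intro u hu
    rw [edgeProj_of_mem hu.2, edgeRefl_of_mem hu.2, two_smul, add_sub_cancel_right]
  · intro u hu
    have hud : HasFDerivWithinAt φ (fderivWithin ℝ φ (W ∩ halfPlane) u) (W ∩ halfPlane) u :=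
      (hφ.differentiableOn one_ne_zero u ⟨hu.1.1.1, edge_subset_halfPlane hu.2⟩).hasFDerivWithinAt
    have hP : HasFDerivWithinAt (fun v => φ (edgeProj v))
        ((fderivWithin ℝ φ (W ∩ halfPlane) u).comp edgeProj) (B ∩ negHalfPlane) u := by
      refine HasFDerivWithinAt.comp u (t := W ∩ halfPlane) ?_ edgeProj.hasFDerivWithinAt mP
      rw [edgeProj_of_mem hu.2]; exact hud
    have hR : HasFDerivWithinAt (fun v => φ (edgeRefl v))
        ((fderivWithin ℝ φ (W ∩ halfPlane) u).comp edgeRefl) (B ∩ negHalfPlane) u := by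
      refine HasFDerivWithinAt.comp u (t := W ∩ halfPlane) ?_ edgeRefl.hasFDerivWithinAt mR
      rw [edgeRefl_of_mem hu.2]; exact hud
    have hmem : u ∈ B ∩ negHalfPlane := ⟨hu.1, (show u 0 = 0 from hu.2).le⟩
    have hD : fderivWithin ℝ (fun u => (2 : ℝ) • φ (edgeProj u) - φ (edgeRefl u))
        (B ∩ negHalfPlane) u = _ :=
      ((hP.const_smul (2 : ℝ)).sub hR).fderivWithin (hB' u hmem)
    rw [hD, fderivWithin_inter_halfPlane hB hu.1, ← fderivWithin_inter_halfPlane hW hu.1.1.1]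
    have e0 : edgeProj (ee 0) = 0 := by apply E2_ext <;> simp
    have e1 : edgeProj (ee 1) = ee 1 := by apply E2_ext <;> simp
    have e2 : edgeRefl (ee 0) = - ee 0 := by apply E2_ext <;> simp
    have e3 : edgeRefl (ee 1) = ee 1 := by apply E2_ext <;> simp
    apply E2_clm_ext
    · simp [e0, e2]
    · simp [e1, e3, two_smul]

/-- A `C^1` map on a half plane extends locally to a `C^1` map on the plane. -/
theorem exists_contDiffOn_extension {φ : E2 → F} {W : Set E2} (hW : IsOpen W)
    (hφ : ContDiffOn ℝ 1 φ (W ∩ halfPlane)) {u : E2} (hu : u ∈ W ∩ halfPlane) :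
    ∃ (ψ : E2 → F) (B : Set E2), IsOpen B ∧ u ∈ B ∧ B ⊆ W ∧ ContDiffOn ℝ 1 ψ B ∧
      EqOn φ ψ (B ∩ halfPlane) := by
  rcases lt_or_eq_of_le (show 0 ≤ u 0 from hu.2) with h | h
  · refine ⟨φ, W ∩ {v | 0 < v 0}, hW.inter (isOpen_lt continuous_const
      (contDiff_coord 0).continuous), ⟨hu.1, h⟩, inter_subset_left, ?_, fun v _ => rfl⟩
    exact hφ.mono (inter_subset_inter_right _ fun v hv => le_of_lt (show 0 < v 0 from hv))
  · have he : u ∈ edge := h.symm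
    refine ⟨oddExt φ, _, (hW.inter (hW.preimage edgeProj.continuous)).inter
      (hW.preimage edgeRefl.continuous), ?_, fun v hv => hv.1.1, contDiffOn_oddExt hW hφ,
      fun v hv => (oddExt_of_mem hv.2).symm⟩
    refine ⟨⟨hu.1, ?_⟩, ?_⟩
    · rw [mem_preimage, edgeProj_of_mem he]; exact hu.1
    · rw [mem_preimage, edgeRefl_of_mem he]; exact hu.1

end Glue

/-! ### Local inverses -/

/-- The inverse function theorem, with the source cut down to where the derivative stays invertible,
so that the inverse is `C^1` on its whole domain. -/
theorem exists_openPartialHomeomorph {E : Type*} [NormedAddCommGroup E] [NormedSpace ℝ E]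
    [FiniteDimensional ℝ E] {κ : E → E} {B : Set E} (hB : IsOpen B)
    (hκ : ContDiffOn ℝ 1 κ B) {u : E} (hu : u ∈ B) (hinj : Function.Injective (fderiv ℝ κ u)) :
    ∃ e : OpenPartialHomeomorph E E, (e : E → E) = κ ∧ u ∈ e.source ∧ e.source ⊆ B ∧
      ContDiffOn ℝ 1 e.symm e.target ∧ ∀ v ∈ e.source, Function.Injective (fderiv ℝ κ v) := by
  have : CompleteSpace E := FiniteDimensional.complete ℝ E
  set A : (E →L[ℝ] E) := fderiv ℝ κ u
  let A' : E ≃L[ℝ] E := (LinearEquiv.ofInjectiveEndo A.toLinearMap hinj).toContinuousLinearEquiv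
  have hA' : (A' : E →L[ℝ] E) = A := by ext x; rfl
  have hκu : ContDiffAt ℝ 1 κ u := hκ.contDiffAt (hB.mem_nhds hu)
  have hd : HasFDerivAt κ (A' : E →L[ℝ] E) u := by
    rw [hA']; exact (hκu.differentiableAt one_ne_zero).hasFDerivAt
  let e0 := hκu.toOpenPartialHomeomorph κ hd one_ne_zero
  have hc : ContinuousOn (fderiv ℝ κ) B := hκ.continuousOn_fderiv_of_isOpen hB le_rfl
  have hU : IsOpen (range ((↑) : (E ≃L[ℝ] E) → E →L[ℝ] E)) := ContinuousLinearEquiv.isOpen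
  let O := B ∩ fderiv ℝ κ ⁻¹' (range ((↑) : (E ≃L[ℝ] E) → E →L[ℝ] E))
  have hO : IsOpen O := hc.isOpen_inter_preimage hB hU
  let e := e0.restrOpen O hO
  have hes : e.source = e0.source ∩ O := e0.restrOpen_source O hO
  have he : (e : E → E) = κ := rfl
  refine ⟨e, he, ?_, ?_, ?_, ?_⟩
  · rw [hes]
    exact ⟨hκu.mem_toOpenPartialHomeomorph_source hd one_ne_zero, hu, A', hA'⟩
  · rw [hes]; exact fun v hv => hv.2.1
  · intro y hy
    have hv : e.symm y ∈ e.source := e.map_target hy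
    rw [hes] at hv
    obtain ⟨C, hC⟩ := hv.2.2
    have hκv : ContDiffAt ℝ 1 κ (e.symm y) := hκ.contDiffAt (hB.mem_nhds hv.2.1)
    refine (e.contDiffAt_symm hy (f₀' := C) ?_ hκv).contDiffWithinAt
    rw [hC]; exact (hκv.differentiableAt one_ne_zero).hasFDerivAt
  · intro v hv
    rw [hes] at hv
    obtain ⟨C, hC⟩ := hv.2.2
    rw [← hC]; exact C.injective

/-- An immersed plane `C^1` patch has a `C^1` local left inverse. -/
theorem exists_leftInverse {ψ : E2 → E3} {B₀ : Set E2} (hB₀ : IsOpen B₀)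
    (hψ : ContDiffOn ℝ 1 ψ B₀) {u : E2} (hu : u ∈ B₀)
    (hinj : Function.Injective (fderiv ℝ ψ u)) :
    ∃ (ρ : E3 → E2) (O : Set E3) (B : Set E2), IsOpen O ∧ IsOpen B ∧ u ∈ B ∧ B ⊆ B₀ ∧
      ContDiffOn ℝ 1 ρ O ∧ (∀ v ∈ B, ψ v ∈ O ∧ ρ (ψ v) = v) ∧
      ∀ v ∈ B, Function.Injective (fderiv ℝ ψ v) := by
  -- With a linear left inverse `L` of the derivative, `L ∘ ψ` is a local diffeomorphism of the
  -- plane; its inverse composed with `L` is the retraction.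
  obtain ⟨L, hL⟩ := (fderiv ℝ ψ u).toLinearMap.exists_leftInverse_of_injective
    (LinearMap.ker_eq_bot.2 hinj)
  let L' : E3 →L[ℝ] E2 := LinearMap.toContinuousLinearMap L
  have hL' : ∀ x, L' (fderiv ℝ ψ u x) = x := fun x => LinearMap.congr_fun hL x
  have hκ : ContDiffOn ℝ 1 (fun v => L' (ψ v)) B₀ := L'.contDiff.comp_contDiffOn hψ
  have hdψ : ∀ v ∈ B₀, DifferentiableAt ℝ ψ v := fun v hv =>
    (hψ.contDiffAt (hB₀.mem_nhds hv)).differentiableAt one_ne_zero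
  have hder : ∀ v ∈ B₀, fderiv ℝ (fun v => L' (ψ v)) v = L'.comp (fderiv ℝ ψ v) := fun v hv =>
    (L'.hasFDerivAt.comp v (hdψ v hv).hasFDerivAt).fderiv
  obtain ⟨e, he, hue, heB, hsymm, hei⟩ := exists_openPartialHomeomorph hB₀ hκ hu (by
    rw [hder u hu]; exact Function.LeftInverse.injective (g := id) hL')
  refine ⟨fun y => e.symm (L' y), L' ⁻¹' e.target, e.source,
    e.open_target.preimage L'.continuous, e.open_source, hue, heB,
    hsymm.comp L'.contDiff.contDiffOn fun y hy => hy, ?_, ?_⟩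
  · intro v hv
    have h1 : L' (ψ v) = e v := by rw [he]
    refine ⟨?_, ?_⟩
    · rw [mem_preimage, h1]; exact e.map_source hv
    · change e.symm (L' (ψ v)) = v
      rw [h1]; exact e.left_inv hv
  · intro v hv
    have := hei v hv
    rw [hder v (heB hv)] at this
    exact Function.Injective.of_comp (f := L') this

theorem isEmbedding_domRestrict_of_leftInvOn {X Y : Type*} [TopologicalSpace X]
    [TopologicalSpace Y] {ψ : X → Y} {ρ : Y → X} {B : Set X} {O : Set Y} (hψ : ContinuousOn ψ B)
    (hρ : ContinuousOn ρ O) (h : ∀ v ∈ B, ψ v ∈ O ∧ ρ (ψ v) = v) :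
    Topology.IsEmbedding (B.domRestrict ψ) := by
  let ψ' : B → O := fun v => ⟨ψ v, (h v v.2).1⟩
  have hψ' : Continuous ψ' := (continuousOn_iff_continuous_domRestrict.1 hψ).subtype_mk _
  have hcomp : (O.domRestrict ρ) ∘ ψ' = Subtype.val := by
    ext v; exact (h v v.2).2
  have h1 : Topology.IsEmbedding ψ' := Topology.IsEmbedding.of_comp hψ'
    (continuousOn_iff_continuous_domRestrict.1 hρ) (by rw [hcomp]; exact .subtypeVal)
  exact Topology.IsEmbedding.subtypeVal.comp h1

/-! ### Local parametrisations -/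

namespace IsLocalParam

variable {n : WithTop ℕ∞} {S Γ V : Set E3} {W : Set E2} {φ : E2 → E3}

theorem injOn (h : IsLocalParam n S Γ V W φ) : InjOn φ (W ∩ halfPlane) :=
  injOn_iff_injective.2 h.isEmbedding.injective

theorem mapsTo (h : IsLocalParam n S Γ V W φ) {u : E2} (hu : u ∈ W ∩ halfPlane) :
    φ u ∈ S ∩ V := h.image_eq ▸ mem_image_of_mem φ hu

theorem mapsTo_edge (h : IsLocalParam n S Γ V W φ) {u : E2} (hu : u ∈ W ∩ edge) :
    φ u ∈ Γ ∩ V := h.image_edge_eq ▸ mem_image_of_mem φ hu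

theorem mem_iff_mem_edge (h : IsLocalParam n S Γ V W φ) {u : E2} (hu : u ∈ W ∩ halfPlane) :
    φ u ∈ Γ ↔ u ∈ edge := by
  constructor
  · intro hΓ
    have : φ u ∈ φ '' (W ∩ edge) := by rw [h.image_edge_eq]; exact ⟨hΓ, (h.mapsTo hu).2⟩
    obtain ⟨v, hv, hvu⟩ := this
    rw [← h.injOn ⟨hv.1, edge_subset_halfPlane hv.2⟩ hu hvu]; exact hv.2
  · exact fun he => (h.mapsTo_edge ⟨hu.1, he⟩).1

/-- Patches can be shrunk: by the embedding property an open part of the parameter domain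
corresponds to the trace on `S` of an open set of space. -/
theorem exists_image_eq (h : IsLocalParam n S Γ V W φ) {B : Set E2} (hB : IsOpen B)
    (hBW : B ⊆ W) : ∃ V' : Set E3, IsOpen V' ∧ V' ⊆ V ∧ φ '' (B ∩ halfPlane) = S ∩ V' := by
  obtain ⟨O, hO, hOB⟩ := h.isEmbedding.isInducing.isOpen_iff.1
    (hB.preimage (continuous_subtype_val (p := fun u => u ∈ W ∩ halfPlane)))
  have key : ∀ v ∈ W ∩ halfPlane, φ v ∈ O ↔ v ∈ B := fun v hv =>
    Set.ext_iff.1 hOB ⟨v, hv⟩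
  refine ⟨O ∩ V, hO.inter h.isOpen_target, inter_subset_right, ?_⟩
  ext y
  constructor
  · rintro ⟨v, hv, rfl⟩
    have hv' : v ∈ W ∩ halfPlane := ⟨hBW hv.1, hv.2⟩
    exact ⟨(h.mapsTo hv').1, (key v hv').2 hv.1, (h.mapsTo hv').2⟩
  · rintro ⟨hS, hyO, hV⟩
    have : y ∈ φ '' (W ∩ halfPlane) := by rw [h.image_eq]; exact ⟨hS, hV⟩
    obtain ⟨v, hv, rfl⟩ := this
    exact ⟨v, ⟨(key v hv).1 hyO, hv.2⟩, rfl⟩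

theorem immersive' (h : IsLocalParam n S Γ V W φ) {u : E2} (hu : u ∈ W ∩ halfPlane) :
    Function.Injective (fderivWithin ℝ φ halfPlane u) := by
  rw [← fderivWithin_inter_halfPlane h.isOpen_source hu.1]; exact h.immersive u hu

theorem differentiableWithinAt (h : IsLocalParam n S Γ V W φ) (hn : n ≠ 0) {u : E2}
    (hu : u ∈ W ∩ halfPlane) : DifferentiableWithinAt ℝ φ halfPlane u := by
  have := h.contDiffOn.differentiableOn hn u hu
  rwa [inter_comm, differentiableWithinAt_inter (h.isOpen_source.mem_nhds hu.1)] at this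

/-- A parametrised surface has a local `C^1` retraction to its parameter domain. -/
theorem exists_retraction (h : IsLocalParam n S Γ V W φ) (hn : 1 ≤ n) {u : E2}
    (hu : u ∈ W ∩ halfPlane) {B₀ : Set E2} (hB₀ : B₀ ∈ 𝓝 u) :
    ∃ (ρ : E3 → E2) (O : Set E3) (B : Set E2), IsOpen O ∧ IsOpen B ∧ u ∈ B ∧ B ⊆ W ∧ B ⊆ B₀ ∧
      O ⊆ V ∧ ContDiffOn ℝ 1 ρ O ∧ (∀ v ∈ B ∩ halfPlane, φ v ∈ O ∧ ρ (φ v) = v) ∧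
      ∀ y ∈ S ∩ O, ρ y ∈ B ∩ halfPlane ∧ φ (ρ y) = y := by
  -- The inverse function theorem needs an open domain, hence the extension across the edge.
  obtain ⟨ψ, B₁, hB₁, huB₁, hB₁W, hψ, hEq⟩ :=
    exists_contDiffOn_extension h.isOpen_source (h.contDiffOn.of_le hn) hu
  have hψu : DifferentiableAt ℝ ψ u :=
    (hψ.contDiffAt (hB₁.mem_nhds huB₁)).differentiableAt one_ne_zero
  have hder : fderivWithin ℝ φ halfPlane u = fderiv ℝ ψ u := by
    refine fderivWithin_halfPlane_eq_fderiv hu.2 hψu ?_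
    filter_upwards [self_mem_nhdsWithin, mem_nhdsWithin_of_mem_nhds (hB₁.mem_nhds huB₁)]
      with v hv hv' using hEq ⟨hv', hv⟩
  obtain ⟨ρ, O₂, B₂, hO₂, hB₂, huB₂, hB₂₁, hρ, hleft, -⟩ := exists_leftInverse hB₁ hψ huB₁
    (by rw [← hder]; exact h.immersive' hu)
  let B := B₂ ∩ interior B₀
  have hB : IsOpen B := hB₂.inter isOpen_interior
  -- Other sheets of `S` could enter the domain of the left inverse; inside `V'` only the points
  -- parametrised by `B` remain.
  obtain ⟨V', hV', hV'V, him⟩ := h.exists_image_eq hB (fun v hv => hB₁W (hB₂₁ hv.1))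
  refine ⟨ρ, O₂ ∩ V', B, hO₂.inter hV', hB, ⟨huB₂, mem_interior_iff_mem_nhds.2 hB₀⟩,
    fun v hv => hB₁W (hB₂₁ hv.1), fun v hv => interior_subset hv.2, fun y hy => hV'V hy.2,
    hρ.mono inter_subset_left, ?_, ?_⟩
  · intro v hv
    have hvψ : φ v = ψ v := hEq ⟨hB₂₁ hv.1.1, hv.2⟩
    have hvV : φ v ∈ S ∩ V' := him ▸ mem_image_of_mem φ hv
    refine ⟨⟨?_, hvV.2⟩, ?_⟩
    · rw [hvψ]; exact (hleft v hv.1.1).1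
    · rw [hvψ]; exact (hleft v hv.1.1).2
  · rintro y ⟨hyS, hyO, hyV⟩
    have : y ∈ φ '' (B ∩ halfPlane) := by rw [him]; exact ⟨hyS, hyV⟩
    obtain ⟨v, hv, rfl⟩ := this
    have hvψ : φ v = ψ v := hEq ⟨hB₂₁ hv.1.1, hv.2⟩
    have hρv : ρ (φ v) = v := by rw [hvψ]; exact (hleft v hv.1.1).2
    rw [hρv]; exact ⟨hv, rfl⟩

end IsLocalParam

end
end FlatExt

namespace FlatExt
noncomputable section

/-! ### Tangent planes -/

theorem inner_partialD_normalVec (φ : E2 → E3) (D : Set E2) (u : E2) (i : Fin 2) :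
    inner ℝ (partialD D i φ u) (normalVec D φ u) = 0 := by
  fin_cases i
  · exact inner_self_cross_left _ _
  · exact inner_self_cross_right _ _

theorem inner_fderivWithin_normalVec (φ : E2 → E3) (D : Set E2) (u x : E2) :
    inner ℝ (fderivWithin ℝ φ D u x) (normalVec D φ u) = 0 := by
  have h0 := inner_partialD_normalVec φ D u 0
  have h1 := inner_partialD_normalVec φ D u 1
  simp only [partialD] at h0 h1
  rw [map_E2, inner_add_left, inner_smul_left, inner_smul_left, h0, h1]; simp

theorem normalVec_ne_zero_iff (φ : E2 → E3) (D : Set E2) (u : E2) :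
    normalVec D φ u ≠ 0 ↔ Function.Injective (fderivWithin ℝ φ D u) :=
  (injective_iff_cross_ne_zero _).symm

namespace IsLocalParam

variable {n : WithTop ℕ∞} {S Γ V : Set E3} {W : Set E2} {φ : E2 → E3}

theorem normalVec_ne_zero (h : IsLocalParam n S Γ V W φ) {u : E2} (hu : u ∈ W ∩ halfPlane) :
    normalVec halfPlane φ u ≠ 0 :=
  (normalVec_ne_zero_iff _ _ _).2 (h.immersive' hu)

/-- A map into a surface is tangent to it. -/
theorem exists_fderivWithin_eq (h : IsLocalParam n S Γ V W φ) (hn : 1 ≤ n) {u : E2}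
    (hu : u ∈ W ∩ halfPlane) {φ' : E2 → E3} {u' : E2} (hu' : u' ∈ halfPlane)
    (hd : DifferentiableWithinAt ℝ φ' halfPlane u') (he : φ' u' = φ u)
    (hS : ∀ᶠ v in 𝓝[halfPlane] u', φ' v ∈ S) (x : E2) :
    ∃ y, fderivWithin ℝ φ' halfPlane u' x = fderivWithin ℝ φ halfPlane u y := by
  -- Near `u'` one has φ' = φ ∘ ρ ∘ φ', and the chain rule places the derivative of φ' in the range
  -- of that of φ.
  obtain ⟨ρ, O, B, hO, hB, huB, -, -, -, hρ, hleft, hret⟩ :=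
    h.exists_retraction hn hu Filter.univ_mem
  have huO := (hleft u ⟨huB, hu.2⟩).1
  have hev : ∀ᶠ v in 𝓝[halfPlane] u', φ' v ∈ S ∩ O :=
    hS.and (hd.continuousWithinAt.eventually (by rw [he]; exact hO.mem_nhds huO))
  have hdρ : HasFDerivAt ρ (fderiv ℝ ρ (φ u)) (φ' u') := by
    rw [he]
    exact ((hρ.contDiffAt (hO.mem_nhds huO)).differentiableAt one_ne_zero).hasFDerivAt
  have hρu : ρ (φ' u') = u := by rw [he]; exact (hleft u ⟨huB, hu.2⟩).2
  have h1 : HasFDerivWithinAt (fun v => ρ (φ' v))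
      ((fderiv ℝ ρ (φ u)).comp (fderivWithin ℝ φ' halfPlane u')) halfPlane u' :=
    hdρ.comp_hasFDerivWithinAt u' hd.hasFDerivWithinAt
  have h2 : HasFDerivWithinAt φ (fderivWithin ℝ φ halfPlane u) halfPlane (ρ (φ' u')) := by
    rw [hρu]
    exact (h.differentiableWithinAt (by rintro rfl; simp at hn) hu).hasFDerivWithinAt
  have h3 : HasFDerivWithinAt (fun v => φ (ρ (φ' v)))
      ((fderivWithin ℝ φ halfPlane u).comp
        ((fderiv ℝ ρ (φ u)).comp (fderivWithin ℝ φ' halfPlane u'))) halfPlane u' := by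
    refine HasFDerivWithinAt.comp_of_tendsto u' h2 h1 ?_
    refine tendsto_nhdsWithin_iff.2 ⟨h1.continuousWithinAt, ?_⟩
    filter_upwards [hev] with v hv using (hret _ hv).1.2
  have h4 : HasFDerivWithinAt φ' ((fderivWithin ℝ φ halfPlane u).comp
        ((fderiv ℝ ρ (φ u)).comp (fderivWithin ℝ φ' halfPlane u'))) halfPlane u' := by
    refine h3.congr_of_eventuallyEq ?_ ?_
    · filter_upwards [hev] with v hv using (hret _ hv).2.symm
    · rw [hρu, he]
  refine ⟨fderiv ℝ ρ (φ u) (fderivWithin ℝ φ' halfPlane u' x), ?_⟩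
  have := h4.fderivWithin (uniqueDiffOn_halfPlane u' hu')
  conv_lhs => rw [this]
  rfl

/-- The normals of two patches are parallel at a common point if one lies in the other. -/
theorem exists_normalVec_eq_smul (h : IsLocalParam n S Γ V W φ) (hn : 1 ≤ n) {u : E2}
    (hu : u ∈ W ∩ halfPlane) {φ' : E2 → E3} {u' : E2} (hu' : u' ∈ halfPlane)
    (hd : DifferentiableWithinAt ℝ φ' halfPlane u')
    (hinj : Function.Injective (fderivWithin ℝ φ' halfPlane u')) (he : φ' u' = φ u)
    (hS : ∀ᶠ v in 𝓝[halfPlane] u', φ' v ∈ S) :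
    ∃ k : ℝ, k ≠ 0 ∧ normalVec halfPlane φ u = k • normalVec halfPlane φ' u' := by
  have hN' := (normalVec_ne_zero_iff φ' halfPlane u').2 hinj
  have hperp : ∀ i, inner ℝ (normalVec halfPlane φ u) (partialD halfPlane i φ' u') = 0 := by
    intro i
    obtain ⟨y, hy⟩ := h.exists_fderivWithin_eq hn hu hu' hd he hS (ee i)
    rw [real_inner_comm, partialD, hy, inner_fderivWithin_normalVec]
  have := eq_smul_cross_of_inner_eq_zero hN' (hperp 0) (hperp 1)
  refine ⟨_, ?_, this⟩
  intro hk
  rw [hk, zero_smul] at this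
  exact h.normalVec_ne_zero hu this

end IsLocalParam

/-- Both normals are compared with the normal of a chart of `T`. This is how the `C^1` condition on
an extension enters: its flat part and `S` share their tangent planes along the boundary. -/
theorem IsSurface.exists_normalVec_eq_smul {T : Set E3} (hT : IsSurface 1 T ∅)
    {φ₁ φ₂ : E2 → E3} {u₁ u₂ : E2} (hu₁ : u₁ ∈ halfPlane) (hu₂ : u₂ ∈ halfPlane)
    (hd₁ : DifferentiableWithinAt ℝ φ₁ halfPlane u₁)
    (hd₂ : DifferentiableWithinAt ℝ φ₂ halfPlane u₂)
    (hi₁ : Function.Injective (fderivWithin ℝ φ₁ halfPlane u₁))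
    (hi₂ : Function.Injective (fderivWithin ℝ φ₂ halfPlane u₂)) (he : φ₁ u₁ = φ₂ u₂)
    (h₁ : ∀ᶠ v in 𝓝[halfPlane] u₁, φ₁ v ∈ T) (h₂ : ∀ᶠ v in 𝓝[halfPlane] u₂, φ₂ v ∈ T) :
    ∃ k : ℝ, k ≠ 0 ∧ normalVec halfPlane φ₂ u₂ = k • normalVec halfPlane φ₁ u₁ := by
  have hmem : φ₁ u₁ ∈ T := h₁.self_of_nhdsWithin hu₁
  obtain ⟨V, W, ψ, hV, hψ⟩ := hT.2 _ hmem
  have : φ₁ u₁ ∈ ψ '' (W ∩ halfPlane) := by rw [hψ.image_eq]; exact ⟨hmem, hV⟩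
  obtain ⟨w, hw, hwe⟩ := this
  obtain ⟨k₁, hk₁, e₁⟩ := hψ.exists_normalVec_eq_smul le_rfl hw hu₁ hd₁ hi₁ hwe.symm h₁
  obtain ⟨k₂, hk₂, e₂⟩ := hψ.exists_normalVec_eq_smul le_rfl hw hu₂ hd₂ hi₂
    (he.symm.trans hwe.symm) h₂
  refine ⟨k₂⁻¹ * k₁, mul_ne_zero (inv_ne_zero hk₂) hk₁, ?_⟩
  rw [mul_smul, ← e₁, e₂, smul_smul, inv_mul_cancel₀ hk₂, one_smul]

/-! ### Curves and normals along the edge -/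

/-- The curve along the edge of a patch. -/
def edgeCurve (φ : E2 → E3) (t : ℝ) : E3 := φ (pt 0 t)

/-- The normal of a patch along the edge. -/
def edgeNormal (φ : E2 → E3) (t : ℝ) : E3 := normalVec halfPlane φ (pt 0 t)

/-- The characteristic set of the tangent planes of a patch along its edge. -/
def edgeChar (φ : E2 → E3) (t : ℝ) : Set E3 :=
  {x | inner ℝ (x - edgeCurve φ t) (edgeNormal φ t) = 0 ∧
    inner ℝ (x - edgeCurve φ t) (deriv (edgeNormal φ) t) = 0}

/-- The vector product of the first two derivatives of the edge curve. -/
def edgeBinormal (φ : E2 → E3) (t : ℝ) : E3 :=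
  cross (deriv (edgeCurve φ) t) (deriv (deriv (edgeCurve φ)) t)

theorem contDiff_pt_zero : ContDiff ℝ ω (fun t : ℝ => pt 0 t) :=
  contDiff_pt.comp (contDiff_const.prodMk contDiff_id)

theorem hasDerivAt_pt (s t : ℝ) : HasDerivAt (fun t : ℝ => pt s t) (ee 1) t := by
  simp only [pt_eq]
  simpa using ((hasDerivAt_id t).smul_const (ee 1)).const_add (s • ee 0)

theorem isOpen_pt_preimage {W : Set E2} (hW : IsOpen W) : IsOpen {t : ℝ | pt 0 t ∈ W} :=
  hW.preimage contDiff_pt_zero.continuous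

theorem hasDerivAt_comp_pt {F : Type*} [NormedAddCommGroup F] [NormedSpace ℝ F] {g : E2 → F}
    {t : ℝ} (hg : DifferentiableWithinAt ℝ g halfPlane (pt 0 t)) :
    HasDerivAt (fun t => g (pt 0 t)) (fderivWithin ℝ g halfPlane (pt 0 t) (ee 1)) t :=
  hg.hasFDerivWithinAt.comp_hasDerivAt t (hasDerivAt_pt 0 t)
    (Filter.Eventually.of_forall fun _ => edge_subset_halfPlane (pt_mem_edge t))

theorem contDiffOn_comp_pt {F : Type*} [NormedAddCommGroup F] [NormedSpace ℝ F] {g : E2 → F}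
    {W : Set E2} {m : WithTop ℕ∞} (hg : ContDiffOn ℝ m g (W ∩ halfPlane)) :
    ContDiffOn ℝ m (fun t => g (pt 0 t)) {t | pt 0 t ∈ W} :=
  hg.comp (contDiff_pt_zero.of_le le_top).contDiffOn
    fun _ ht => ⟨ht, edge_subset_halfPlane (pt_mem_edge _)⟩

namespace IsLocalParam

variable {S Γ V : Set E3} {W : Set E2} {φ : E2 → E3}

theorem mem_of_pt {t : ℝ} (ht : pt 0 t ∈ W) :
    pt 0 t ∈ W ∩ halfPlane :=
  ⟨ht, edge_subset_halfPlane (pt_mem_edge t)⟩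

theorem contDiffOn_edgeCurve (h : IsLocalParam ∞ S Γ V W φ) :
    ContDiffOn ℝ ∞ (edgeCurve φ) {t | pt 0 t ∈ W} :=
  contDiffOn_comp_pt h.contDiffOn

theorem contDiffOn_edgeNormal (h : IsLocalParam ∞ S Γ V W φ) :
    ContDiffOn ℝ ∞ (edgeNormal φ) {t | pt 0 t ∈ W} :=
  (contDiffOn_comp_pt (contDiffOn_normalVec h.isOpen_source h.contDiffOn)).congr fun _ ht =>
    (normalVec_inter_halfPlane h.isOpen_source ht φ).symm

theorem contDiffOn_deriv_edgeCurve (h : IsLocalParam ∞ S Γ V W φ) :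
    ContDiffOn ℝ ∞ (deriv (edgeCurve φ)) {t | pt 0 t ∈ W} :=
  h.contDiffOn_edgeCurve.deriv_of_isOpen (isOpen_pt_preimage h.isOpen_source) (by simp)

theorem contDiffOn_deriv_edgeNormal (h : IsLocalParam ∞ S Γ V W φ) :
    ContDiffOn ℝ ∞ (deriv (edgeNormal φ)) {t | pt 0 t ∈ W} :=
  h.contDiffOn_edgeNormal.deriv_of_isOpen (isOpen_pt_preimage h.isOpen_source) (by simp)

theorem hasDerivAt_edgeCurve (h : IsLocalParam ∞ S Γ V W φ) {t : ℝ} (ht : pt 0 t ∈ W) :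
    HasDerivAt (edgeCurve φ) (partialD halfPlane 1 φ (pt 0 t)) t :=
  hasDerivAt_comp_pt (h.differentiableWithinAt (by simp) (mem_of_pt ht))

theorem deriv_edgeCurve (h : IsLocalParam ∞ S Γ V W φ) {t : ℝ} (ht : pt 0 t ∈ W) :
    deriv (edgeCurve φ) t = partialD halfPlane 1 φ (pt 0 t) :=
  (h.hasDerivAt_edgeCurve ht).deriv

theorem hasDerivAt_edgeNormal (h : IsLocalParam ∞ S Γ V W φ) {t : ℝ} (ht : pt 0 t ∈ W) :
    HasDerivAt (edgeNormal φ) (deriv (edgeNormal φ) t) t :=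
  ((h.contDiffOn_edgeNormal.contDiffAt ((isOpen_pt_preimage h.isOpen_source).mem_nhds
    ht)).differentiableAt (by simp)).hasDerivAt

theorem hasDerivAt_deriv_edgeCurve (h : IsLocalParam ∞ S Γ V W φ) {t : ℝ} (ht : pt 0 t ∈ W) :
    HasDerivAt (deriv (edgeCurve φ)) (deriv (deriv (edgeCurve φ)) t) t :=
  ((h.contDiffOn_deriv_edgeCurve.contDiffAt ((isOpen_pt_preimage h.isOpen_source).mem_nhds
    ht)).differentiableAt (by simp)).hasDerivAt

theorem deriv_edgeCurve_ne_zero (h : IsLocalParam ∞ S Γ V W φ) {t : ℝ} (ht : pt 0 t ∈ W) :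
    deriv (edgeCurve φ) t ≠ 0 := by
  rw [h.deriv_edgeCurve ht]
  intro h0
  have : ee 1 = 0 := h.immersive' (mem_of_pt ht) (by rw [map_zero]; exact h0)
  simpa using congrArg (fun u : E2 => u 1) this

theorem edgeNormal_ne_zero (h : IsLocalParam ∞ S Γ V W φ) {t : ℝ} (ht : pt 0 t ∈ W) :
    edgeNormal φ t ≠ 0 := h.normalVec_ne_zero (mem_of_pt ht)

theorem inner_deriv_edgeCurve_edgeNormal (h : IsLocalParam ∞ S Γ V W φ) {t : ℝ}
    (ht : pt 0 t ∈ W) : inner ℝ (deriv (edgeCurve φ) t) (edgeNormal φ t) = 0 := by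
  rw [h.deriv_edgeCurve ht]; exact inner_partialD_normalVec _ _ _ 1

/-- Differentiating the orthogonality of the edge curve and the normal. -/
theorem inner_deriv_deriv_edgeCurve_edgeNormal (h : IsLocalParam ∞ S Γ V W φ) {t : ℝ}
    (ht : pt 0 t ∈ W) : (inner ℝ (deriv (deriv (edgeCurve φ)) t) (edgeNormal φ t) : ℝ) =
      - inner ℝ (deriv (edgeCurve φ) t) (deriv (edgeNormal φ) t) := by
  have h1 := (h.hasDerivAt_deriv_edgeCurve ht).inner ℝ (h.hasDerivAt_edgeNormal ht)
  have h2 : (fun t => (inner ℝ (deriv (edgeCurve φ) t) (edgeNormal φ t) : ℝ)) =ᶠ[𝓝 t] fun _ => 0 := by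
    filter_upwards [(isOpen_pt_preimage h.isOpen_source).mem_nhds ht] with s hs
      using h.inner_deriv_edgeCurve_edgeNormal hs
  have h3 := h1.unique ((hasDerivAt_const t (0 : ℝ)).congr_of_eventuallyEq h2)
  linarith

/-- The term with γ' vanishes since γ' is tangent; thus the envelope condition is the second linear
equation in `edgeChar`. -/
theorem deriv_inner_sub_edgeCurve (h : IsLocalParam ∞ S Γ V W φ) {t : ℝ} (ht : pt 0 t ∈ W)
    (x : E3) : deriv (fun t => (inner ℝ (x - edgeCurve φ t) (edgeNormal φ t) : ℝ)) t =
      inner ℝ (x - edgeCurve φ t) (deriv (edgeNormal φ) t) := by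
  have h1 := ((h.hasDerivAt_edgeCurve ht).const_sub x).inner ℝ (h.hasDerivAt_edgeNormal ht)
  rw [h1.deriv, inner_neg_left]
  have : inner ℝ (partialD halfPlane 1 φ (pt 0 t)) (edgeNormal φ t) = 0 :=
    inner_partialD_normalVec _ _ _ 1
  rw [this]; simp

end IsLocalParam

/-! ### Changing the parametrisation of the edge -/

/-- Two parametrisations of the same boundary curve differ by a change of the parameter. -/
theorem IsLocalParam.exists_reparam {n₂ : WithTop ℕ∞} {S₁ Γ₁ V₁ S₂ Γ₂ V₂ : Set E3} {W₁ W₂ : Set E2}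
    {φ₁ φ₂ : E2 → E3} (h₁ : IsLocalParam ∞ S₁ Γ₁ V₁ W₁ φ₁)
    (h₂ : IsLocalParam n₂ S₂ Γ₂ V₂ W₂ φ₂) (hn₂ : 1 ≤ n₂) (hΓ : Γ₂ ⊆ Γ₁) (hΓS : Γ₁ ⊆ S₁)
    {b₁ b₂ : ℝ} (hb₁ : pt 0 b₁ ∈ W₁) (hb₂ : pt 0 b₂ ∈ W₂)
    (he : edgeCurve φ₁ b₁ = edgeCurve φ₂ b₂) :
    ∃ τ : ℝ → ℝ, τ b₂ = b₁ ∧ ContinuousAt τ b₂ ∧ ∀ᶠ t in 𝓝 b₂, pt 0 (τ t) ∈ W₁ ∧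
      DifferentiableAt ℝ τ t ∧ edgeCurve φ₂ t = edgeCurve φ₁ (τ t) := by
  obtain ⟨ρ, O, B, hO, hB, huB, hBW, -, -, hρ, hleft, hret⟩ :=
    h₁.exists_retraction (by simp) (mem_of_pt hb₁) Filter.univ_mem
  have hbO : edgeCurve φ₂ b₂ ∈ O := by
    rw [← he]; exact (hleft _ ⟨huB, edge_subset_halfPlane (pt_mem_edge _)⟩).1
  have hn₂' : n₂ ≠ 0 := by rintro rfl; simp at hn₂
  have hd₂ : ∀ t, pt 0 t ∈ W₂ → DifferentiableAt ℝ (edgeCurve φ₂) t := fun t ht =>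
    (hasDerivAt_comp_pt (h₂.differentiableWithinAt hn₂' (mem_of_pt ht))).differentiableAt
  have hdτ : ∀ t, pt 0 t ∈ W₂ → edgeCurve φ₂ t ∈ O →
      DifferentiableAt ℝ (fun t => ρ (edgeCurve φ₂ t) 1) t := fun t ht hO' => by
    have h1 : DifferentiableAt ℝ ρ (edgeCurve φ₂ t) :=
      (hρ.contDiffAt (hO.mem_nhds hO')).differentiableAt one_ne_zero
    have h2 : DifferentiableAt ℝ (fun t => ρ (edgeCurve φ₂ t)) t := h1.comp t (hd₂ t ht)
    exact (cc 1).differentiableAt.comp t h2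
  -- The second curve is read in the chart φ₁. Its points are boundary points, so their coordinates
  -- lie on the edge and the second coordinate is the new parameter.
  refine ⟨fun t => ρ (edgeCurve φ₂ t) 1, ?_, (hdτ b₂ hb₂ hbO).continuousAt, ?_⟩
  · change ρ (edgeCurve φ₂ b₂) 1 = b₁
    rw [← he, edgeCurve, (hleft _ ⟨huB, edge_subset_halfPlane (pt_mem_edge _)⟩).2, pt_one]
  · filter_upwards [(isOpen_pt_preimage h₂.isOpen_source).mem_nhds hb₂,
      (hd₂ b₂ hb₂).continuousAt.eventually (hO.mem_nhds hbO)] with t ht htO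
    have hΓt : edgeCurve φ₂ t ∈ Γ₁ := hΓ (h₂.mapsTo_edge ⟨ht, pt_mem_edge t⟩).1
    obtain ⟨hm, hφ⟩ := hret _ ⟨hΓS hΓt, htO⟩
    have hedge : ρ (edgeCurve φ₂ t) ∈ edge :=
      (h₁.mem_iff_mem_edge ⟨hBW hm.1, hm.2⟩).1 (by rw [hφ]; exact hΓt)
    have hpt : pt 0 (ρ (edgeCurve φ₂ t) 1) = ρ (edgeCurve φ₂ t) := (eq_pt_of_mem_edge hedge).symm
    refine ⟨?_, hdτ t ht htO, ?_⟩
    · rw [hpt]; exact hBW hm.1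
    · change edgeCurve φ₂ t = φ₁ (pt 0 (ρ (edgeCurve φ₂ t) 1))
      rw [hpt, hφ]

section Reparam

variable {S₁ Γ₁ V₁ S₂ Γ₂ V₂ : Set E3} {W₁ W₂ : Set E2} {φ₁ φ₂ : E2 → E3} {τ : ℝ → ℝ} {b : ℝ}

theorem deriv_edgeCurve_reparam
    (h₁ : IsLocalParam ∞ S₁ Γ₁ V₁ W₁ φ₁)
    (hb₁ : pt 0 (τ b) ∈ W₁) (hτ : DifferentiableAt ℝ τ b)
    (he : ∀ᶠ t in 𝓝 b, edgeCurve φ₂ t = edgeCurve φ₁ (τ t)) :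
    deriv (edgeCurve φ₂) b = deriv τ b • deriv (edgeCurve φ₁) (τ b) := by
  have h := HasDerivAt.scomp b (h₁.hasDerivAt_edgeCurve hb₁) hτ.hasDerivAt
  have h' : HasDerivAt (edgeCurve φ₂) _ b := h.congr_of_eventuallyEq he
  rw [h'.deriv, h₁.deriv_edgeCurve hb₁]

theorem deriv_reparam_ne_zero
    (h₁ : IsLocalParam ∞ S₁ Γ₁ V₁ W₁ φ₁) (h₂ : IsLocalParam ∞ S₂ Γ₂ V₂ W₂ φ₂)
    (hb₁ : pt 0 (τ b) ∈ W₁) (hb₂ : pt 0 b ∈ W₂) (hτ : DifferentiableAt ℝ τ b)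
    (he : ∀ᶠ t in 𝓝 b, edgeCurve φ₂ t = edgeCurve φ₁ (τ t)) :
    deriv τ b ≠ 0 := by
  intro h0
  have := deriv_edgeCurve_reparam h₁ hb₁ hτ he
  rw [h0, zero_smul] at this
  exact h₂.deriv_edgeCurve_ne_zero hb₂ this

/-- The product of the first two derivatives is multiplied by the cube of τ', the term with γ₁' ×
γ₁' being zero. -/
theorem edgeBinormal_reparam
    (h₁ : IsLocalParam ∞ S₁ Γ₁ V₁ W₁ φ₁) (h₂ : IsLocalParam ∞ S₂ Γ₂ V₂ W₂ φ₂)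
    (hb₁ : pt 0 (τ b) ∈ W₁) (hb₂ : pt 0 b ∈ W₂) (hτ : DifferentiableAt ℝ τ b)
    (he : ∀ᶠ t in 𝓝 b, edgeCurve φ₂ t = edgeCurve φ₁ (τ t))
    (hτ' : ∀ᶠ t in 𝓝 b, DifferentiableAt ℝ τ t) :
    edgeBinormal φ₂ b ≠ 0 ↔ edgeBinormal φ₁ (τ b) ≠ 0 := by
  let c₁ := deriv (edgeCurve φ₁)
  let c₂ := deriv (edgeCurve φ₂)
  -- τ is only known to be differentiable. Writing τ' as a quotient of inner products shows that it
  -- can be differentiated once more.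
  let k : ℝ → ℝ := fun t => inner ℝ (c₂ t) (c₁ (τ t)) / inner ℝ (c₁ (τ t)) (c₁ (τ t))
  have hc₁ : HasDerivAt (fun t => c₁ (τ t)) (deriv τ b • deriv c₁ (τ b)) b :=
    HasDerivAt.scomp b (h₁.hasDerivAt_deriv_edgeCurve hb₁) hτ.hasDerivAt
  have hne : ∀ t, pt 0 (τ t) ∈ W₁ → (inner ℝ (c₁ (τ t)) (c₁ (τ t)) : ℝ) ≠ 0 := fun t ht => by
    simpa using h₁.deriv_edgeCurve_ne_zero ht
  have hk : DifferentiableAt ℝ k b :=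
    (((h₂.hasDerivAt_deriv_edgeCurve hb₂).inner ℝ hc₁).differentiableAt).div
      (hc₁.inner ℝ hc₁).differentiableAt (hne b hb₁)
  have hev : ∀ᶠ t in 𝓝 b, c₂ t = k t • c₁ (τ t) := by
    filter_upwards [he.eventually_nhds, hτ', hτ.continuousAt.eventually
      ((isOpen_pt_preimage h₁.isOpen_source).mem_nhds hb₁)] with t ht htτ htW₁
    have h := deriv_edgeCurve_reparam h₁ htW₁ htτ ht
    have hk' : k t = deriv τ t := by
      change (inner ℝ (c₂ t) (c₁ (τ t)) : ℝ) / _ = _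
      rw [show c₂ t = deriv τ t • c₁ (τ t) from h, inner_smul_left]
      exact mul_div_cancel_right₀ _ (hne t htW₁)
    rw [hk']; exact h
  have hd : HasDerivAt c₂ (k b • (deriv τ b • deriv c₁ (τ b)) + deriv k b • c₁ (τ b)) b :=
    (hk.hasDerivAt.smul hc₁).congr_of_eventuallyEq hev
  have hk0 : k b ≠ 0 := by
    intro h0
    have := hev.self_of_nhds
    rw [h0, zero_smul] at this
    exact h₂.deriv_edgeCurve_ne_zero hb₂ this
  have hτ0 := deriv_reparam_ne_zero h₁ h₂ hb₁ hb₂ hτ he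
  have : edgeBinormal φ₂ b = (k b * (k b * deriv τ b)) • edgeBinormal φ₁ (τ b) := by
    change cross (c₂ b) (deriv c₂ b) = _ • cross (c₁ (τ b)) (deriv c₁ (τ b))
    rw [hd.deriv, hev.self_of_nhds, cross_add_right, cross_smul_right (deriv k b),
      cross_smul_left (k b) _ (c₁ (τ b)), cross_self, smul_zero, smul_zero, add_zero, smul_smul,
      cross_smul_left, cross_smul_right, smul_smul]
  rw [this]
  simp [hk0, hτ0]

/-- Product rule for n₂ = k n₁ ∘ τ. The factor is given pointwise without any regularity, which is
recovered by expressing it through inner products. -/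
theorem exists_deriv_edgeNormal_reparam
    (h₁ : IsLocalParam ∞ S₁ Γ₁ V₁ W₁ φ₁) (h₂ : IsLocalParam ∞ S₂ Γ₂ V₂ W₂ φ₂)
    (hb₁ : pt 0 (τ b) ∈ W₁) (hb₂ : pt 0 b ∈ W₂) (hτ : DifferentiableAt ℝ τ b)
    (hN : ∀ᶠ t in 𝓝 b, ∃ k : ℝ, k ≠ 0 ∧ edgeNormal φ₂ t = k • edgeNormal φ₁ (τ t)) :
    ∃ k l : ℝ, k ≠ 0 ∧
    edgeNormal φ₂ b = k • edgeNormal φ₁ (τ b) ∧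
    deriv (edgeNormal φ₂) b = (k * deriv τ b) • deriv (edgeNormal φ₁) (τ b) +
      l • edgeNormal φ₁ (τ b) := by
  let n₁ := edgeNormal φ₁
  let n₂ := edgeNormal φ₂
  let k : ℝ → ℝ := fun t => inner ℝ (n₂ t) (n₁ (τ t)) / inner ℝ (n₁ (τ t)) (n₁ (τ t))
  have hn₁ : HasDerivAt (fun t => n₁ (τ t)) (deriv τ b • deriv n₁ (τ b)) b :=
    HasDerivAt.scomp b (h₁.hasDerivAt_edgeNormal hb₁) hτ.hasDerivAt
  have hne : ∀ t, pt 0 (τ t) ∈ W₁ → (inner ℝ (n₁ (τ t)) (n₁ (τ t)) : ℝ) ≠ 0 := fun t ht => by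
    simpa using h₁.edgeNormal_ne_zero ht
  have hk : DifferentiableAt ℝ k b :=
    (((h₂.hasDerivAt_edgeNormal hb₂).inner ℝ hn₁).differentiableAt).div
      (hn₁.inner ℝ hn₁).differentiableAt (hne b hb₁)
  have hev : ∀ᶠ t in 𝓝 b, n₂ t = k t • n₁ (τ t) := by
    filter_upwards [hN, hτ.continuousAt.eventually
      ((isOpen_pt_preimage h₁.isOpen_source).mem_nhds hb₁)] with t ht htW₁
    obtain ⟨r, -, hr⟩ := ht
    have hk' : k t = r := by
      change (inner ℝ (n₂ t) (n₁ (τ t)) : ℝ) / _ = _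
      rw [show n₂ t = r • n₁ (τ t) from hr, inner_smul_left]
      exact mul_div_cancel_right₀ _ (hne t htW₁)
    rw [hk']; exact hr
  have hd : HasDerivAt n₂ (k b • (deriv τ b • deriv n₁ (τ b)) + deriv k b • n₁ (τ b)) b :=
    (hk.hasDerivAt.smul hn₁).congr_of_eventuallyEq hev
  have hk0 : k b ≠ 0 := by
    intro h0
    have := hev.self_of_nhds
    rw [h0, zero_smul] at this
    exact h₂.edgeNormal_ne_zero hb₂ this
  refine ⟨k b, deriv k b, hk0, hev.self_of_nhds, ?_⟩
  change deriv n₂ b = _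
  rw [hd.deriv, smul_smul]

/-- Modulo the normal, its derivative changes by a nonzero factor only, so the two equations keep
their solutions. The characteristic lines depend just on the tangent planes along the curve: this
serves both for changes of chart and for comparing `S` with the flat part of an extension. -/
theorem edgeChar_reparam
    (h₁ : IsLocalParam ∞ S₁ Γ₁ V₁ W₁ φ₁) (h₂ : IsLocalParam ∞ S₂ Γ₂ V₂ W₂ φ₂)
    (hb₁ : pt 0 (τ b) ∈ W₁) (hb₂ : pt 0 b ∈ W₂) (hτ : DifferentiableAt ℝ τ b)
    (he : ∀ᶠ t in 𝓝 b, edgeCurve φ₂ t = edgeCurve φ₁ (τ t))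
    (hN : ∀ᶠ t in 𝓝 b, ∃ k : ℝ, k ≠ 0 ∧ edgeNormal φ₂ t = k • edgeNormal φ₁ (τ t)) :
    edgeChar φ₂ b = edgeChar φ₁ (τ b) := by
  obtain ⟨k, l, hk, e, e'⟩ := exists_deriv_edgeNormal_reparam h₁ h₂ hb₁ hb₂ hτ hN
  have hτ0 := deriv_reparam_ne_zero h₁ h₂ hb₁ hb₂ hτ he
  ext x
  simp only [edgeChar, mem_ofPred_eq, he.self_of_nhds, e, e', inner_add_right, inner_smul_right,
    mul_eq_zero, hk, false_or]
  constructor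
  · rintro ⟨h0, h1⟩
    refine ⟨h0, ?_⟩
    rw [h0, mul_zero, add_zero] at h1
    exact (mul_eq_zero.1 h1).resolve_left (mul_ne_zero hk hτ0)
  · rintro ⟨h0, h1⟩
    exact ⟨h0, by rw [h0, h1]; simp⟩

/-- For the same reason the regularity of an edge parameter passes from `S` to the flat part of an
extension. -/
theorem inner_deriv_edgeNormal_reparam
    (h₁ : IsLocalParam ∞ S₁ Γ₁ V₁ W₁ φ₁) (h₂ : IsLocalParam ∞ S₂ Γ₂ V₂ W₂ φ₂)
    (hb₁ : pt 0 (τ b) ∈ W₁) (hb₂ : pt 0 b ∈ W₂) (hτ : DifferentiableAt ℝ τ b)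
    (he : ∀ᶠ t in 𝓝 b, edgeCurve φ₂ t = edgeCurve φ₁ (τ t))
    (hN : ∀ᶠ t in 𝓝 b, ∃ k : ℝ, k ≠ 0 ∧ edgeNormal φ₂ t = k • edgeNormal φ₁ (τ t)) :
    (inner ℝ (deriv (edgeCurve φ₂) b) (deriv (edgeNormal φ₂) b) : ℝ) ≠ 0 ↔
    (inner ℝ (deriv (edgeCurve φ₁) (τ b)) (deriv (edgeNormal φ₁) (τ b)) : ℝ) ≠ 0 := by
  obtain ⟨k, l, hk, e, e'⟩ := exists_deriv_edgeNormal_reparam h₁ h₂ hb₁ hb₂ hτ hN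
  have hτ0 := deriv_reparam_ne_zero h₁ h₂ hb₁ hb₂ hτ he
  rw [e', deriv_edgeCurve_reparam h₁ hb₁ hτ he, inner_add_right, inner_smul_right,
    inner_smul_right, inner_smul_left, inner_smul_left,
    h₁.inner_deriv_edgeCurve_edgeNormal hb₁]
  simp [hk, hτ0]

end Reparam

end
end FlatExt

/-! ### Existence: developable ruled surfaces and the envelope of the tangent planes. -/

namespace FlatExt
noncomputable section

/-! ### Ruled surfaces -/

/-- The ruled surface with base curve `c` and rulings in direction `ξ`. -/
def ruled (c ξ : ℝ → E3) (u : E2) : E3 := c (u 1) + u 0 • ξ (u 1)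

theorem isOpen_coord_preimage {J : Set ℝ} (hJ : IsOpen J) (i : Fin 2) : IsOpen {u : E2 | u i ∈ J} :=
  hJ.preimage (contDiff_coord i).continuous

theorem hasFDerivAt_comp_coord {f : ℝ → E3} {f' : E3} {u : E2} {i : Fin 2}
    (hf : HasDerivAt f f' (u i)) :
    HasFDerivAt (fun v : E2 => f (v i)) ((cc i).smulRight f') u :=
  hf.hasFDerivAt.comp u (cc i).hasFDerivAt |>.congr_fderiv (by
    ext x; simp)

section Ruled

variable {c ξ : ℝ → E3} {J : Set ℝ}

theorem contDiffOn_ruled {n : WithTop ℕ∞} (hc : ContDiffOn ℝ n c J) (hξ : ContDiffOn ℝ n ξ J) :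
    ContDiffOn ℝ n (ruled c ξ) {u | u 1 ∈ J} := by
  have h1 : ContDiffOn ℝ n (fun u : E2 => u 1) {u | u 1 ∈ J} :=
    ((contDiff_coord 1).of_le le_top).contDiffOn
  exact (hc.comp h1 fun u hu => hu).add
    (((contDiff_coord 0).of_le le_top).contDiffOn.smul (hξ.comp h1 fun u hu => hu))

theorem hasFDerivAt_ruled {c' ξ' : E3} {u : E2} (hc : HasDerivAt c c' (u 1))
    (hξ : HasDerivAt ξ ξ' (u 1)) :
    HasFDerivAt (ruled c ξ) ((cc 0).smulRight (ξ (u 1)) + (cc 1).smulRight (c' + u 0 • ξ')) u := by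
  have h := (hasFDerivAt_comp_coord hc).add
    ((cc 0).hasFDerivAt.smul (hasFDerivAt_comp_coord hξ) (x := u))
  refine HasFDerivAt.congr_fderiv h ?_
  apply E2_clm_ext <;> simp

/-- A ruled surface whose tangent planes are constant along the rulings is flat. -/
theorem gaussCurvature_ruled (hJ : IsOpen J) (hc : ContDiffOn ℝ ∞ c J) (hξ : ContDiffOn ℝ ∞ ξ J)
    (h0 : ∀ t ∈ J, inner ℝ (deriv ξ t) (cross (ξ t) (deriv c t)) = 0) {W : Set E2}
    (hW : IsOpen W) (hWJ : W ⊆ {u | u 1 ∈ J}) {u : E2} (hu : u ∈ W ∩ halfPlane) :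
    gaussCurvature (W ∩ halfPlane) (ruled c ξ) u = 0 := by
  have hdc : ∀ t ∈ J, HasDerivAt c (deriv c t) t := fun t ht =>
    ((hc.contDiffAt (hJ.mem_nhds ht)).differentiableAt (by simp)).hasDerivAt
  have hdξ : ∀ t ∈ J, HasDerivAt ξ (deriv ξ t) t := fun t ht =>
    ((hξ.contDiffAt (hJ.mem_nhds ht)).differentiableAt (by simp)).hasDerivAt
  have hdc' : ∀ t ∈ J, HasDerivAt (deriv c) (deriv (deriv c) t) t := fun t ht =>
    (((hc.deriv_of_isOpen hJ (m := ∞) (by simp)).contDiffAt (hJ.mem_nhds ht)).differentiableAt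
      (by simp)).hasDerivAt
  have hdξ' : ∀ t ∈ J, HasDerivAt (deriv ξ) (deriv (deriv ξ) t) t := fun t ht =>
    (((hξ.deriv_of_isOpen hJ (m := ∞) (by simp)).contDiffAt (hJ.mem_nhds ht)).differentiableAt
      (by simp)).hasDerivAt
  have hud := uniqueDiffOn_inter_halfPlane hW
  have hD : ∀ v ∈ W ∩ halfPlane, fderivWithin ℝ (ruled c ξ) (W ∩ halfPlane) v =
      (cc 0).smulRight (ξ (v 1)) + (cc 1).smulRight (deriv c (v 1) + v 0 • deriv ξ (v 1)) :=
    fun v hv => (hasFDerivAt_ruled (hdc _ (hWJ hv.1))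
      (hdξ _ (hWJ hv.1))).hasFDerivWithinAt.fderivWithin (hud v hv)
  have hp0 : ∀ v ∈ W ∩ halfPlane, partialD (W ∩ halfPlane) 0 (ruled c ξ) v = ξ (v 1) :=
    fun v hv => by rw [partialD, hD v hv]; simp
  have hp1 : ∀ v ∈ W ∩ halfPlane, partialD (W ∩ halfPlane) 1 (ruled c ξ) v =
      ruled (deriv c) (deriv ξ) v :=
    fun v hv => by rw [partialD, hD v hv]; simp [ruled]
  have hp00 : partialD (W ∩ halfPlane) 0 (partialD (W ∩ halfPlane) 0 (ruled c ξ)) u = 0 := by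
    rw [partialD, fderivWithin_congr hp0 (hp0 u hu),
      (hasFDerivAt_comp_coord (hdξ _ (hWJ hu.1))).hasFDerivWithinAt.fderivWithin (hud u hu)]
    simp
  have hp01 : partialD (W ∩ halfPlane) 0 (partialD (W ∩ halfPlane) 1 (ruled c ξ)) u =
      deriv ξ (u 1) := by
    rw [partialD, fderivWithin_congr hp1 (hp1 u hu), (hasFDerivAt_ruled (hdc' _ (hWJ hu.1))
      (hdξ' _ (hWJ hu.1))).hasFDerivWithinAt.fderivWithin (hud u hu)]
    simp
  have hN : normalVec (W ∩ halfPlane) (ruled c ξ) u =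
      cross (ξ (u 1)) (deriv c (u 1)) + u 0 • cross (ξ (u 1)) (deriv ξ (u 1)) := by
    rw [normalVec, hp0 u hu, hp1 u hu, ruled, cross_add_right, cross_smul_right]
  -- L = 0 because the rulings are straight, M = 0 by `h0`; then L N - M² vanishes whatever N is.
  have hs00 : secondForm (W ∩ halfPlane) (ruled c ξ) u 0 0 = 0 := by
    rw [secondForm, hp00, inner_zero_left]
  have hs01 : secondForm (W ∩ halfPlane) (ruled c ξ) u 0 1 = 0 := by
    rw [secondForm, hp01, hN, inner_smul_right, inner_add_right, inner_smul_right,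
      h0 _ (hWJ hu.1), inner_self_cross_right]
    simp
  rw [gaussCurvature, hs00, hs01]
  simp

end Ruled

/-- An embedded patch, translated off the edge, parametrises its image. -/
theorem isLocalParam_translate {n : WithTop ℕ∞} {ψ : E2 → E3} {ρ : E3 → E2} {O : Set E3}
    {B : Set E2} (hB : IsOpen B) (hn : n ≠ 0) (hψ : ContDiffOn ℝ n ψ B) (hρ : ContinuousOn ρ O)
    (hleft : ∀ v ∈ B, ψ v ∈ O ∧ ρ (ψ v) = v)
    (hinj : ∀ v ∈ B, Function.Injective (fderiv ℝ ψ v)) (hB0 : ∀ v ∈ B, -1 < v 0) :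
    IsLocalParam n (ψ '' B) ∅ univ ((fun w => w - ee 0) ⁻¹' B) fun w => ψ (w - ee 0) := by
  -- Patches without boundary still have to be parametrised in the half plane; `hB0` ensures that
  -- the shift by `ee 0` takes the domain off the edge.
  have hpos : ∀ w ∈ (fun w : E2 => w - ee 0) ⁻¹' B, 0 < w 0 := fun w hw => by
    have := hB0 _ hw
    simp at this; linarith
  have hW : IsOpen ((fun w : E2 => w - ee 0) ⁻¹' B) := hB.preimage (by fun_prop)
  have hhalf : (fun w : E2 => w - ee 0) ⁻¹' B ∩ halfPlane = (fun w : E2 => w - ee 0) ⁻¹' B :=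
    inter_eq_left.2 fun w hw => (hpos w hw).le
  have hsub : MapsTo (fun w : E2 => w - ee 0) ((fun w : E2 => w - ee 0) ⁻¹' B) B := fun w hw => hw
  have hsm : ContDiff ℝ n (fun w : E2 => w - ee 0) := by fun_prop
  refine ⟨isOpen_univ, hW, ?_, ?_, ?_, ?_, ?_⟩
  · rw [hhalf]; exact hψ.comp hsm.contDiffOn hsub
  · rw [hhalf]
    intro w hw
    have h1 : HasFDerivAt ψ (fderiv ℝ ψ (w - ee 0)) (w - ee 0) :=
      ((hψ.contDiffAt (hB.mem_nhds hw)).differentiableAt hn).hasFDerivAt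
    have h2 : HasFDerivAt (fun w => ψ (w - ee 0)) (fderiv ℝ ψ (w - ee 0)) w := by
      have h3 := h1.comp w ((hasFDerivAt_id w).sub_const (ee 0))
      rw [ContinuousLinearMap.comp_id] at h3
      exact h3
    rw [h2.hasFDerivWithinAt.fderivWithin (hW.uniqueDiffOn w hw)]
    exact hinj _ hw
  · rw [hhalf]
    refine isEmbedding_domRestrict_of_leftInvOn (ρ := fun y => ρ y + ee 0) (O := O)
      ((hψ.continuousOn).comp hsm.continuous.continuousOn hsub)
      (hρ.add continuousOn_const) fun w hw => ⟨(hleft _ hw).1, ?_⟩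
    rw [(hleft _ hw).2]; simp
  · rw [hhalf, inter_univ]
    ext y; constructor
    · rintro ⟨w, hw, rfl⟩; exact ⟨_, hw, rfl⟩
    · rintro ⟨v, hv, rfl⟩
      exact ⟨v + ee 0, by simpa using hv, by simp⟩
  · rw [empty_inter, image_eq_empty]
    ext w; constructor
    · rintro ⟨hw, he⟩; exact (hpos w hw).ne' he
    · exact fun h => h.elim

/-! ### The envelope of the tangent planes along the edge -/

/-- The component of `∂₀ φ` along the edge in the direction of the edge curve. -/
def edgeShear (φ : E2 → E3) (t : ℝ) : ℝ :=
  inner ℝ (partialD halfPlane 0 φ (pt 0 t)) (deriv (edgeNormal φ) t) /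
    inner ℝ (deriv (edgeCurve φ) t) (deriv (edgeNormal φ) t)

/-- The direction of the characteristic lines of the tangent planes along the edge. -/
def ruling (φ : E2 → E3) (t : ℝ) : E3 :=
  edgeShear φ t • deriv (edgeCurve φ) t - partialD halfPlane 0 φ (pt 0 t)

/-- The envelope of the tangent planes along the edge. -/
def envelope (φ : E2 → E3) : E2 → E3 := ruled (edgeCurve φ) (ruling φ)

/-- The parameters of edge points at which the edge curve is not asymptotic. -/
def regularParams (W : Set E2) (φ : E2 → E3) : Set ℝ :=
  {t | pt 0 t ∈ W ∧ (inner ℝ (deriv (edgeCurve φ) t) (deriv (edgeNormal φ) t) : ℝ) ≠ 0}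

namespace IsLocalParam

variable {S Γ V : Set E3} {W : Set E2} {φ : E2 → E3}

theorem isOpen_regularParams (h : IsLocalParam ∞ S Γ V W φ) : IsOpen (regularParams W φ) := by
  have h1 : ContinuousOn (fun t => (inner ℝ (deriv (edgeCurve φ) t) (deriv (edgeNormal φ) t) : ℝ))
      {t | pt 0 t ∈ W} :=
    h.contDiffOn_deriv_edgeCurve.continuousOn.inner h.contDiffOn_deriv_edgeNormal.continuousOn
  exact h1.isOpen_inter_preimage (isOpen_pt_preimage h.isOpen_source) isOpen_ne

theorem contDiffOn_edgePartial (h : IsLocalParam ∞ S Γ V W φ) :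
    ContDiffOn ℝ ∞ (fun t => partialD halfPlane 0 φ (pt 0 t)) {t | pt 0 t ∈ W} :=
  (contDiffOn_comp_pt (contDiffOn_partialD h.isOpen_source h.contDiffOn 0)).congr fun _ ht =>
    (partialD_inter_halfPlane h.isOpen_source ht 0 φ).symm

theorem contDiffOn_edgeShear (h : IsLocalParam ∞ S Γ V W φ) : ContDiffOn ℝ ∞ (edgeShear φ) (regularParams W φ) := by
  have hs : regularParams W φ ⊆ {t | pt 0 t ∈ W} := fun t ht => ht.1
  exact ((h.contDiffOn_edgePartial.mono hs).inner ℝ (h.contDiffOn_deriv_edgeNormal.mono hs)).div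
    ((h.contDiffOn_deriv_edgeCurve.mono hs).inner ℝ (h.contDiffOn_deriv_edgeNormal.mono hs))
    fun t ht => ht.2

theorem contDiffOn_ruling (h : IsLocalParam ∞ S Γ V W φ) : ContDiffOn ℝ ∞ (ruling φ) (regularParams W φ) := by
  have hs : regularParams W φ ⊆ {t | pt 0 t ∈ W} := fun t ht => ht.1
  exact (h.contDiffOn_edgeShear.smul (h.contDiffOn_deriv_edgeCurve.mono hs)).sub
    (h.contDiffOn_edgePartial.mono hs)

theorem inner_ruling_edgeNormal (h : IsLocalParam ∞ S Γ V W φ) {t : ℝ} (ht : t ∈ regularParams W φ) :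
    inner ℝ (ruling φ t) (edgeNormal φ t) = 0 := by
  have h1 : inner ℝ (partialD halfPlane 0 φ (pt 0 t)) (edgeNormal φ t) = 0 :=
    inner_partialD_normalVec _ _ _ 0
  rw [ruling, inner_sub_left, inner_smul_left, h.inner_deriv_edgeCurve_edgeNormal ht.1, h1]
  simp

/-- `edgeShear` is defined for this: exactly one of the vectors a γ' - ∂₀φ is orthogonal to n', as
⟨γ', n'⟩ ≠ 0. -/
theorem inner_ruling_deriv_edgeNormal {t : ℝ} (ht : t ∈ regularParams W φ) :
    inner ℝ (ruling φ t) (deriv (edgeNormal φ) t) = 0 := by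
  rw [ruling, inner_sub_left, inner_smul_left, edgeShear]
  simp only [conj_trivial]
  rw [div_mul_cancel₀ _ ht.2, sub_self]

/-- The γ' component of the ruling drops out. Hence ruling and curve span the tangent plane of `S`,
which makes the envelope regular along the edge and tangent to `S` there. -/
theorem cross_ruling (h : IsLocalParam ∞ S Γ V W φ) {t : ℝ} (ht : t ∈ regularParams W φ) :
    cross (ruling φ t) (deriv (edgeCurve φ) t) = - edgeNormal φ t := by
  rw [ruling, sub_eq_add_neg, cross_add_left, cross_smul_left, cross_self, smul_zero, zero_add,
    ← neg_one_smul ℝ (partialD _ _ _ _), cross_smul_left, neg_one_smul, h.deriv_edgeCurve ht.1]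
  rfl

theorem hasDerivAt_ruling (h : IsLocalParam ∞ S Γ V W φ) {t : ℝ} (ht : t ∈ regularParams W φ) :
    HasDerivAt (ruling φ) (deriv (ruling φ) t) t :=
  ((h.contDiffOn_ruling.contDiffAt (h.isOpen_regularParams.mem_nhds ht)).differentiableAt
    (by simp)).hasDerivAt

/-- Differentiate ⟨ξ, n⟩ = 0 and use ⟨ξ, n'⟩ = 0. With `cross_ruling` this becomes the
developability condition of `gaussCurvature_ruled`. -/
theorem inner_deriv_ruling (h : IsLocalParam ∞ S Γ V W φ) {t : ℝ} (ht : t ∈ regularParams W φ) :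
    inner ℝ (deriv (ruling φ) t) (edgeNormal φ t) = 0 := by
  have h1 := (h.hasDerivAt_ruling ht).inner ℝ (h.hasDerivAt_edgeNormal ht.1)
  have h2 : (fun t => (inner ℝ (ruling φ t) (edgeNormal φ t) : ℝ)) =ᶠ[𝓝 t] fun _ => 0 := by
    filter_upwards [h.isOpen_regularParams.mem_nhds ht] with s hs
      using h.inner_ruling_edgeNormal hs
  have h3 := h1.unique ((hasDerivAt_const t (0 : ℝ)).congr_of_eventuallyEq h2)
  rw [inner_ruling_deriv_edgeNormal ht, zero_add] at h3
  exact h3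

theorem inner_deriv_ruling_cross (h : IsLocalParam ∞ S Γ V W φ) {t : ℝ} (ht : t ∈ regularParams W φ) :
    inner ℝ (deriv (ruling φ) t) (cross (ruling φ t) (deriv (edgeCurve φ) t)) = 0 := by
  rw [h.cross_ruling ht, inner_neg_right, h.inner_deriv_ruling ht, neg_zero]

theorem contDiffOn_envelope (h : IsLocalParam ∞ S Γ V W φ) : ContDiffOn ℝ ∞ (envelope φ) {u | u 1 ∈ regularParams W φ} :=
  contDiffOn_ruled (h.contDiffOn_edgeCurve.mono fun _ ht => ht.1) h.contDiffOn_ruling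

theorem fderiv_envelope (h : IsLocalParam ∞ S Γ V W φ) {u : E2} (hu : u 1 ∈ regularParams W φ) :
    fderiv ℝ (envelope φ) u = (cc 0).smulRight (ruling φ (u 1)) +
      (cc 1).smulRight (deriv (edgeCurve φ) (u 1) + u 0 • deriv (ruling φ) (u 1)) := by
  have := h.hasDerivAt_edgeCurve hu.1
  rw [← h.deriv_edgeCurve hu.1] at this
  exact (hasFDerivAt_ruled this (h.hasDerivAt_ruling hu)).fderiv

theorem injective_fderiv_envelope (h : IsLocalParam ∞ S Γ V W φ) {t : ℝ} (ht : t ∈ regularParams W φ) :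
    Function.Injective (fderiv ℝ (envelope φ) (pt 0 t)) := by
  rw [injective_iff_cross_ne_zero, h.fderiv_envelope ht]
  have := h.cross_ruling ht
  simp [this, h.edgeNormal_ne_zero ht.1]

theorem ruling_ne_zero (h : IsLocalParam ∞ S Γ V W φ) {t : ℝ} (ht : t ∈ regularParams W φ) : ruling φ t ≠ 0 := by
  intro h0
  have h1 := h.cross_ruling ht
  have h2 : cross (0 : E3) (deriv (edgeCurve φ) t) = 0 := by simp [← crossL_apply]
  rw [h0, h2] at h1
  exact h.edgeNormal_ne_zero ht.1 (neg_eq_zero.1 h1.symm)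

/-- The characteristic sets of the tangent planes along the edge are the rulings of the
envelope. -/
theorem edgeChar_eq (h : IsLocalParam ∞ S Γ V W φ) {t : ℝ} (ht : t ∈ regularParams W φ) :
    edgeChar φ t = range fun s => envelope φ (pt s t) := by
  -- If n' were a multiple of n, then ⟨γ', n'⟩ would be 0. So the two equations cut out a line, and
  -- ξ directs it.
  have hc : cross (edgeNormal φ t) (deriv (edgeNormal φ) t) ≠ 0 := by
    rw [← linearIndependent_iff_cross_ne_zero,
      LinearIndependent.pair_iff' (h.edgeNormal_ne_zero ht.1)]
    intro a ha
    apply ht.2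
    rw [← ha, inner_smul_right, h.inner_deriv_edgeCurve_edgeNormal ht.1, mul_zero]
  ext x
  constructor
  · rintro ⟨h0, h1⟩
    have e1 := eq_smul_cross_of_inner_eq_zero hc h0 h1
    have e2 := eq_smul_cross_of_inner_eq_zero hc (h.inner_ruling_edgeNormal ht)
      (inner_ruling_deriv_edgeNormal ht)
    set k₁ : ℝ := inner ℝ (x - edgeCurve φ t) (cross (edgeNormal φ t) (deriv (edgeNormal φ) t)) /
      inner ℝ (cross (edgeNormal φ t) (deriv (edgeNormal φ) t))
        (cross (edgeNormal φ t) (deriv (edgeNormal φ) t))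
    set k₂ : ℝ := inner ℝ (ruling φ t) (cross (edgeNormal φ t) (deriv (edgeNormal φ) t)) /
      inner ℝ (cross (edgeNormal φ t) (deriv (edgeNormal φ) t))
        (cross (edgeNormal φ t) (deriv (edgeNormal φ) t))
    have hk : k₂ ≠ 0 := by
      intro hk; rw [hk, zero_smul] at e2; exact h.ruling_ne_zero ht e2
    refine ⟨k₁ / k₂, ?_⟩
    simp only [envelope, ruled, pt_one, pt_zero]
    rw [e2, smul_smul, div_mul_cancel₀ _ hk, ← e1]; simp
  · rintro ⟨s, rfl⟩
    simp only [envelope, ruled, pt_one, pt_zero, edgeChar, mem_ofPred_eq, add_sub_cancel_left,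
      inner_smul_left, h.inner_ruling_edgeNormal ht, inner_ruling_deriv_edgeNormal ht]
    simp

end IsLocalParam

end
end FlatExt

/-! ### The envelope near the edge as an embedded flat surface. -/

namespace FlatExt
noncomputable section

namespace IsLocalParam

variable {S Γ V : Set E3} {W : Set E2} {φ : E2 → E3}

theorem envelope_pt_zero (φ : E2 → E3) (t : ℝ) : envelope φ (pt 0 t) = edgeCurve φ t := by
  simp [envelope, ruled]

/-- The envelope is a regular patch near the edge. -/
theorem exists_envelope_leftInverse (h : IsLocalParam ∞ S Γ V W φ) {b : ℝ}
    (hb : b ∈ regularParams W φ) :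
    ∃ (ρ : E3 → E2) (O : Set E3) (B : Set E2), IsOpen O ∧ IsOpen B ∧ pt 0 b ∈ B ∧
      B ⊆ {u | u 1 ∈ regularParams W φ} ∧ ContDiffOn ℝ 1 ρ O ∧
      (∀ v ∈ B, envelope φ v ∈ O ∧ ρ (envelope φ v) = v) ∧
      ∀ v ∈ B, Function.Injective (fderiv ℝ (envelope φ) v) :=
  exists_leftInverse (isOpen_coord_preimage h.isOpen_regularParams 1)
    (h.contDiffOn_envelope.of_le (by simp)) (show pt 0 b 1 ∈ _ from hb)
    (h.injective_fderiv_envelope hb)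

theorem mem_nhds_pt {B : Set E2} {b : ℝ} (hB : B ∈ 𝓝 (pt 0 b)) :
    ∃ r > 0, ∀ s t : ℝ, |s| < r → |t - b| < r → pt s t ∈ B := by
  have h1 : (fun x : ℝ × ℝ => pt x.1 x.2) ⁻¹' B ∈ 𝓝 ((0 : ℝ), b) :=
    contDiff_pt.continuous.continuousAt.preimage_mem_nhds hB
  obtain ⟨r, hr, hrB⟩ := Metric.mem_nhds_iff.1 h1
  refine ⟨r, hr, fun s t hs ht => hrB (a := (s, t)) ?_⟩
  rw [Metric.mem_ball, Prod.dist_eq, max_lt_iff, Real.dist_eq, Real.dist_eq, sub_zero]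
  exact ⟨hs, ht⟩

/-- Points of the envelope over parameters near `b` which are close to the edge point with
parameter `b` have small parameters. -/
theorem exists_small_param (h : IsLocalParam ∞ S Γ V W φ) {b : ℝ} (hb : b ∈ regularParams W φ)
    {r : ℝ} (hr : 0 < r) : ∃ δ > 0, ∃ ε > 0, ∀ s t : ℝ, |t - b| < δ →
      envelope φ (pt s t) ∈ Metric.ball (edgeCurve φ b) ε → |s| < r := by
  -- Characteristic sets are whole lines, whereas the envelope is known to be embedded for small
  -- parameters only. With ε = r ‖ξ(b)‖ / 4, a point of the ball satisfies ‖s ξ(t)‖ < 2ε, while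
  -- ‖ξ(t)‖ > ‖ξ(b)‖ / 2; hence |s| < r.
  have hm : 0 < ‖ruling φ b‖ := norm_pos_iff.2 (h.ruling_ne_zero hb)
  have h1 : ∀ᶠ t in 𝓝 b, ‖ruling φ b‖ / 2 < ‖ruling φ t‖ :=
    (h.hasDerivAt_ruling hb).continuousAt.norm.eventually_const_lt (by linarith)
  have hε : 0 < r * (‖ruling φ b‖ / 2) / 2 := by positivity
  have h2 : ∀ᶠ t in 𝓝 b, edgeCurve φ t ∈ Metric.ball (edgeCurve φ b) (r * (‖ruling φ b‖ / 2) / 2) :=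
    (h.hasDerivAt_edgeCurve hb.1).continuousAt.eventually (Metric.ball_mem_nhds _ hε)
  obtain ⟨δ, hδ, hδ'⟩ := Metric.eventually_nhds_iff.1 (h1.and h2)
  refine ⟨δ, hδ, _, hε, fun s t ht hx => ?_⟩
  obtain ⟨h3, h4⟩ := hδ' (y := t) (by rwa [Real.dist_eq])
  rw [mem_ball_iff_norm] at h4 hx
  have h5 : ‖s • ruling φ t‖ < r * (‖ruling φ b‖ / 2) := by
    have : s • ruling φ t = (envelope φ (pt s t) - edgeCurve φ b) -
        (edgeCurve φ t - edgeCurve φ b) := by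
      simp [envelope, ruled]
    rw [this]
    refine (norm_sub_le _ _).trans_lt ?_
    linarith
  rw [norm_smul, Real.norm_eq_abs] at h5
  by_contra hcon
  push Not at hcon
  have := mul_le_mul hcon h3.le (by positivity) (abs_nonneg s)
  linarith

/-- The envelope of the tangent planes is a flat surface near the edge. -/
theorem exists_isFlatSurface_envelope (h : IsLocalParam ∞ S Γ V W φ) {b : ℝ}
    (hb : b ∈ regularParams W φ) : ∃ δ > 0, (∀ t, |t - b| < δ → t ∈ regularParams W φ) ∧
      ∃ ε > 0, ∀ I : Set ℝ, IsOpen I → (∀ t ∈ I, |t - b| < δ) →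
        ∀ Y : Set E3, IsOpen Y → Y ⊆ Metric.ball (edgeCurve φ b) ε →
          IsFlatSurface ((⋃ t ∈ I, edgeChar φ t) ∩ Y) ∅ := by
  obtain ⟨ρ, O, B, hO, hB, hbB, hBr, hρ, hleft, hinj⟩ := h.exists_envelope_leftInverse hb
  obtain ⟨r, hr, hrB⟩ := mem_nhds_pt (hB.mem_nhds hbB)
  obtain ⟨δ, hδ, ε, hε, hsmall⟩ := h.exists_small_param hb (r := min r 1) (by positivity)
  have hδB : ∀ s t, |s| < r → |t - b| < min δ r → pt s t ∈ B := fun s t hs ht =>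
    hrB s t hs (lt_of_lt_of_le ht (min_le_right _ _))
  have hreg : ∀ t, |t - b| < min δ r → t ∈ regularParams W φ := fun t ht =>
    hBr (hδB 0 t (by simpa using hr) ht)
  refine ⟨min δ r, by positivity, hreg, ε, hε, fun I hI hIδ Y hY hYε => ?_⟩
  let B' : Set E2 := B ∩ envelope φ ⁻¹' Y ∩ {u | u 1 ∈ I} ∩
    {u | |u 0| < min r 1}
  have hcont : ContinuousOn (envelope φ) B := h.contDiffOn_envelope.continuousOn.mono hBr
  have hB' : IsOpen B' := ((hcont.isOpen_inter_preimage hB hY).inter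
    (isOpen_coord_preimage hI 1)).inter
    (isOpen_lt (contDiff_coord 0).continuous.abs continuous_const)
  -- By the bound on `s`, the lines meet `Y` only inside the embedded patch.
  have heq : (⋃ t ∈ I, edgeChar φ t) ∩ Y = envelope φ '' B' := by
    ext x
    simp only [mem_inter_iff, mem_iUnion]
    constructor
    · rintro ⟨⟨t, ht, hx⟩, hxε⟩
      rw [h.edgeChar_eq (hreg t (hIδ t ht))] at hx
      obtain ⟨s, rfl⟩ := hx
      have hs := hsmall s t (lt_of_lt_of_le (hIδ t ht) (min_le_left _ _)) (hYε hxε)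
      exact ⟨pt s t, ⟨⟨⟨hδB s t (lt_of_lt_of_le hs (min_le_left _ _)) (hIδ t ht), hxε⟩, ht⟩, hs⟩, rfl⟩
    · rintro ⟨u, ⟨⟨⟨huB, huε⟩, huI⟩, -⟩, rfl⟩
      refine ⟨⟨u 1, huI, ?_⟩, huε⟩
      rw [h.edgeChar_eq (hreg _ (hIδ _ huI))]
      exact ⟨u 0, by simp only [pt_eta]⟩
  rw [heq]
  have hB'B : B' ⊆ B := fun u hu => hu.1.1.1
  have hP := isLocalParam_translate hB' (n := ∞) (by simp)
    (h.contDiffOn_envelope.mono (hB'B.trans hBr)) hρ.continuousOn (fun v hv => hleft v (hB'B hv))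
    (fun v hv => hinj v (hB'B hv)) (fun v hv => by
      have := (abs_lt.1 (lt_of_lt_of_le (show |v 0| < min r 1 from hv.2) (min_le_right _ _))).1
      exact this)
  -- The shift of the parameter moves the base curve along the rulings, so the shifted patch is
  -- ruled with the same directions.
  have hshift : (fun w => envelope φ (w - ee 0)) =
      ruled (fun t => edgeCurve φ t - ruling φ t) (ruling φ) := by
    ext1 w
    simp only [envelope, ruled]
    have e0 : (w - ee 0) 0 = w 0 - 1 := by simp
    have e1 : (w - ee 0) 1 = w 1 := by simp
    rw [e0, e1, sub_smul, one_smul]; abel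
  refine ⟨empty_subset _, fun x hx => ⟨univ, _, _, mem_univ x, hP, fun u hu => ?_⟩⟩
  rw [hshift]
  refine gaussCurvature_ruled h.isOpen_regularParams
    ((h.contDiffOn_edgeCurve.mono fun _ ht => ht.1).sub h.contDiffOn_ruling) h.contDiffOn_ruling
    (fun t ht => ?_) hP.isOpen_source (fun w hw => ?_) hu
  · have hd : deriv (fun t => edgeCurve φ t - ruling φ t) t =
        deriv (edgeCurve φ) t - deriv (ruling φ) t :=
      deriv_fun_sub (h.hasDerivAt_edgeCurve ht.1).differentiableAt
        (h.hasDerivAt_ruling ht).differentiableAt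
    rw [hd, sub_eq_add_neg, cross_add_right, ← neg_one_smul ℝ (deriv (ruling φ) t),
      cross_smul_right, inner_add_right, h.inner_deriv_ruling_cross ht, inner_smul_right,
      inner_self_cross_right]
    simp
  · have := hBr (hB'B hw)
    simpa using this

/-! ### Existence of flat extensions -/

/-- The map of parameters which turns the derivatives of the envelope along the edge into
those of the surface. -/
def shearMap (φ : E2 → E3) (v : E2) : E2 := pt (-v 0) (v 1 + edgeShear φ (v 1) * v 0)

theorem shearMap_of_mem_edge (φ : E2 → E3) {v : E2} (hv : v ∈ edge) : shearMap φ v = v := by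
  have : v 0 = 0 := hv
  apply E2_ext <;> simp [shearMap, this]

theorem contDiffOn_shearMap (h : IsLocalParam ∞ S Γ V W φ) :
    ContDiffOn ℝ ∞ (shearMap φ) {u | u 1 ∈ regularParams W φ} := by
  have h0 : ContDiffOn ℝ ∞ (fun u : E2 => u 0) {u | u 1 ∈ regularParams W φ} :=
    ((contDiff_coord 0).of_le le_top).contDiffOn
  have h1 : ContDiffOn ℝ ∞ (fun u : E2 => u 1) {u | u 1 ∈ regularParams W φ} :=
    ((contDiff_coord 1).of_le le_top).contDiffOn
  have h2 : ContDiffOn ℝ ∞ (fun u : E2 => edgeShear φ (u 1)) {u | u 1 ∈ regularParams W φ} :=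
    h.contDiffOn_edgeShear.comp h1 fun u hu => hu
  exact (contDiff_pt.of_le le_top).comp_contDiffOn (h0.neg.prodMk (h1.add (h2.mul h0)))

/-- The derivative of the envelope sends (-1, `edgeShear`) to -ξ + `edgeShear` γ' = ∂₀φ, as the
gluing requires; the sign exchanges the two half planes. -/
theorem hasFDerivAt_shearMap (h : IsLocalParam ∞ S Γ V W φ) {u : E2}
    (hu : u 1 ∈ regularParams W φ) (hue : u ∈ edge) :
    HasFDerivAt (shearMap φ)
      ((cc 0).smulRight (pt (-1) (edgeShear φ (u 1))) + (cc 1).smulRight (ee 1)) u := by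
  have hd : HasDerivAt (edgeShear φ) (deriv (edgeShear φ) (u 1)) (u 1) :=
    ((h.contDiffOn_edgeShear.contDiffAt (h.isOpen_regularParams.mem_nhds hu)).differentiableAt
      (by simp)).hasDerivAt
  have h0 : HasFDerivAt (fun v : E2 => v 0) (cc 0) u := (cc 0).hasFDerivAt
  have h1 : HasFDerivAt (fun v : E2 => v 1) (cc 1) u := (cc 1).hasFDerivAt
  have h2 : HasFDerivAt (fun v : E2 => edgeShear φ (v 1)) (deriv (edgeShear φ) (u 1) • cc 1) u :=
    HasDerivAt.comp_hasFDerivAt (h₂ := edgeShear φ) u hd h1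
  have h3 := (h0.neg.smul_const (ee 0)).add ((h1.add (h2.mul h0)).smul_const (ee 1))
  have h4 : shearMap φ = fun v : E2 =>
      (-v 0) • ee 0 + (v 1 + edgeShear φ (v 1) * v 0) • ee 1 := by
    ext1 v; rw [shearMap, pt_eq]
  rw [h4]
  refine HasFDerivAt.congr_fderiv h3 ?_
  have hu0 : u 0 = 0 := hue
  apply E2_clm_ext
  · apply E2_ext <;> simp [hu0]
  · apply E2_ext <;> simp [hu0]

/-- The map `Ψ` is φ on the half plane and the sheared envelope on the opposite one. Values and
first derivatives agree along the edge, so `Ψ` is a regular `C^1` patch near the given edge point,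
and its image over a small domain is the extension. -/
theorem exists_isFlatExtension (h : IsLocalParam ∞ S Γ V W φ) (hΓS : Γ ⊆ S) {b : ℝ}
    (hb : b ∈ regularParams W φ) : ∃ U T : Set E3, edgeCurve φ b ∈ U ∧
      IsFlatExtension S Γ U T := by
  let D₀ : Set E2 := {u | u 1 ∈ regularParams W φ}
  have hD₀ : IsOpen D₀ := isOpen_coord_preimage h.isOpen_regularParams 1
  have hκ := h.contDiffOn_shearMap
  let D : Set E2 := (D₀ ∩ shearMap φ ⁻¹' D₀) ∩ W
  have hD : IsOpen D := (hκ.continuousOn.isOpen_inter_preimage hD₀ hD₀).inter h.isOpen_source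
  have hbD : pt 0 b ∈ D := by
    refine ⟨⟨hb, ?_⟩, hb.1⟩
    rw [mem_preimage, shearMap_of_mem_edge φ (pt_mem_edge b)]; exact hb
  let g : E2 → E3 := fun v => envelope φ (shearMap φ v)
  have hg : ContDiffOn ℝ ∞ g D := h.contDiffOn_envelope.comp (hκ.mono fun v hv => hv.1.1)
    fun v hv => hv.1.2
  let Ψ : E2 → E3 := glue φ g
  have hval : ∀ u ∈ edge, φ u = g u := fun u hu => by
    change φ u = envelope φ (shearMap φ u)
    rw [shearMap_of_mem_edge φ hu, eq_pt_of_mem_edge hu, envelope_pt_zero]; rfl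
  have hΨneg : ∀ u ∈ negHalfPlane, Ψ u = g u := fun u hu => glue_of_mem_neg hu (hval u)
  have hΨ : ContDiffOn ℝ 1 Ψ D := by
    refine contDiffOn_glue hD ?_ ?_ (fun u hu => hval u hu.2) ?_
    · exact (h.contDiffOn.of_le (by simp)).mono (inter_subset_inter_left _ fun v hv => hv.2)
    · exact (hg.of_le (by simp)).mono inter_subset_left
    · intro u hu
      have hur : u 1 ∈ regularParams W φ := hu.1.1.1
      have hup : pt 0 (u 1) = u := (eq_pt_of_mem_edge hu.2).symm
      have h1 := h.hasFDerivAt_shearMap hur hu.2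
      have h2 : HasFDerivAt (envelope φ) (fderiv ℝ (envelope φ) u) (shearMap φ u) := by
        rw [shearMap_of_mem_edge φ hu.2]
        exact ((h.contDiffOn_envelope.contDiffAt (hD₀.mem_nhds hur)).differentiableAt
          (by simp)).hasFDerivAt
      have h3 : HasFDerivAt g _ u := h2.comp u h1
      have hun : UniqueDiffWithinAt ℝ (D ∩ negHalfPlane) u := by
        rw [inter_comm]
        exact uniqueDiffOn_negHalfPlane.inter hD u ⟨(show u 0 = 0 from hu.2).le, hu.1⟩
      rw [h3.hasFDerivWithinAt.fderivWithin hun, fderivWithin_inter_halfPlane hD hu.1,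
        h.fderiv_envelope hur]
      have hu0 : u 0 = 0 := hu.2
      have hd := h.deriv_edgeCurve hur.1
      rw [hup] at hd
      apply E2_clm_ext
      · simp [hu0, ruling, hup, partialD]
      · simp [hu0, hd, partialD]
  have hΨd : ∀ u ∈ D ∩ halfPlane, fderivWithin ℝ φ halfPlane u = fderiv ℝ Ψ u := fun u hu => by
    refine fderivWithin_halfPlane_eq_fderiv hu.2
      ((hΨ.contDiffAt (hD.mem_nhds hu.1)).differentiableAt one_ne_zero) ?_
    filter_upwards [self_mem_nhdsWithin] with v hv using (glue_of_mem hv).symm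
  obtain ⟨ρ, O, B, hO, hB, hbB, hBD, hρ, hleft, hinj⟩ := exists_leftInverse hD hΨ hbD
    (by rw [← hΨd _ ⟨hbD, edge_subset_halfPlane (pt_mem_edge b)⟩]; exact h.immersive' (mem_of_pt hb.1))
  obtain ⟨ρ', O', B', hO', hB', hbB', hBr', hρ', hleft', hinj'⟩ := h.exists_envelope_leftInverse hb
  -- Since `shearMap` is invertible near the edge point, the lower half of `Ψ` is also parametrised
  -- by the envelope itself over the upper half plane, where `gaussCurvature_ruled` applies.
  obtain ⟨e, hee, hbe, heD, -, -⟩ := exists_openPartialHomeomorph hD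
    ((hκ.mono fun v hv => hv.1.1).of_le (by simp : (1 : WithTop ℕ∞) ≤ ∞)) hbD (by
      rw [(h.hasFDerivAt_shearMap (u := pt 0 b) hb (pt_mem_edge b)).fderiv,
        injective_iff_map_eq_zero]
      intro x hx
      have h0 := congrArg (fun u : E2 => u 0) hx
      have h1 := congrArg (fun u : E2 => u 1) hx
      simp at h0 h1
      rw [h0] at h1
      exact E2_ext h0 (by simpa using h1))
  let B₀ : Set E2 := (B ∩ (e.source ∩ e ⁻¹' B')) ∩ {v | -1 < v 0}
  have hB₀ : IsOpen B₀ := (hB.inter (e.continuousOn.isOpen_inter_preimage e.open_source hB')).inter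
    (isOpen_lt continuous_const (contDiff_coord 0).continuous)
  have hbB₀ : pt 0 b ∈ B₀ := by
    refine ⟨⟨hbB, hbe, ?_⟩, by simp⟩
    rw [mem_preimage, hee, shearMap_of_mem_edge φ (pt_mem_edge b)]; exact hbB'
  have hB₀W : B₀ ⊆ W := fun v hv => (hBD hv.1.1).2
  -- `U` is taken from the patch of `S`, so that `S ∩ U` is exactly its part over `B₀`; passing to
  -- `C` then keeps the image of `Ψ` in `U`.
  obtain ⟨U, hU, hUV, him⟩ := h.exists_image_eq hB₀ hB₀W
  let C : Set E2 := B₀ ∩ Ψ ⁻¹' U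
  have hC : IsOpen C := (hΨ.continuousOn.mono fun v hv => hBD hv.1.1).isOpen_inter_preimage hB₀ hU
  have hCB : C ⊆ B := fun v hv => hv.1.1.1
  have hΨinj : InjOn Ψ C := fun v hv w hw hvw => by
    rw [← (hleft v (hCB hv)).2, hvw, (hleft w (hCB hw)).2]
  have hSU : S ∩ U = Ψ '' (C ∩ halfPlane) := by
    rw [← him]
    ext y; constructor
    · rintro ⟨v, hv, rfl⟩
      have hvU : φ v ∈ S ∩ U := him ▸ mem_image_of_mem φ hv
      refine ⟨v, ⟨⟨hv.1, ?_⟩, hv.2⟩, glue_of_mem hv.2⟩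
      rw [mem_preimage, show Ψ v = φ v from glue_of_mem hv.2]; exact hvU.2
    · rintro ⟨v, hv, rfl⟩
      exact ⟨v, ⟨hv.1.1, hv.2⟩, (glue_of_mem hv.2).symm⟩
  have hCW : ∀ v ∈ C ∩ halfPlane, v ∈ W ∩ halfPlane := fun v hv => ⟨hB₀W hv.1.1, hv.2⟩
  have hΓiff : ∀ v ∈ C ∩ halfPlane, Ψ v ∈ Γ ↔ v ∈ edge := fun v hv => by
    rw [show Ψ v = φ v from glue_of_mem hv.2]; exact h.mem_iff_mem_edge (hCW v hv)
  have hΓU : Γ ∩ U = Ψ '' (C ∩ edge) := by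
    ext y; constructor
    · rintro ⟨hyΓ, hyU⟩
      have : y ∈ Ψ '' (C ∩ halfPlane) := hSU ▸ ⟨hΓS hyΓ, hyU⟩
      obtain ⟨v, hv, rfl⟩ := this
      exact ⟨v, ⟨hv.1, (hΓiff v hv).1 hyΓ⟩, rfl⟩
    · rintro ⟨v, hv, rfl⟩
      exact ⟨(hΓiff v ⟨hv.1, edge_subset_halfPlane hv.2⟩).2 hv.2, hv.1.2⟩
  -- Injectivity of `Ψ` prevents the added half from meeting `S` outside the boundary.
  have hT' : Ψ '' C \ (S \ Γ) = Ψ '' (C ∩ negHalfPlane) := by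
    ext y; constructor
    · rintro ⟨⟨v, hv, rfl⟩, hn⟩
      refine ⟨v, ⟨hv, ?_⟩, rfl⟩
      by_contra hneg
      have hpos : 0 < v 0 := not_le.1 hneg
      have hvh : v ∈ C ∩ halfPlane := ⟨hv, hpos.le⟩
      have : Ψ v ∈ S ∩ U := hSU ▸ mem_image_of_mem Ψ hvh
      exact hn ⟨this.1, fun hΓ => hpos.ne' ((hΓiff v hvh).1 hΓ)⟩
    · rintro ⟨v, hv, rfl⟩
      refine ⟨⟨v, hv.1, rfl⟩, fun hn => hn.2 ?_⟩
      have : Ψ v ∈ Ψ '' (C ∩ halfPlane) := hSU ▸ ⟨hn.1, hv.1.2⟩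
      obtain ⟨w, hw, hwv⟩ := this
      have hwv' := hΨinj hw.1 hv.1 hwv
      subst hwv'
      exact (hΓiff w hw).2 (le_antisymm hv.2 hw.2)
  refine ⟨U, Ψ '' C, ?_, hU, ?_, ?_, ?_, ?_⟩
  · have : φ (pt 0 b) ∈ S ∩ U :=
      him ▸ mem_image_of_mem φ ⟨hbB₀, edge_subset_halfPlane (pt_mem_edge b)⟩
    exact this.2
  · rintro _ ⟨v, hv, rfl⟩; exact hv.2
  · rw [hSU]; exact image_mono inter_subset_left
  · have hP := isLocalParam_translate hC (n := 1) one_ne_zero (hΨ.mono (hCB.trans hBD))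
      hρ.continuousOn (fun v hv => hleft v (hCB hv)) (fun v hv => hinj v (hCB hv))
      (fun v hv => hv.1.2)
    exact ⟨empty_subset _, fun x _ => ⟨univ, _, _, mem_univ x, hP⟩⟩
  · have hW'' : IsOpen (e '' C) := e.isOpen_image_of_subset_source hC fun v hv => hv.1.1.2.1
    have hsub : e '' C ⊆ B' := by rintro _ ⟨v, hv, rfl⟩; exact hv.1.1.2.2
    have hκ0 : ∀ v, e v 0 = -v 0 := fun v => by rw [hee]; rfl
    have hgv : ∀ v, envelope φ (e v) = g v := fun v => by rw [hee]
    have hP : IsLocalParam ∞ (Ψ '' C \ (S \ Γ)) (Γ ∩ U) univ (e '' C) (envelope φ) := by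
      refine ⟨isOpen_univ, hW'', ?_, ?_, ?_, ?_, ?_⟩
      · exact h.contDiffOn_envelope.mono fun w hw => hBr' (hsub hw.1)
      · intro w hw
        have : DifferentiableAt ℝ (envelope φ) w := (h.contDiffOn_envelope.contDiffAt
          (hD₀.mem_nhds (hBr' (hsub hw.1)))).differentiableAt (by simp)
        rw [this.fderivWithin (uniqueDiffOn_inter_halfPlane hW'' w hw)]
        exact hinj' w (hsub hw.1)
      · exact isEmbedding_domRestrict_of_leftInvOn
          (h.contDiffOn_envelope.continuousOn.mono fun w hw => hBr' (hsub hw.1))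
          hρ'.continuousOn fun w hw => hleft' w (hsub hw.1)
      · rw [inter_univ, hT']
        ext y; constructor
        · rintro ⟨_, ⟨⟨v, hv, rfl⟩, hh⟩, rfl⟩
          have hvn : v ∈ negHalfPlane := by
            have : 0 ≤ e v 0 := hh
            rw [hκ0] at this
            exact neg_nonneg.1 this
          exact ⟨v, ⟨hv, hvn⟩, by rw [hΨneg v hvn, hgv]⟩
        · rintro ⟨v, hv, rfl⟩
          refine ⟨e v, ⟨⟨v, hv.1, rfl⟩, ?_⟩, by rw [hΨneg v hv.2, hgv]⟩
          change 0 ≤ e v 0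
          rw [hκ0]; exact neg_nonneg.2 hv.2
      · rw [inter_univ, hΓU]
        ext y; constructor
        · rintro ⟨_, ⟨⟨v, hv, rfl⟩, hh⟩, rfl⟩
          have hve : v 0 = 0 := by
            have : e v 0 = 0 := hh
            rw [hκ0] at this
            exact neg_eq_zero.1 this
          exact ⟨v, ⟨hv, hve⟩, by rw [hΨneg v hve.le, hgv]⟩
        · rintro ⟨v, hv, rfl⟩
          have hv0 : v 0 = 0 := hv.2
          refine ⟨e v, ⟨⟨v, hv.1, rfl⟩, ?_⟩, by rw [hΨneg v hv0.le, hgv]⟩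
          change e v 0 = 0
          rw [hκ0, hv0, neg_zero]
    refine ⟨?_, fun x _ => ⟨univ, _, _, mem_univ x, hP, fun u hu => ?_⟩⟩
    · rw [hΓU, hT']
      exact image_mono (inter_subset_inter_right _ fun v (hv : v 0 = 0) => hv.le)
    · exact gaussCurvature_ruled h.isOpen_regularParams
        (h.contDiffOn_edgeCurve.mono fun _ ht => ht.1) h.contDiffOn_ruling
        (fun t ht => h.inner_deriv_ruling_cross ht) hW'' (fun w hw => hBr' (hsub hw)) hu

end IsLocalParam

end
end FlatExt

/-! ### Uniqueness: the flat part of an extension lies in the envelope and fills one side of it. -/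

namespace FlatExt
noncomputable section

/-! ### Maps of rank one near the edge -/

theorem hasDerivAt_pt_left (s t : ℝ) : HasDerivAt (fun s : ℝ => pt s t) (ee 0) s := by
  simp only [pt_eq]
  simpa using ((hasDerivAt_id s).smul_const (ee 0)).add_const (t • ee 1)

/-- If the derivatives of `P` and `Q` are proportional to each other and `Q` is regular along the
edge, then `P` is constant on the level lines of `Q`, each of which meets the edge. -/
theorem exists_edge_point_of_rank_one {F : Type*} [NormedAddCommGroup F] [NormedSpace ℝ F]
    {P : E2 → F} {Q : E2 → ℝ} {W : Set E2} (hW : IsOpen W)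
    (hP : DifferentiableOn ℝ P (W ∩ halfPlane)) (hQ : ContDiffOn ℝ 1 Q (W ∩ halfPlane))
    {l : E2 → ℝ}
    (hlP : ∀ u ∈ W ∩ halfPlane, fderivWithin ℝ P halfPlane u (ee 0) =
      l u • fderivWithin ℝ P halfPlane u (ee 1))
    (hlQ : ∀ u ∈ W ∩ halfPlane, fderivWithin ℝ Q halfPlane u (ee 0) =
      l u * fderivWithin ℝ Q halfPlane u (ee 1))
    {b : ℝ} (hb : pt 0 b ∈ W) (hQb : fderivWithin ℝ Q halfPlane (pt 0 b) (ee 1) ≠ 0)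
    {δ : ℝ} (hδ : 0 < δ) :
    ∃ B ∈ 𝓝 (pt 0 b), ∀ v ∈ B ∩ halfPlane, v ∈ W ∧ ∃ t : ℝ, |t - b| < δ ∧ pt 0 t ∈ W ∧
      P v = P (pt 0 t) ∧ ∃ k : ℝ, k ≠ 0 ∧
        fderivWithin ℝ P halfPlane v (ee 1) = k • fderivWithin ℝ P halfPlane (pt 0 t) (ee 1) := by
  -- The coordinates (u₀, Q) straighten the level lines of `Q`; they are regular at the edge point
  -- because ∂₁Q ≠ 0 there.
  let Φ : E2 → E2 := fun u => pt (u 0) (Q u)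
  have hΦ : ContDiffOn ℝ 1 Φ (W ∩ halfPlane) := (contDiff_pt.of_le le_top).comp_contDiffOn
    (((contDiff_coord 0).of_le le_top).contDiffOn.prodMk hQ)
  have hPd : ∀ u ∈ W ∩ halfPlane, HasFDerivWithinAt P (fderivWithin ℝ P halfPlane u) halfPlane u :=
    fun u hu => by
      have := hP u hu
      rw [inter_comm, differentiableWithinAt_inter (hW.mem_nhds hu.1)] at this
      exact this.hasFDerivWithinAt
  have hQd : ∀ u ∈ W ∩ halfPlane, HasFDerivWithinAt Q (fderivWithin ℝ Q halfPlane u) halfPlane u :=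
    fun u hu => by
      have := hQ.differentiableOn one_ne_zero u hu
      rw [inter_comm, differentiableWithinAt_inter (hW.mem_nhds hu.1)] at this
      exact this.hasFDerivWithinAt
  let B₁ : Set E2 := W ∩ edgeProj ⁻¹' W ∩ edgeRefl ⁻¹' W
  have hB₁ : IsOpen B₁ := (hW.inter (hW.preimage edgeProj.continuous)).inter
    (hW.preimage edgeRefl.continuous)
  have hext : ContDiffOn ℝ 1 (oddExt Φ) B₁ := contDiffOn_oddExt hW hΦ
  have hbB₁ : pt 0 b ∈ B₁ := by
    refine ⟨⟨hb, ?_⟩, ?_⟩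
    · rw [mem_preimage, edgeProj_of_mem (pt_mem_edge b)]; exact hb
    · rw [mem_preimage, edgeRefl_of_mem (pt_mem_edge b)]; exact hb
  -- The odd extension keeps the first coordinate, so its inverse respects the edge and both sides.
  have hext0 : ∀ u, oddExt Φ u 0 = u 0 := fun u => by
    rcases le_or_gt 0 (u 0) with h | h
    · rw [oddExt_of_mem h]; rfl
    · rw [oddExt_of_neg h]; simp [Φ]
  have hder : ∀ u ∈ B₁ ∩ halfPlane, ∀ x,
      fderiv ℝ (oddExt Φ) u x = pt (x 0) (fderivWithin ℝ Q halfPlane u x) := by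
    intro u hu x
    have h1 : fderivWithin ℝ Φ halfPlane u = fderiv ℝ (oddExt Φ) u := by
      refine fderivWithin_halfPlane_eq_fderiv hu.2
        ((hext.contDiffAt (hB₁.mem_nhds hu.1)).differentiableAt one_ne_zero) ?_
      filter_upwards [self_mem_nhdsWithin] with v hv using (oddExt_of_mem hv).symm
    have h0 : HasFDerivWithinAt (fun v : E2 => cc 0 v) (cc 0) halfPlane u :=
      (cc 0).hasFDerivWithinAt
    have h2 := (h0.smul_const (ee 0)).add
      ((hQd u ⟨hu.1.1.1, hu.2⟩).smul_const (ee 1))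
    have h3 : Φ = fun v : E2 => (cc 0) v • ee 0 + Q v • ee 1 := by
      ext1 v; change pt (v 0) (Q v) = _; rw [pt_eq]; rfl
    have h4 : HasFDerivWithinAt Φ ((cc 0).smulRight (ee 0) +
        (fderivWithin ℝ Q halfPlane u).smulRight (ee 1)) halfPlane u := by rw [h3]; exact h2
    rw [← h1, h4.fderivWithin (uniqueDiffOn_halfPlane u hu.2), pt_eq]
    simp
  have hinj : ∀ u ∈ B₁ ∩ halfPlane, Function.Injective (fderiv ℝ (oddExt Φ) u) ↔
      fderivWithin ℝ Q halfPlane u (ee 1) ≠ 0 := by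
    intro u hu
    rw [injective_iff_map_eq_zero]
    constructor
    · intro h h0
      have := h (ee 1) (by rw [hder u hu, h0]; apply E2_ext <;> simp)
      simpa using congrArg (fun u : E2 => u 1) this
    · intro h0 x hx
      rw [hder u hu] at hx
      have hx0 : x 0 = 0 := by simpa using congrArg (fun u : E2 => u 0) hx
      have hx1 : fderivWithin ℝ Q halfPlane u x = 0 := by
        simpa using congrArg (fun u : E2 => u 1) hx
      rw [map_E2, hx0, zero_smul, zero_add, smul_eq_mul] at hx1
      exact E2_ext hx0 ((mul_eq_zero.1 hx1).resolve_right h0)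
  have hbh : pt 0 b ∈ halfPlane := edge_subset_halfPlane (pt_mem_edge b)
  obtain ⟨e, he, hbe, heB, hsymm, hei⟩ := exists_openPartialHomeomorph hB₁ hext hbB₁
    ((hinj _ ⟨hbB₁, hbh⟩).2 hQb)
  have heΦ : ∀ u ∈ halfPlane, e u = Φ u := fun u hu => by rw [he, oddExt_of_mem hu]
  set q₀ := Q (pt 0 b) with hq₀
  have heb : e (pt 0 b) = pt 0 q₀ := heΦ _ hbh
  have hbt : pt 0 q₀ ∈ e.target := heb ▸ e.map_source hbe
  have hsb : e.symm (pt 0 q₀) = pt 0 b := by rw [← heb, e.left_inv hbe]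
  have hnear : e.target ∩ {w | |e.symm w 1 - b| < δ} ∈ 𝓝 (pt 0 q₀) := by
    refine Filter.inter_mem (e.open_target.mem_nhds hbt) ?_
    have hc : ContinuousAt (fun w => |e.symm w 1 - b|) (pt 0 q₀) :=
      (((contDiff_coord 1).continuous.continuousAt.comp
        (e.symm.continuousAt hbt)).sub continuousAt_const).abs
    exact hc.eventually_lt_const (by change |e.symm (pt 0 q₀) 1 - b| < δ; rw [hsb]; simpa using hδ)
  obtain ⟨r, hr, hbox⟩ := IsLocalParam.mem_nhds_pt hnear
  have hz : ∀ s y : ℝ, 0 ≤ s → s < r → |y - q₀| < r → pt s y ∈ e.target ∧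
      e.symm (pt s y) ∈ B₁ ∩ halfPlane ∧ e.symm (pt s y) 0 = s ∧ |e.symm (pt s y) 1 - b| < δ := by
    intro s y hs hsr hy
    obtain ⟨ht, hd⟩ := hbox s y (by rwa [abs_of_nonneg hs]) hy
    have h0 : e.symm (pt s y) 0 = s := by
      rw [← hext0, ← he, e.right_inv ht, pt_zero]
    exact ⟨ht, ⟨heB (e.map_target ht), by change 0 ≤ e.symm (pt s y) 0; rw [h0]; exact hs⟩, h0, hd⟩
  have hA : ∀ w ∈ e.target, HasFDerivAt e.symm (fderiv ℝ e.symm w) w ∧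
      ∀ x, fderiv ℝ (oddExt Φ) (e.symm w) (fderiv ℝ e.symm w x) = x := by
    intro w hw
    have h1 : HasFDerivAt e.symm (fderiv ℝ e.symm w) w :=
      ((hsymm.contDiffAt (e.open_target.mem_nhds hw)).differentiableAt one_ne_zero).hasFDerivAt
    have h2 : HasFDerivAt (oddExt Φ) (fderiv ℝ (oddExt Φ) (e.symm w)) (e.symm w) :=
      ((hext.contDiffAt (hB₁.mem_nhds (heB (e.map_target hw)))).differentiableAt
        one_ne_zero).hasFDerivAt
    have h3 := h2.comp w h1
    have h4 : oddExt Φ ∘ e.symm =ᶠ[𝓝 w] id := by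
      filter_upwards [e.open_target.mem_nhds hw] with v hv
      change oddExt Φ (e.symm v) = v
      rw [← he, e.right_inv hv]
    have h5 := h3.unique ((hasFDerivAt_id w).congr_of_eventuallyEq h4)
    exact ⟨h1, fun x => by simpa using DFunLike.congr_fun h5 x⟩
  -- Along a level line the velocity z has z₀ = 1 and dQ(z) = 0, which forces z₁ = -l; then dP(z) =
  -- 0 by proportionality.
  have hconst : ∀ s y : ℝ, 0 ≤ s → s < r → |y - q₀| < r →
      P (e.symm (pt s y)) = P (e.symm (pt 0 y)) := by
    intro s y hs hsr hy
    have hd : ∀ x ∈ Icc 0 s, HasDerivWithinAt (fun x => P (e.symm (pt x y))) 0 (Icc 0 s) x := by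
      intro x hx
      obtain ⟨ht, hmem, -, -⟩ := hz x y hx.1 (hx.2.trans_lt hsr) hy
      obtain ⟨hA1, hA2⟩ := hA _ ht
      have hc : HasDerivWithinAt (fun x => e.symm (pt x y))
          (fderiv ℝ e.symm (pt x y) (ee 0)) (Icc 0 s) x :=
        (hA1.comp_hasDerivAt x (hasDerivAt_pt_left x y)).hasDerivWithinAt
      have hPc := (hPd _ ⟨hmem.1.1.1, hmem.2⟩).comp_hasDerivWithinAt x hc
        (fun x' hx' => (hz x' y hx'.1 (hx'.2.trans_lt hsr) hy).2.1.2)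
      have hx1 := hA2 (ee 0)
      rw [hder _ hmem] at hx1
      set z := fderiv ℝ e.symm (pt x y) (ee 0)
      have hz0 : z 0 = 1 := by simpa using congrArg (fun u : E2 => u 0) hx1
      have hz1 : fderivWithin ℝ Q halfPlane (e.symm (pt x y)) z = 0 := by
        simpa using congrArg (fun u : E2 => u 1) hx1
      have hmem' : e.symm (pt x y) ∈ W ∩ halfPlane := ⟨hmem.1.1.1, hmem.2⟩
      have hQ1 := (hinj _ hmem).1 (hei _ (e.map_target ht))
      rw [map_E2, hz0, one_smul, hlQ _ hmem', smul_eq_mul, ← add_mul] at hz1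
      have hzl : z 1 = - l (e.symm (pt x y)) := by
        have := (mul_eq_zero.1 hz1).resolve_right hQ1
        linarith
      have : fderivWithin ℝ P halfPlane (e.symm (pt x y)) z = 0 := by
        rw [map_E2, hz0, one_smul, hlP _ hmem', hzl, neg_smul, add_neg_cancel]
      rw [this] at hPc
      exact hPc
    rcases hs.eq_or_lt with rfl | hs'
    · rfl
    · refine constant_of_derivWithin_zero (fun x hx => (hd x hx).differentiableWithinAt)
        (fun x hx => (hd x (Ico_subset_Icc_self hx)).derivWithin
          (uniqueDiffOn_Icc hs' x (Ico_subset_Icc_self hx))) s ⟨hs, le_rfl⟩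
  -- Across the level lines the derivative of `P` is a nonzero multiple of ∂₁P. By `hconst` it is
  -- the same for every `s`, which yields the factor between `v` and the edge point.
  have hyder : ∀ s y : ℝ, 0 ≤ s → s < r → |y - q₀| < r → ∃ a : ℝ, a ≠ 0 ∧
      HasDerivAt (fun y => P (e.symm (pt s y)))
        (a • fderivWithin ℝ P halfPlane (e.symm (pt s y)) (ee 1)) y := by
    intro s y hs hsr hy
    obtain ⟨ht, hmem, -, -⟩ := hz s y hs hsr hy
    obtain ⟨hA1, hA2⟩ := hA _ ht
    have hc : HasDerivAt (fun y => e.symm (pt s y)) (fderiv ℝ e.symm (pt s y) (ee 1)) y :=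
      hA1.comp_hasDerivAt y (hasDerivAt_pt s y)
    have hyn : ∀ᶠ y' in 𝓝 y, |y' - q₀| < r :=
      (continuous_id.sub continuous_const).abs.continuousAt.eventually_lt_const hy
    have hPc := (hPd _ ⟨hmem.1.1.1, hmem.2⟩).comp_hasDerivAt y hc
      (hyn.mono fun y' hy' => (hz s y' hs hsr hy').2.1.2)
    have hx1 := hA2 (ee 1)
    rw [hder _ hmem] at hx1
    set z := fderiv ℝ e.symm (pt s y) (ee 1)
    have hz0 : z 0 = 0 := by simpa using congrArg (fun u : E2 => u 0) hx1
    have hz1 : fderivWithin ℝ Q halfPlane (e.symm (pt s y)) z = 1 := by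
      simpa using congrArg (fun u : E2 => u 1) hx1
    rw [map_E2, hz0, zero_smul, zero_add, smul_eq_mul] at hz1
    refine ⟨z 1, left_ne_zero_of_mul_eq_one hz1, ?_⟩
    have : fderivWithin ℝ P halfPlane (e.symm (pt s y)) z =
        z 1 • fderivWithin ℝ P halfPlane (e.symm (pt s y)) (ee 1) := by
      rw [map_E2, hz0, zero_smul, zero_add]
    rw [this] at hPc
    exact hPc
  refine ⟨e.source ∩ {v | v 0 < r ∧ |e v 1 - q₀| < r}, ?_, ?_⟩
  · refine Filter.inter_mem (e.open_source.mem_nhds hbe) (Filter.Eventually.and ?_ ?_)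
    · exact (contDiff_coord 0).continuous.continuousAt.eventually_lt_const (by simpa using hr)
    · have hc : ContinuousAt (fun v => |e v 1 - q₀|) (pt 0 b) :=
        (((contDiff_coord 1).continuous.continuousAt.comp
          (e.continuousAt hbe)).sub continuousAt_const).abs
      exact hc.eventually_lt_const (by change |e (pt 0 b) 1 - q₀| < r; rw [heb]; simpa using hr)
  · rintro v ⟨⟨hvs, hvr, hvq⟩, hvh⟩
    have hev : e v = pt (v 0) (Q v) := heΦ v hvh
    rw [hev, pt_one] at hvq
    have hvv : e.symm (pt (v 0) (Q v)) = v := by rw [← hev, e.left_inv hvs]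
    have hv0 : 0 ≤ v 0 := hvh
    obtain ⟨-, hm0, hc0, hc1⟩ := hz 0 (Q v) le_rfl hr hvq
    have hpt : pt 0 (e.symm (pt 0 (Q v)) 1) = e.symm (pt 0 (Q v)) := (eq_pt_of_mem_edge hc0).symm
    refine ⟨(heB hvs).1.1, e.symm (pt 0 (Q v)) 1, hc1, ?_, ?_, ?_⟩
    · rw [hpt]; exact hm0.1.1.1
    · rw [hpt, ← hconst (v 0) (Q v) hv0 hvr hvq, hvv]
    · obtain ⟨a, ha, had⟩ := hyder (v 0) (Q v) hv0 hvr hvq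
      obtain ⟨a', ha', had'⟩ := hyder 0 (Q v) le_rfl hr hvq
      have hyn : ∀ᶠ y' in 𝓝 (Q v), |y' - q₀| < r :=
        (continuous_id.sub continuous_const).abs.continuousAt.eventually_lt_const hvq
      have := had.unique (had'.congr_of_eventuallyEq
        (hyn.mono fun y' hy' => hconst (v 0) y' hv0 hvr hy'))
      rw [hvv] at this
      refine ⟨a⁻¹ * a', mul_ne_zero (inv_ne_zero ha) ha', ?_⟩
      rw [hpt, mul_smul, ← this, smul_smul, inv_mul_cancel₀ ha, one_smul]

end
end FlatExt

namespace FlatExt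
noncomputable section

/-! ### Flat surfaces are enveloped by their tangent planes along the boundary -/

/-- The unit normal of a patch. -/
def unitNormal (D : Set E2) (φ : E2 → E3) (u : E2) : E3 := ‖normalVec D φ u‖⁻¹ • normalVec D φ u

/-- Symmetry of second derivatives within a set is used at edge points as well; it requires points
in the closure of the interior, which moving along `ee 0` provides. -/
theorem interior_inter_halfPlane_closure {W : Set E2} (hW : IsOpen W) {u : E2}
    (hu : u ∈ W ∩ halfPlane) : u ∈ closure (interior (W ∩ halfPlane)) := by
  rw [mem_closure_iff_nhds]
  intro t ht
  have hc : Filter.Tendsto (fun s : ℝ => u + s • ee 0) (𝓝[>] 0) (𝓝 u) := by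
    have : Filter.Tendsto (fun s : ℝ => u + s • ee 0) (𝓝 0) (𝓝 (u + (0 : ℝ) • ee 0)) :=
      (continuous_const.add (continuous_id.smul continuous_const)).tendsto 0
    rw [zero_smul, add_zero] at this
    exact this.mono_left nhdsWithin_le_nhds
  obtain ⟨s, ⟨hst, hsW⟩, hs⟩ := ((hc.eventually (Filter.inter_mem ht (hW.mem_nhds hu.1))).and
    self_mem_nhdsWithin).exists
  refine ⟨u + s • ee 0, hst, mem_interior_iff_mem_nhds.2 (Filter.inter_mem (hW.mem_nhds hsW) ?_)⟩
  have hpos : 0 < (u + s • ee 0) 0 := by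
    have h0 : 0 ≤ u 0 := hu.2
    have hs' : 0 < s := hs
    simp; linarith
  filter_upwards [(contDiff_coord 0).continuous.continuousAt.eventually_const_lt hpos] with v hv
    using hv.le

theorem two_le_infty : (2 : WithTop ℕ∞) ≤ ∞ :=
  WithTop.coe_le_coe.2 (le_top : (2 : ℕ∞) ≤ ⊤)

namespace IsLocalParam

variable {S Γ V : Set E3} {W : Set E2} {φ : E2 → E3}

theorem normalVec_inter_ne_zero (h : IsLocalParam ∞ S Γ V W φ) {u : E2} (hu : u ∈ W ∩ halfPlane) :
    normalVec (W ∩ halfPlane) φ u ≠ 0 :=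
  (normalVec_ne_zero_iff _ _ _).2 (h.immersive u hu)

theorem contDiffOn_unitNormal (h : IsLocalParam ∞ S Γ V W φ) :
    ContDiffOn ℝ ∞ (unitNormal (W ∩ halfPlane) φ) (W ∩ halfPlane) := by
  have hN := contDiffOn_normalVec h.isOpen_source h.contDiffOn
  exact ((hN.norm ℝ fun u hu => h.normalVec_inter_ne_zero hu).inv fun u hu =>
    norm_ne_zero_iff.2 (h.normalVec_inter_ne_zero hu)).smul hN

theorem inner_unitNormal_self (h : IsLocalParam ∞ S Γ V W φ) {u : E2} (hu : u ∈ W ∩ halfPlane) :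
    (inner ℝ (unitNormal (W ∩ halfPlane) φ u) (unitNormal (W ∩ halfPlane) φ u) : ℝ) = 1 := by
  rw [real_inner_self_eq_norm_sq, unitNormal, norm_smul, norm_inv, norm_norm,
    inv_mul_cancel₀ (norm_ne_zero_iff.2 (h.normalVec_inter_ne_zero hu)), one_pow]

theorem inner_partialD_unitNormal (u : E2) (i : Fin 2) :
    inner ℝ (partialD (W ∩ halfPlane) i φ u) (unitNormal (W ∩ halfPlane) φ u) = 0 := by
  rw [unitNormal, inner_smul_right, inner_partialD_normalVec, mul_zero]

theorem inner_fderivWithin_eq (h : IsLocalParam ∞ S Γ V W φ) {f g : E2 → E3}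
    (hf : ContDiffOn ℝ ∞ f (W ∩ halfPlane)) (hg : ContDiffOn ℝ ∞ g (W ∩ halfPlane)) {u : E2}
    (hu : u ∈ W ∩ halfPlane) (i : Fin 2) :
    fderivWithin ℝ (fun v => (inner ℝ (f v) (g v) : ℝ)) (W ∩ halfPlane) u (ee i) =
      inner ℝ (f u) (partialD (W ∩ halfPlane) i g u) +
        inner ℝ (partialD (W ∩ halfPlane) i f u) (g u) := by
  rw [((hf.differentiableOn (by simp) u hu).hasFDerivWithinAt.inner ℝ
    (hg.differentiableOn (by simp) u hu).hasFDerivWithinAt).fderivWithin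
    (uniqueDiffOn_inter_halfPlane h.isOpen_source u hu)]
  simp [partialD]

theorem inner_unitNormal_partialD (h : IsLocalParam ∞ S Γ V W φ) {u : E2}
    (hu : u ∈ W ∩ halfPlane) (i : Fin 2) :
    inner ℝ (partialD (W ∩ halfPlane) i (unitNormal (W ∩ halfPlane) φ) u)
      (unitNormal (W ∩ halfPlane) φ u) = 0 := by
  have h1 := h.inner_fderivWithin_eq h.contDiffOn_unitNormal h.contDiffOn_unitNormal hu i
  rw [fderivWithin_congr (f₁ := fun v => (inner ℝ (unitNormal (W ∩ halfPlane) φ v)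
    (unitNormal (W ∩ halfPlane) φ v) : ℝ)) (f := fun _ => (1 : ℝ))
    (fun v hv => h.inner_unitNormal_self hv) (h.inner_unitNormal_self hu)] at h1
  rw [real_inner_comm (partialD _ _ _ _)] at h1
  simp only [fderivWithin_const_apply, zero_apply] at h1
  linarith

/-- Differentiate ⟨∂ⱼφ, ν⟩ = 0. This trades second derivatives of φ for first derivatives of ν. -/
theorem secondForm_eq (h : IsLocalParam ∞ S Γ V W φ) {u : E2}
    (hu : u ∈ W ∩ halfPlane) (i j : Fin 2) :
    secondForm (W ∩ halfPlane) φ u i j = - inner ℝ (partialD (W ∩ halfPlane) j φ u)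
      (partialD (W ∩ halfPlane) i (unitNormal (W ∩ halfPlane) φ) u) := by
  have h1 := h.inner_fderivWithin_eq (contDiffOn_partialD h.isOpen_source h.contDiffOn j)
    h.contDiffOn_unitNormal hu i
  rw [fderivWithin_congr (f₁ := fun v => (inner ℝ (partialD (W ∩ halfPlane) j φ v)
    (unitNormal (W ∩ halfPlane) φ v) : ℝ)) (f := fun _ => (0 : ℝ))
    (fun v _ => inner_partialD_unitNormal v j) (inner_partialD_unitNormal u j)] at h1
  simp only [fderivWithin_const_apply, zero_apply] at h1
  change inner ℝ (partialD (W ∩ halfPlane) i (partialD (W ∩ halfPlane) j φ) u)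
    (unitNormal (W ∩ halfPlane) φ u) = _
  linarith

theorem secondForm_comm (h : IsLocalParam ∞ S Γ V W φ) {u : E2} (hu : u ∈ W ∩ halfPlane) :
    secondForm (W ∩ halfPlane) φ u 0 1 = secondForm (W ∩ halfPlane) φ u 1 0 := by
  have hud := uniqueDiffOn_inter_halfPlane h.isOpen_source
  have hd : DifferentiableWithinAt ℝ (fderivWithin ℝ φ (W ∩ halfPlane)) (W ∩ halfPlane) u :=
    (h.contDiffOn.fderivWithin hud (m := ∞) (by simp)).differentiableOn (by simp) u hu
  have hp : ∀ i j : Fin 2, partialD (W ∩ halfPlane) i (partialD (W ∩ halfPlane) j φ) u =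
      fderivWithin ℝ (fderivWithin ℝ φ (W ∩ halfPlane)) (W ∩ halfPlane) u (ee i) (ee j) := by
    intro i j
    have h1 : HasFDerivWithinAt (partialD (W ∩ halfPlane) j φ) _ (W ∩ halfPlane) u :=
      hd.hasFDerivWithinAt.clm_apply (hasFDerivWithinAt_const (ee j) u (W ∩ halfPlane))
    rw [partialD, h1.fderivWithin (hud u hu)]
    simp
  have hs : IsSymmSndFDerivWithinAt ℝ φ (W ∩ halfPlane) u :=
    (h.contDiffOn u hu).isSymmSndFDerivWithinAt (by simpa using two_le_infty) hud
      (interior_inter_halfPlane_closure h.isOpen_source hu) hu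
  rw [secondForm, secondForm, hp, hp, hs.eq]

/-- For a flat patch, the derivatives of the unit normal are linearly dependent. -/
theorem partialD_unitNormal_eq_smul (h : IsLocalParam ∞ S Γ V W φ)
    (hK : ∀ u ∈ W ∩ halfPlane, gaussCurvature (W ∩ halfPlane) φ u = 0) {u : E2}
    (hu : u ∈ W ∩ halfPlane)
    (h11 : (inner ℝ (partialD (W ∩ halfPlane) 1 φ u)
      (partialD (W ∩ halfPlane) 1 (unitNormal (W ∩ halfPlane) φ) u) : ℝ) ≠ 0) :
    partialD (W ∩ halfPlane) 0 (unitNormal (W ∩ halfPlane) φ) u =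
      (inner ℝ (partialD (W ∩ halfPlane) 1 φ u)
          (partialD (W ∩ halfPlane) 0 (unitNormal (W ∩ halfPlane) φ) u) /
        inner ℝ (partialD (W ∩ halfPlane) 1 φ u)
          (partialD (W ∩ halfPlane) 1 (unitNormal (W ∩ halfPlane) φ) u) : ℝ) •
      partialD (W ∩ halfPlane) 1 (unitNormal (W ∩ halfPlane) φ) u := by
  have hc := h.secondForm_comm hu
  have hKu := hK u hu
  have hden : firstForm (W ∩ halfPlane) φ u 0 0 * firstForm (W ∩ halfPlane) φ u 1 1 -
      firstForm (W ∩ halfPlane) φ u 0 1 ^ 2 ≠ 0 := by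
    have := inner_self_cross_pos (h.normalVec_inter_ne_zero hu)
    have e : (inner ℝ (cross (partialD (W ∩ halfPlane) 0 φ u) (partialD (W ∩ halfPlane) 1 φ u))
        (cross (partialD (W ∩ halfPlane) 0 φ u) (partialD (W ∩ halfPlane) 1 φ u)) : ℝ) =
        firstForm (W ∩ halfPlane) φ u 0 0 * firstForm (W ∩ halfPlane) φ u 1 1 -
          firstForm (W ∩ halfPlane) φ u 0 1 ^ 2 := by
      simp only [firstForm, inner_eq_sum, cross_zero, cross_one, cross_two]; ring
    rw [← e]; exact this.ne'
  rw [gaussCurvature, div_eq_zero_iff, or_iff_left hden] at hKu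
  rw [pow_two] at hKu
  -- With one factor of M² in the other order, the numerator is the determinant of the numbers ⟨∂ⱼφ,
  -- ∂ᵢν⟩.
  nth_rewrite 2 [hc] at hKu
  rw [h.secondForm_eq hu, h.secondForm_eq hu, h.secondForm_eq hu, h.secondForm_eq hu] at hKu
  have hn0 := h.inner_unitNormal_partialD hu 0
  have hn1 := h.inner_unitNormal_partialD hu 1
  set ν := unitNormal (W ∩ halfPlane) φ u with hν
  set ν₀ := partialD (W ∩ halfPlane) 0 (unitNormal (W ∩ halfPlane) φ) u
  set ν₁ := partialD (W ∩ halfPlane) 1 (unitNormal (W ∩ halfPlane) φ) u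
  set φ₀ := partialD (W ∩ halfPlane) 0 φ u with hφ₀
  set φ₁ := partialD (W ∩ halfPlane) 1 φ u with hφ₁
  -- The choice of `l` makes ν₀ - l ν₁ orthogonal to φ₁, the vanishing determinant makes it
  -- orthogonal to φ₀, and it is orthogonal to ν since |ν| = 1. Hence it is zero.
  set l : ℝ := inner ℝ φ₁ ν₀ / inner ℝ φ₁ ν₁ with hl
  have hl' : l * inner ℝ φ₁ ν₁ = inner ℝ φ₁ ν₀ := div_mul_cancel₀ _ h11
  have hcr : cross φ₀ φ₁ ≠ 0 := h.normalVec_inter_ne_zero hu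
  have e1 : inner ℝ (ν₀ - l • ν₁) φ₁ = 0 := by
    rw [inner_sub_left, inner_smul_left, real_inner_comm, real_inner_comm φ₁ ν₁]
    simp only [conj_trivial]; linarith
  have e0 : inner ℝ (ν₀ - l • ν₁) φ₀ = 0 := by
    rw [inner_sub_left, inner_smul_left, real_inner_comm, real_inner_comm φ₀ ν₁]
    simp only [conj_trivial]
    have : ((inner ℝ φ₀ ν₀ : ℝ) - l * inner ℝ φ₀ ν₁) * inner ℝ φ₁ ν₁ = 0 := by
      rw [sub_mul, mul_right_comm, hl']; linarith
    exact (mul_eq_zero.1 this).resolve_right h11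
  have e2 := eq_smul_cross_of_inner_eq_zero hcr e0 e1
  have e3 : inner ℝ (ν₀ - l • ν₁) (cross φ₀ φ₁) = 0 := by
    have e4 : cross φ₀ φ₁ = ‖normalVec (W ∩ halfPlane) φ u‖ • ν := by
      rw [hν, unitNormal, smul_smul,
        mul_inv_cancel₀ (norm_ne_zero_iff.2 (h.normalVec_inter_ne_zero hu)), one_smul]; rfl
    rw [e4, inner_smul_right, inner_sub_left, inner_smul_left, hn0, hn1]; simp
  rw [e3, zero_div, zero_smul] at e2
  exact sub_eq_zero.1 e2

/-- Characteristic sets are defined by the unnormalised normal, the rank argument uses the unit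
normal; this converts the equations of the one into those of the other. -/
theorem exists_deriv_edgeNormal_eq (h : IsLocalParam ∞ S Γ V W φ) {t : ℝ} (ht : pt 0 t ∈ W) :
    ∃ m m' : ℝ, m ≠ 0 ∧ edgeNormal φ t = m • unitNormal (W ∩ halfPlane) φ (pt 0 t) ∧
      deriv (edgeNormal φ) t =
        m • partialD (W ∩ halfPlane) 1 (unitNormal (W ∩ halfPlane) φ) (pt 0 t) +
          m' • unitNormal (W ∩ halfPlane) φ (pt 0 t) := by
  have hne : ∀ s, pt 0 s ∈ W → edgeNormal φ s =
      ‖edgeNormal φ s‖ • unitNormal (W ∩ halfPlane) φ (pt 0 s) := fun s hs => by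
    rw [unitNormal, normalVec_inter_halfPlane h.isOpen_source hs]
    change edgeNormal φ s = ‖edgeNormal φ s‖ • ‖edgeNormal φ s‖⁻¹ • edgeNormal φ s
    rw [smul_smul, mul_inv_cancel₀ (norm_ne_zero_iff.2 (h.edgeNormal_ne_zero hs)), one_smul]
  have hd : DifferentiableWithinAt ℝ (unitNormal (W ∩ halfPlane) φ) halfPlane (pt 0 t) := by
    have := h.contDiffOn_unitNormal.differentiableOn (by simp) _ (mem_of_pt ht)
    rwa [inter_comm W halfPlane, differentiableWithinAt_inter (h.isOpen_source.mem_nhds ht),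
      inter_comm halfPlane W] at this
  have hν := hasDerivAt_comp_pt hd
  have hm : HasDerivAt (fun s => ‖edgeNormal φ s‖) (deriv (fun s => ‖edgeNormal φ s‖) t) t :=
    ((h.hasDerivAt_edgeNormal ht).differentiableAt.norm ℝ (h.edgeNormal_ne_zero ht)).hasDerivAt
  have hprod := hm.smul hν
  have hev : edgeNormal φ =ᶠ[𝓝 t]
      fun s => ‖edgeNormal φ s‖ • unitNormal (W ∩ halfPlane) φ (pt 0 s) := by
    filter_upwards [(isOpen_pt_preimage h.isOpen_source).mem_nhds ht] with s hs using hne s hs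
  refine ⟨‖edgeNormal φ t‖, deriv (fun s => ‖edgeNormal φ s‖) t,
    norm_ne_zero_iff.2 (h.edgeNormal_ne_zero ht), hne t ht, ?_⟩
  have := (HasDerivAt.congr_of_eventuallyEq hprod hev).deriv
  rw [this, partialD_inter_halfPlane h.isOpen_source ht]
  rfl

/-- A flat patch is contained in the envelope of its tangent planes along the edge. -/
theorem exists_mem_edgeChar_of_flat (h : IsLocalParam ∞ S Γ V W φ)
    (hK : ∀ u ∈ W ∩ halfPlane, gaussCurvature (W ∩ halfPlane) φ u = 0) {b : ℝ}
    (hb : b ∈ regularParams W φ) {δ : ℝ} (hδ : 0 < δ) :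
    ∃ B ∈ 𝓝 (pt 0 b), ∀ v ∈ B ∩ halfPlane, v ∈ W ∧
      ∃ t : ℝ, |t - b| < δ ∧ pt 0 t ∈ W ∧ φ v ∈ edgeChar φ t := by
  set D := W ∩ halfPlane with hDdef
  set ν := unitNormal D φ with hνdef
  have hν : ContDiffOn ℝ ∞ ν D := h.contDiffOn_unitNormal
  let A : E2 → ℝ := fun u => inner ℝ (partialD D 1 φ u) (partialD D 1 ν u)
  have hA : ContinuousOn A D := (contDiffOn_partialD h.isOpen_source h.contDiffOn 1).continuousOn.inner
    (contDiffOn_partialD h.isOpen_source hν 1).continuousOn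
  have hbD : pt 0 b ∈ D := mem_of_pt hb.1
  have hAb : A (pt 0 b) ≠ 0 := by
    obtain ⟨m, m', hm, e, e'⟩ := h.exists_deriv_edgeNormal_eq hb.1
    intro h0
    apply hb.2
    rw [e', h.deriv_edgeCurve hb.1, inner_add_right, inner_smul_right, inner_smul_right,
      ← partialD_inter_halfPlane h.isOpen_source hb.1, inner_partialD_unitNormal]
    rw [show inner ℝ (partialD (W ∩ halfPlane) 1 φ (pt 0 b))
      (partialD (W ∩ halfPlane) 1 (unitNormal (W ∩ halfPlane) φ) (pt 0 b)) = 0 from h0]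
    simp
  obtain ⟨W₁, hW₁, hbW₁, hW₁A⟩ : ∃ W₁, IsOpen W₁ ∧ pt 0 b ∈ W₁ ∧ ∀ u ∈ W₁ ∩ D, A u ≠ 0 := by
    have := (hA _ hbD).eventually_ne hAb
    obtain ⟨W₁, hW₁, hb₁, hsub⟩ := mem_nhdsWithin.1 this
    exact ⟨W₁, hW₁, hb₁, fun u hu => hsub hu⟩
  let W₂ := W₁ ∩ W
  have hW₂ : IsOpen W₂ := hW₁.inter h.isOpen_source
  have hsub : W₂ ∩ halfPlane ⊆ D := fun u hu => ⟨hu.1.2, hu.2⟩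
  -- The pair (ν, r) with r = ⟨φ, ν⟩ records the tangent plane. As ⟨∂ᵢφ, ν⟩ = 0, the derivative of r
  -- is ⟨φ, ∂ᵢν⟩, so the proportionality of ∂₀ν and ∂₁ν passes to the pair. Testing ν against the
  -- fixed vector ∂₁φ at `pt 0 b` gives a scalar `Q` with ∂₁Q = `A` ≠ 0 there.
  let Q : E2 → ℝ := fun u => inner ℝ (ν u) (partialD D 1 φ (pt 0 b))
  let r : E2 → ℝ := fun u => inner ℝ (φ u) (ν u)
  have hr : ContDiffOn ℝ ∞ r D := h.contDiffOn.inner ℝ hν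
  have hQ : ContDiffOn ℝ ∞ Q D := hν.inner ℝ contDiffOn_const
  have hconv : ∀ {F : Type} [NormedAddCommGroup F] [NormedSpace ℝ F] (f : E2 → F) {u : E2},
      u ∈ D → fderivWithin ℝ f halfPlane u = fderivWithin ℝ f D u := fun {F} _ _ f {u} hu =>
    (fderivWithin_inter_halfPlane h.isOpen_source hu.1 f).symm
  have hQi : ∀ u ∈ D, ∀ i, fderivWithin ℝ Q D u (ee i) =
      inner ℝ (partialD D i ν u) (partialD D 1 φ (pt 0 b)) := by
    intro u hu i
    have h1 := h.inner_fderivWithin_eq hν (contDiffOn_const (c := partialD D 1 φ (pt 0 b))) hu i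
    rw [show fderivWithin ℝ Q D u (ee i) = _ from h1]
    simp [partialD, D]
  have hri : ∀ u ∈ D, ∀ i, fderivWithin ℝ r D u (ee i) = inner ℝ (φ u) (partialD D i ν u) := by
    intro u hu i
    have h1 := h.inner_fderivWithin_eq h.contDiffOn hν hu i
    rw [show fderivWithin ℝ r D u (ee i) = _ from h1, inner_partialD_unitNormal, add_zero]
  let l : E2 → ℝ := fun u => inner ℝ (partialD D 1 φ u) (partialD D 0 ν u) /
    inner ℝ (partialD D 1 φ u) (partialD D 1 ν u)
  have hl : ∀ u ∈ W₂ ∩ halfPlane, partialD D 0 ν u = l u • partialD D 1 ν u := fun u hu =>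
    h.partialD_unitNormal_eq_smul hK (hsub hu) (hW₁A u ⟨hu.1.1, hsub hu⟩)
  have hPi : ∀ u ∈ D, ∀ i, fderivWithin ℝ (fun v => (ν v, r v)) D u (ee i) =
      (partialD D i ν u, (inner ℝ (φ u) (partialD D i ν u) : ℝ)) := by
    intro u hu i
    rw [DifferentiableWithinAt.fderivWithin_prodMk (hν.differentiableOn (by simp) u hu)
      (hr.differentiableOn (by simp) u hu) (uniqueDiffOn_inter_halfPlane h.isOpen_source u hu)]
    rw [ContinuousLinearMap.prod_apply, hri u hu]
    rfl
  obtain ⟨B, hB, hBv⟩ := exists_edge_point_of_rank_one (P := fun v => (ν v, r v)) (Q := Q)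
    (l := l) (b := b) hW₂ (((hν.prodMk hr).differentiableOn (by simp)).mono hsub)
    ((hQ.of_le (by simp)).mono hsub)
    (fun u hu => by
      rw [hconv _ (hsub hu), hPi u (hsub hu), hPi u (hsub hu), hl u hu, inner_smul_right]; rfl)
    (fun u hu => by
      rw [hconv _ (hsub hu), hQi u (hsub hu), hQi u (hsub hu), hl u hu, inner_smul_left]; rfl)
    ⟨hbW₁, hb.1⟩ (by rw [hconv _ hbD, hQi _ hbD, real_inner_comm]; exact hAb) hδ
  refine ⟨B, hB, fun v hv => ?_⟩
  obtain ⟨hvW, t, htδ, htW, hPv, k, hk, hPk⟩ := hBv v hv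
  have htD : pt 0 t ∈ D := mem_of_pt htW.2
  have hvD : v ∈ D := ⟨hvW.2, hv.2⟩
  rw [hconv _ hvD, hconv _ htD, hPi v hvD, hPi _ htD] at hPk
  simp only [Prod.smul_mk, Prod.mk.injEq] at hPk hPv
  obtain ⟨hν1, hr1⟩ := hPk
  obtain ⟨hν0, hr0⟩ := hPv
  refine ⟨hvW.2, t, htδ, htW.2, ?_⟩
  obtain ⟨m, m', hm, e, e'⟩ := h.exists_deriv_edgeNormal_eq htW.2
  -- Equal tangent planes at `v` and at the edge point give the first equation; the proportional
  -- derivatives of (ν, r) give the second.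
  have i0 : inner ℝ (φ v - edgeCurve φ t) (ν (pt 0 t)) = 0 := by
    rw [inner_sub_left, ← hν0]
    change r v - inner ℝ (φ (pt 0 t)) (ν v) = 0
    rw [hν0, hr0]; exact sub_self _
  have i1 : inner ℝ (φ v - edgeCurve φ t) (partialD D 1 ν (pt 0 t)) = 0 := by
    rw [hν1, inner_smul_right, smul_eq_mul] at hr1
    rw [inner_sub_left, mul_left_cancel₀ hk hr1]; exact sub_self _
  refine ⟨?_, ?_⟩
  · rw [e, inner_smul_right]; exact mul_eq_zero_of_right _ i0
  · rw [e', inner_add_right, inner_smul_right, inner_smul_right]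
    change m * inner ℝ (φ v - edgeCurve φ t) (partialD D 1 ν (pt 0 t)) +
      m' * inner ℝ (φ v - edgeCurve φ t) (ν (pt 0 t)) = 0
    rw [i0, i1]; simp

end IsLocalParam

end
end FlatExt

namespace FlatExt
noncomputable section

/-! ### Half discs -/

/-- Local inverse of a regular map of a half disc, extended over the edge. -/
theorem exists_oddExt_openPartialHomeomorph {κ : E2 → E2} {W : Set E2} (hW : IsOpen W)
    (hκ : ContDiffOn ℝ 1 κ (W ∩ halfPlane)) {b : ℝ} (hb : pt 0 b ∈ W)
    (hinj : Function.Injective (fderivWithin ℝ κ halfPlane (pt 0 b))) :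
    ∃ e : OpenPartialHomeomorph E2 E2, (e : E2 → E2) = oddExt κ ∧ pt 0 b ∈ e.source ∧
      e.source ⊆ W ∩ edgeProj ⁻¹' W ∩ edgeRefl ⁻¹' W ∧ ContDiffOn ℝ 1 e.symm e.target ∧
      e (pt 0 b) = κ (pt 0 b) ∧
      HasFDerivAt e (fderivWithin ℝ κ halfPlane (pt 0 b)) (pt 0 b) := by
  have hB₁ : IsOpen (W ∩ edgeProj ⁻¹' W ∩ edgeRefl ⁻¹' W) :=
    (hW.inter (hW.preimage edgeProj.continuous)).inter (hW.preimage edgeRefl.continuous)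
  have hbB₁ : pt 0 b ∈ W ∩ edgeProj ⁻¹' W ∩ edgeRefl ⁻¹' W := by
    refine ⟨⟨hb, ?_⟩, ?_⟩
    · rw [mem_preimage, edgeProj_of_mem (pt_mem_edge b)]; exact hb
    · rw [mem_preimage, edgeRefl_of_mem (pt_mem_edge b)]; exact hb
  have hbh : pt 0 b ∈ halfPlane := edge_subset_halfPlane (pt_mem_edge b)
  have hext := contDiffOn_oddExt hW hκ
  have hd : DifferentiableAt ℝ (oddExt κ) (pt 0 b) :=
    (hext.contDiffAt (hB₁.mem_nhds hbB₁)).differentiableAt one_ne_zero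
  have hder : fderivWithin ℝ κ halfPlane (pt 0 b) = fderiv ℝ (oddExt κ) (pt 0 b) := by
    refine fderivWithin_halfPlane_eq_fderiv hbh hd ?_
    filter_upwards [self_mem_nhdsWithin] with v hv using (oddExt_of_mem hv).symm
  obtain ⟨e, he, hbe, heB, hsymm, -⟩ := exists_openPartialHomeomorph hB₁ hext hbB₁
    (by rw [← hder]; exact hinj)
  refine ⟨e, he, hbe, heB, hsymm, by rw [he, oddExt_of_mem hbh], ?_⟩
  rw [he, hder]; exact hd.hasFDerivAt

/-- The image of a half disc under a regular map contains short segments in every direction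
pointing to the interior. -/
theorem exists_interior_point_of_inward {κ : E2 → E2} {W : Set E2} (hW : IsOpen W)
    (hκ : ContDiffOn ℝ 1 κ (W ∩ halfPlane)) {b : ℝ} (hb : pt 0 b ∈ W)
    (hinj : Function.Injective (fderivWithin ℝ κ halfPlane (pt 0 b))) {z : E2} (hz : 0 < z 0)
    {N : Set E2} (hN : N ∈ 𝓝 (pt 0 b)) :
    ∀ᶠ ε in 𝓝[>] (0 : ℝ), ∃ v ∈ N, 0 < v 0 ∧
      κ v = κ (pt 0 b) + ε • fderivWithin ℝ κ halfPlane (pt 0 b) z := by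
  obtain ⟨e, he, hbe, heW, hsymm, heb, hde⟩ := exists_oddExt_openPartialHomeomorph hW hκ hb hinj
  set A := fderivWithin ℝ κ halfPlane (pt 0 b)
  have hbt : κ (pt 0 b) ∈ e.target := heb ▸ e.map_source hbe
  have hsb : e.symm (κ (pt 0 b)) = pt 0 b := by rw [← heb, e.left_inv hbe]
  let y : ℝ → E2 := fun ε => κ (pt 0 b) + ε • A z
  have hy0 : y 0 = κ (pt 0 b) := by simp [y]
  have hy : HasDerivAt y (A z) 0 := by
    have := ((hasDerivAt_id (0 : ℝ)).smul_const (A z)).const_add (κ (pt 0 b))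
    rw [one_smul] at this
    exact this
  have hs : HasFDerivAt e.symm (fderiv ℝ e.symm (κ (pt 0 b))) (κ (pt 0 b)) :=
    ((hsymm.contDiffAt (e.open_target.mem_nhds hbt)).differentiableAt one_ne_zero).hasFDerivAt
  have hsA : fderiv ℝ e.symm (κ (pt 0 b)) (A z) = z := by
    have h1 : HasFDerivAt (fun v => e.symm (e v)) ((fderiv ℝ e.symm (κ (pt 0 b))).comp A)
        (pt 0 b) := HasFDerivAt.comp (pt 0 b) (by rw [heb]; exact hs) hde
    have h2 : (fun v => e.symm (e v)) =ᶠ[𝓝 (pt 0 b)] id := by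
      filter_upwards [e.open_source.mem_nhds hbe] with v hv using e.left_inv hv
    have h3 := h1.unique ((hasFDerivAt_id _).congr_of_eventuallyEq h2)
    simpa using DFunLike.congr_fun h3 z
  -- Pulled back, the segment becomes a curve with velocity `z` starting on the edge. Since z₀ > 0
  -- it enters the open half plane, where the odd extension is κ itself.
  have hv : HasDerivAt (fun ε => e.symm (y ε)) z 0 := by
    have := HasFDerivAt.comp_hasDerivAt (f := y) (0 : ℝ) (by rw [hy0]; exact hs) hy
    rwa [hsA] at this
  have hv0 : HasDerivAt (fun ε => e.symm (y ε) 0) (z 0) 0 :=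
    (cc 0).hasFDerivAt.comp_hasDerivAt (0 : ℝ) hv
  have hslope := (hasDerivAt_iff_tendsto_slope.1 hv0).eventually_const_lt hz
  have hslope' : ∀ᶠ ε in 𝓝[>] (0 : ℝ),
      0 < slope (fun ε => e.symm (y ε) 0) 0 ε :=
    hslope.filter_mono (nhdsWithin_mono 0 fun ε (hε : 0 < ε) => hε.ne')
  have hyt : ∀ᶠ ε in 𝓝 (0 : ℝ), y ε ∈ e.target :=
    hy.continuousAt.eventually (by rw [hy0]; exact e.open_target.mem_nhds hbt)
  have hyN : ∀ᶠ ε in 𝓝 (0 : ℝ), e.symm (y ε) ∈ N :=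
    hv.continuousAt.eventually (by simp only [hy0, hsb]; exact hN)
  filter_upwards [hslope', nhdsWithin_le_nhds hyt, nhdsWithin_le_nhds hyN, self_mem_nhdsWithin]
    with ε h1 h2 h3 (h4 : 0 < ε)
  have hpos : 0 < e.symm (y ε) 0 := by
    rw [slope_def_field, hy0, hsb, pt_zero, sub_zero, sub_zero] at h1
    exact (div_pos_iff_of_pos_right h4).1 h1
  refine ⟨e.symm (y ε), h3, hpos, ?_⟩
  rw [← oddExt_of_mem (φ := κ) hpos.le, ← he, e.right_inv h2]

/-- A regular map of half discs which maps edge to edge and preserves the sides is locally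
onto. -/
theorem exists_half_homeomorph {κ : E2 → E2} {W : Set E2} (hW : IsOpen W)
    (hκ : ContDiffOn ℝ 1 κ (W ∩ halfPlane)) {b c : ℝ} (hb : pt 0 b ∈ W) (hbc : κ (pt 0 b) = pt 0 c)
    (hinj : Function.Injective (fderivWithin ℝ κ halfPlane (pt 0 b)))
    (hedge : ∀ u ∈ W ∩ edge, κ u ∈ edge)
    (hpos : 0 < fderivWithin ℝ κ halfPlane (pt 0 b) (ee 0) 0) :
    ∃ N ∈ 𝓝 (pt 0 b), N ⊆ W ∧ (∀ v ∈ N ∩ halfPlane, κ v ∈ halfPlane) ∧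
      ∀ᶠ u in 𝓝 (pt 0 c), u ∈ halfPlane → ∃ v ∈ W ∩ halfPlane, κ v = u := by
  have hbh : pt 0 b ∈ halfPlane := edge_subset_halfPlane (pt_mem_edge b)
  have hkd : ∀ u ∈ W ∩ halfPlane, HasFDerivWithinAt κ (fderivWithin ℝ κ halfPlane u) halfPlane u :=
    fun u hu => by
      have := hκ.differentiableOn one_ne_zero u hu
      rw [inter_comm, differentiableWithinAt_inter (hW.mem_nhds hu.1)] at this
      exact this.hasFDerivWithinAt
  have hcont : ContinuousOn (fun u => fderivWithin ℝ κ halfPlane u (ee 0) 0) (W ∩ halfPlane) := by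
    have h1 : ContinuousOn (fun u => fderivWithin ℝ κ (W ∩ halfPlane) u) (W ∩ halfPlane) :=
      hκ.continuousOn_fderivWithin (uniqueDiffOn_inter_halfPlane hW) le_rfl
    have h2 : ContinuousOn (fun u => fderivWithin ℝ κ halfPlane u) (W ∩ halfPlane) :=
      h1.congr fun u hu => (fderivWithin_inter_halfPlane hW hu.1 κ).symm
    exact (contDiff_coord 0).continuous.comp_continuousOn (h2.clm_apply continuousOn_const)
  obtain ⟨W₁, hW₁, hbW₁, hpos₁⟩ : ∃ W₁, IsOpen W₁ ∧ pt 0 b ∈ W₁ ∧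
      ∀ u ∈ W₁ ∩ (W ∩ halfPlane), 0 < fderivWithin ℝ κ halfPlane u (ee 0) 0 := by
    obtain ⟨W₁, hW₁, hb₁, hsub⟩ :=
      mem_nhdsWithin.1 ((hcont _ ⟨hb, hbh⟩).eventually_const_lt hpos)
    exact ⟨W₁, hW₁, hb₁, fun u hu => hsub hu⟩
  obtain ⟨r, hr, hbox⟩ := IsLocalParam.mem_nhds_pt ((hW₁.inter hW).mem_nhds ⟨hbW₁, hb⟩)
  -- The first coordinate of κ vanishes on the edge and increases strictly along the lines leaving
  -- it.
  have hside : ∀ s t : ℝ, 0 < s → s < r → |t - b| < r → 0 < κ (pt s t) 0 := by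
    intro s t hs hsr ht
    have hmem : ∀ x ∈ Icc 0 s, pt x t ∈ W₁ ∩ (W ∩ halfPlane) := fun x hx => by
      have := hbox x t (by rw [abs_of_nonneg hx.1]; exact hx.2.trans_lt hsr) ht
      exact ⟨this.1, this.2, hx.1⟩
    have hd : ∀ x ∈ Icc 0 s, HasDerivWithinAt (fun x => κ (pt x t) 0)
        (fderivWithin ℝ κ halfPlane (pt x t) (ee 0) 0) (Icc 0 s) x := fun x hx =>
      (cc 0).hasFDerivAt.comp_hasDerivWithinAt x
        ((hkd _ (hmem x hx).2).comp_hasDerivWithinAt x (hasDerivAt_pt_left x t).hasDerivWithinAt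
          fun x' hx' => (hmem x' hx').2.2)
    have hmono : StrictMonoOn (fun x => κ (pt x t) 0) (Icc 0 s) := by
      refine strictMonoOn_of_hasDerivWithinAt_pos (convex_Icc 0 s)
        (fun x hx => (hd x hx).continuousWithinAt)
        (f' := fun x => fderivWithin ℝ κ halfPlane (pt x t) (ee 0) 0) (fun x hx => ?_)
        fun x hx => hpos₁ _ (hmem x (interior_subset hx))
      exact (hd x (interior_subset hx)).mono interior_subset
    have h0 : κ (pt 0 t) 0 = 0 :=
      hedge _ ⟨(hmem 0 ⟨le_rfl, hs.le⟩).2.1, pt_mem_edge t⟩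
    have := hmono ⟨le_rfl, hs.le⟩ ⟨hs.le, le_rfl⟩ hs
    simpa [h0] using this
  obtain ⟨e, he, hbe, heW, hsymm, heb, -⟩ := exists_oddExt_openPartialHomeomorph hW hκ hb hinj
  let N : Set E2 := W ∩ {v | |v 0| < r ∧ |v 1 - b| < r}
  have hN : N ∈ 𝓝 (pt 0 b) := by
    refine Filter.inter_mem (hW.mem_nhds hb) (Filter.Eventually.and ?_ ?_)
    · exact (contDiff_coord 0).continuous.abs.continuousAt.eventually_lt_const (by simpa using hr)
    · exact ((contDiff_coord 1).continuous.sub continuous_const).abs.continuousAt.eventually_lt_const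
        (by simpa using hr)
  refine ⟨N, hN, inter_subset_left, ?_, ?_⟩
  · rintro v ⟨⟨hvW, hv0, hv1⟩, hvh⟩
    rcases (show 0 ≤ v 0 from hvh).eq_or_lt with h0 | h0
    · exact edge_subset_halfPlane (hedge v ⟨hvW, h0.symm⟩)
    · have := hside (v 0) (v 1) h0 (lt_of_abs_lt hv0) hv1
      rw [pt_eta] at this
      exact this.le
  · have hbt : pt 0 c ∈ e.target := by rw [← hbc, ← heb]; exact e.map_source hbe
    have hsb : e.symm (pt 0 c) = pt 0 b := by rw [← hbc, ← heb, e.left_inv hbe]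
    have hev : ∀ᶠ u in 𝓝 (pt 0 c), e.symm u ∈ N :=
      (e.symm.continuousAt hbt).eventually (by rw [hsb]; exact hN)
    filter_upwards [hev, e.open_target.mem_nhds hbt] with u hu hut huh
    have hvs := e.map_target hut
    have hev' : oddExt κ (e.symm u) = u := by rw [← he, e.right_inv hut]
    set v := e.symm u with hv
    -- On the negative side the odd extension has first coordinate 2 · 0 minus a positive number, so
    -- it cannot reach the half plane.
    have hvh : v ∈ halfPlane := by
      by_contra hneg
      have hneg' : v 0 < 0 := not_le.1 hneg
      rw [oddExt_of_neg hneg'] at hev'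
      have h0 := congrArg (fun w : E2 => w 0) hev'
      have hP : κ (edgeProj v) 0 = 0 := hedge _ ⟨(heW hvs).1.2, edgeProj_zero v⟩
      have hR : 0 < κ (edgeRefl v) 0 := by
        have := hside (-v 0) (v 1) (by linarith) (by
          have := hu.2.1
          rw [abs_of_neg hneg'] at this; exact this) hu.2.2
        have e1 : pt (-v 0) (v 1) = edgeRefl v := by apply E2_ext <;> simp
        rwa [e1] at this
      simp [hP] at h0
      have : 0 ≤ u 0 := huh
      linarith
    exact ⟨v, ⟨hu.1, hvh⟩, by rw [← oddExt_of_mem (φ := κ) hvh, hev']⟩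

end
end FlatExt

namespace FlatExt
noncomputable section

/-! ### The structure of flat extensions near the edge -/

/-- Inside `U` an extension is the union of `S` and its flat part; uniqueness therefore reduces to
that of the flat part. -/
theorem IsFlatExtension.mem_iff {S Γ U T : Set E3} (hT : IsFlatExtension S Γ U T) {y : E3}
    (hy : y ∈ U) : y ∈ T ↔ y ∈ S ∨ y ∈ T \ (S \ Γ) := by
  constructor
  · intro h
    by_cases hS : y ∈ S
    · exact Or.inl hS
    · exact Or.inr ⟨h, fun h' => hS h'.1⟩
  · rintro (h | h)
    · exact hT.extends_surface ⟨h, hy⟩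
    · exact h.1

namespace IsLocalParam

variable {S Γ V : Set E3} {W : Set E2} {φ : E2 → E3}

theorem eventually_mem (h : IsLocalParam ∞ S Γ V W φ) {u : E2} (hu : u ∈ W ∩ halfPlane)
    {U : Set E3} (hU : IsOpen U) (huU : φ u ∈ U) : ∀ᶠ v in 𝓝[halfPlane] u, φ v ∈ S ∩ U := by
  filter_upwards [self_mem_nhdsWithin, mem_nhdsWithin_of_mem_nhds (h.isOpen_source.mem_nhds hu.1),
    (h.differentiableWithinAt (by simp) hu).continuousWithinAt.eventually (hU.mem_nhds huU)]
    with v h1 h2 h3 using ⟨(h.mapsTo ⟨h2, h1⟩).1, h3⟩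

/-- The flat part of a flat extension has a flat parametrisation near a given boundary point,
whose tangent planes along the boundary are those of the surface. -/
theorem exists_flat_param (h : IsLocalParam ∞ S Γ V W φ) (hΓS : Γ ⊆ S) {b : ℝ}
    (hb : b ∈ regularParams W φ) {U T : Set E3} (hbU : edgeCurve φ b ∈ U)
    (hT : IsFlatExtension S Γ U T) :
    ∃ (V₂ : Set E3) (W₂ : Set E2) (φ₂ : E2 → E3) (b₂ : ℝ) (τ : ℝ → ℝ),
      IsLocalParam ∞ (T \ (S \ Γ)) (Γ ∩ U) V₂ W₂ φ₂ ∧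
      (∀ u ∈ W₂ ∩ halfPlane, gaussCurvature (W₂ ∩ halfPlane) φ₂ u = 0) ∧
      b₂ ∈ regularParams W₂ φ₂ ∧ τ b₂ = b ∧ ContinuousAt τ b₂ ∧
      ∀ᶠ t in 𝓝 b₂, edgeCurve φ₂ t = edgeCurve φ (τ t) ∧ edgeChar φ₂ t = edgeChar φ (τ t) := by
  have hxΓ : edgeCurve φ b ∈ Γ ∩ U := ⟨(h.mapsTo_edge ⟨hb.1, pt_mem_edge b⟩).1, hbU⟩
  obtain ⟨V₂, W₂, φ₂, hxV, h₂, hK⟩ := hT.flat.2 _ (hT.flat.1 hxΓ)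
  have : edgeCurve φ b ∈ φ₂ '' (W₂ ∩ edge) := by rw [h₂.image_edge_eq]; exact ⟨hxΓ, hxV⟩
  obtain ⟨u₂, hu₂, hu₂e⟩ := this
  obtain ⟨b₂, rfl⟩ : ∃ b₂, u₂ = pt 0 b₂ := ⟨u₂ 1, eq_pt_of_mem_edge hu₂.2⟩
  obtain ⟨τ, hτb, hτc, hτ⟩ := h.exists_reparam h₂ (by simp) inter_subset_left hΓS hb.1 hu₂.1
    hu₂e.symm
  -- Both patches lie in the `C^1` surface `T` and share the boundary curve, so
  -- `IsSurface.exists_normalVec_eq_smul` applies.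
  have hN : ∀ᶠ t in 𝓝 b₂, ∃ k : ℝ, k ≠ 0 ∧ edgeNormal φ₂ t = k • edgeNormal φ (τ t) := by
    filter_upwards [hτ, (isOpen_pt_preimage h₂.isOpen_source).mem_nhds hu₂.1] with t ht htW
    obtain ⟨hW, -, heq⟩ := ht
    have hmem₂ := h₂.mapsTo (mem_of_pt htW)
    have hU : φ (pt 0 (τ t)) ∈ U := by
      have := hT.subset hmem₂.1.1
      rw [show φ₂ (pt 0 t) = φ (pt 0 (τ t)) from heq] at this
      exact this
    refine hT.isSurface.exists_normalVec_eq_smul (mem_of_pt hW).2 (mem_of_pt htW).2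
      (h.differentiableWithinAt (by simp) (mem_of_pt hW))
      (h₂.differentiableWithinAt (by simp) (mem_of_pt htW)) (h.immersive' (mem_of_pt hW))
      (h₂.immersive' (mem_of_pt htW)) heq.symm ?_ ?_
    · exact (h.eventually_mem (mem_of_pt hW) hT.isOpen hU).mono fun v hv => hT.extends_surface hv
    · exact (h₂.eventually_mem (mem_of_pt htW) isOpen_univ (mem_univ _)).mono fun v hv => hv.1.1
  have hb₂ := hτ.self_of_nhds
  have he : ∀ᶠ t in 𝓝 b₂, edgeCurve φ₂ t = edgeCurve φ (τ t) := hτ.mono fun t ht => ht.2.2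
  refine ⟨V₂, W₂, φ₂, b₂, τ, h₂, hK, ⟨hu₂.1, ?_⟩, hτb, hτc, ?_⟩
  · rw [inner_deriv_edgeNormal_reparam h h₂ hb₂.1 hu₂.1 hb₂.2.1 he hN, hτb]
    exact hb.2
  · filter_upwards [hτ, he.eventually_nhds, hN.eventually_nhds,
      (isOpen_pt_preimage h₂.isOpen_source).mem_nhds hu₂.1] with t ht he' hN' htW
    exact ⟨ht.2.2, edgeChar_reparam h h₂ ht.1 htW ht.2.1 he' hN'⟩

/-- The flat part of a flat extension lies in the envelope of the tangent planes. -/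
theorem exists_subset_iUnion_edgeChar (h : IsLocalParam ∞ S Γ V W φ) (hΓS : Γ ⊆ S) {b : ℝ}
    (hb : b ∈ regularParams W φ) {U T : Set E3} (hbU : edgeCurve φ b ∈ U)
    (hT : IsFlatExtension S Γ U T) {δ : ℝ} (hδ : 0 < δ) :
    ∃ V' : Set E3, IsOpen V' ∧ edgeCurve φ b ∈ V' ∧
      ∀ y ∈ (T \ (S \ Γ)) ∩ V', ∃ t, |t - b| < δ ∧ y ∈ edgeChar φ t := by
  obtain ⟨V₂, W₂, φ₂, b₂, τ, h₂, hK, hb₂, hτb, hτc, hτ⟩ := h.exists_flat_param hΓS hb hbU hT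
  have hτδ : ∀ᶠ t in 𝓝 b₂, |τ t - b| < δ :=
    ((hτc.sub continuousAt_const).abs).eventually_lt_const (by simpa [hτb] using hδ)
  obtain ⟨δ₂, hδ₂, hδ₂'⟩ := Metric.eventually_nhds_iff.1 (hτ.and hτδ)
  obtain ⟨B, hB, hBv⟩ := h₂.exists_mem_edgeChar_of_flat hK hb₂ hδ₂
  obtain ⟨V', hV', -, him⟩ := h₂.exists_image_eq (B := interior B ∩ W₂)
    (isOpen_interior.inter h₂.isOpen_source) inter_subset_right
  refine ⟨V', hV', ?_, ?_⟩
  · have : φ₂ (pt 0 b₂) ∈ T \ (S \ Γ) ∩ V' := him ▸ mem_image_of_mem φ₂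
      ⟨⟨mem_interior_iff_mem_nhds.2 hB, hb₂.1⟩, edge_subset_halfPlane (pt_mem_edge b₂)⟩
    have e := hτ.self_of_nhds.1
    rw [hτb] at e
    rw [← e]; exact this.2
  · intro y hy
    rw [← him] at hy
    obtain ⟨v, hv, rfl⟩ := hy
    obtain ⟨-, t, ht, -, hmem⟩ := hBv v ⟨interior_subset hv.1.1, hv.2⟩
    obtain ⟨⟨-, hchar⟩, hτt⟩ := hδ₂' (y := t) (by rwa [Real.dist_eq])
    exact ⟨τ t, hτt, hchar ▸ hmem⟩

/-- A patch of a surface that contains it is regular in the charts of that surface. -/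
theorem exists_chart_of_subset {S₁ Γ₁ V₁ : Set E3} {W₁ : Set E2} {ψ : E2 → E3}
    (hψ : IsLocalParam 1 S₁ Γ₁ V₁ W₁ ψ) {ρ : E3 → E2} {O : Set E3} (hO : IsOpen O)
    (hρ : ContDiffOn ℝ 1 ρ O) (hret : ∀ y ∈ S₁ ∩ O, ρ y ∈ W₁ ∩ halfPlane ∧ ψ (ρ y) = y)
    (h : IsLocalParam ∞ S Γ V W φ) {u : E2} (hu : u ∈ W ∩ halfPlane)
    (hS : ∀ᶠ v in 𝓝[halfPlane] u, φ v ∈ S₁ ∩ O) :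
    ∃ N : Set E2, IsOpen N ∧ u ∈ N ∧ N ⊆ W ∧ (∀ v ∈ N ∩ halfPlane, φ v ∈ S₁ ∩ O) ∧
      ContDiffOn ℝ 1 (fun v => ρ (φ v)) (N ∩ halfPlane) ∧
      (∀ x, fderivWithin ℝ (fun v => ρ (φ v)) halfPlane u x =
        fderiv ℝ ρ (φ u) (fderivWithin ℝ φ halfPlane u x)) ∧
      Function.Injective (fderivWithin ℝ (fun v => ρ (φ v)) halfPlane u) := by
  obtain ⟨N, hN, huN, hsub⟩ := mem_nhdsWithin.1 hS
  have hmem : ∀ v ∈ (N ∩ W) ∩ halfPlane, φ v ∈ S₁ ∩ O := fun v hv => hsub ⟨hv.1.1, hv.2⟩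
  have huO := (hmem u ⟨⟨huN, hu.1⟩, hu.2⟩)
  have hd : HasFDerivWithinAt φ (fderivWithin ℝ φ halfPlane u) halfPlane u :=
    (h.differentiableWithinAt (by simp) hu).hasFDerivWithinAt
  have hρd : HasFDerivAt ρ (fderiv ℝ ρ (φ u)) (φ u) :=
    ((hρ.contDiffAt (hO.mem_nhds huO.2)).differentiableAt one_ne_zero).hasFDerivAt
  have hcomp : HasFDerivWithinAt (fun v => ρ (φ v))
      ((fderiv ℝ ρ (φ u)).comp (fderivWithin ℝ φ halfPlane u)) halfPlane u :=
    hρd.comp_hasFDerivWithinAt u hd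
  have hfd := hcomp.fderivWithin (uniqueDiffOn_halfPlane u hu.2)
  refine ⟨N ∩ W, hN.inter h.isOpen_source, ⟨huN, hu.1⟩, inter_subset_right, hmem, ?_, ?_, ?_⟩
  · exact hρ.comp ((h.contDiffOn.of_le (by simp)).mono (inter_subset_inter_left _ inter_subset_right))
      fun v hv => (hmem v hv).2
  · intro x; rw [hfd]; rfl
  · have h2 : HasFDerivWithinAt ψ (fderivWithin ℝ ψ halfPlane (ρ (φ u))) halfPlane (ρ (φ u)) :=
      (hψ.differentiableWithinAt one_ne_zero (hret _ huO).1).hasFDerivWithinAt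
    have h3 : HasFDerivWithinAt (fun v => ψ (ρ (φ v)))
        ((fderivWithin ℝ ψ halfPlane (ρ (φ u))).comp
          ((fderiv ℝ ρ (φ u)).comp (fderivWithin ℝ φ halfPlane u))) halfPlane u := by
      refine HasFDerivWithinAt.comp_of_tendsto u h2 hcomp ?_
      refine tendsto_nhdsWithin_iff.2 ⟨hcomp.continuousWithinAt, ?_⟩
      filter_upwards [hS] with v hv using (hret _ hv).1.2
    have h4 : HasFDerivWithinAt φ ((fderivWithin ℝ ψ halfPlane (ρ (φ u))).comp
        ((fderiv ℝ ρ (φ u)).comp (fderivWithin ℝ φ halfPlane u))) halfPlane u := by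
      refine h3.congr_of_eventuallyEq ?_ (hret _ huO).2.symm
      filter_upwards [hS] with v hv using (hret _ hv).2.symm
    have h5 := h4.fderivWithin (uniqueDiffOn_halfPlane u hu.2)
    have h6 := h.immersive' hu
    rw [h5] at h6
    rw [hfd]
    exact Function.Injective.of_comp (f := fderivWithin ℝ ψ halfPlane (ρ (φ u))) h6

/-- The derivatives of a surface and of the flat part of a flat extension at a boundary point do
not point to the same side. -/
theorem fderivWithin_ne_of_isFlatExtension (h : IsLocalParam ∞ S Γ V W φ) {b : ℝ}
    (hb : pt 0 b ∈ W) {U T : Set E3} (hbU : edgeCurve φ b ∈ U)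
    (hT : IsFlatExtension S Γ U T) {V₂ : Set E3} {W₂ : Set E2} {φ₂ : E2 → E3} {b₂ : ℝ}
    (h₂ : IsLocalParam ∞ (T \ (S \ Γ)) (Γ ∩ U) V₂ W₂ φ₂) (hb₂ : pt 0 b₂ ∈ W₂)
    (he : edgeCurve φ₂ b₂ = edgeCurve φ b) {z z₂ : E2} (hz : 0 < z 0) (hz₂ : 0 < z₂ 0) :
    fderivWithin ℝ φ halfPlane (pt 0 b) z ≠ fderivWithin ℝ φ₂ halfPlane (pt 0 b₂) z₂ := by
  intro heq
  have hxT : edgeCurve φ b ∈ T := hT.extends_surface ⟨(h.mapsTo (mem_of_pt hb)).1, hbU⟩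
  obtain ⟨VT, WT, ψ, hxV, hψ⟩ := hT.isSurface.2 _ hxT
  have : edgeCurve φ b ∈ ψ '' (WT ∩ halfPlane) := by rw [hψ.image_eq]; exact ⟨hxT, hxV⟩
  obtain ⟨w, hw, hwe⟩ := this
  obtain ⟨ρ, O, B, hO, hB, hwB, hBW, -, -, hρ, hleft, hret⟩ :=
    hψ.exists_retraction le_rfl hw Filter.univ_mem
  have hret' : ∀ y ∈ T ∩ O, ρ y ∈ WT ∩ halfPlane ∧ ψ (ρ y) = y := fun y hy =>
    ⟨⟨hBW (hret y hy).1.1, (hret y hy).1.2⟩, (hret y hy).2⟩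
  have hxO : edgeCurve φ b ∈ O := by rw [← hwe]; exact (hleft w ⟨hwB, hw.2⟩).1
  have hS₁ : ∀ᶠ v in 𝓝[halfPlane] (pt 0 b), φ v ∈ T ∩ O :=
    (h.eventually_mem (mem_of_pt hb) (hT.isOpen.inter hO) ⟨hbU, hxO⟩).mono fun v hv =>
      ⟨hT.extends_surface ⟨hv.1, hv.2.1⟩, hv.2.2⟩
  have hS₂ : ∀ᶠ v in 𝓝[halfPlane] (pt 0 b₂), φ₂ v ∈ T ∩ O :=
    (h₂.eventually_mem (mem_of_pt hb₂) hO (by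
      change edgeCurve φ₂ b₂ ∈ O; rw [he]; exact hxO)).mono fun v hv => ⟨hv.1.1, hv.2⟩
  obtain ⟨N, hN, hbN, hNW, hNT, hsm, hder, hinj⟩ :=
    exists_chart_of_subset hψ hO hρ hret' h (mem_of_pt hb) hS₁
  obtain ⟨N₂, hN₂, hbN₂, hNW₂, hNT₂, hsm₂, hder₂, hinj₂⟩ :=
    exists_chart_of_subset hψ hO hρ hret' h₂ (mem_of_pt hb₂) hS₂
  -- In a chart of `T` both images contain the same short segment from the boundary point. Its
  -- points come from `v` with v₀ > 0, so they are interior points of `S` lying in the flat part,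
  -- which excludes them.
  have e1 := exists_interior_point_of_inward hN hsm hbN hinj hz (hN.mem_nhds hbN)
  have e2 := exists_interior_point_of_inward hN₂ hsm₂ hbN₂ hinj₂ hz₂ (hN₂.mem_nhds hbN₂)
  obtain ⟨ε, ⟨v, hvN, hv0, hv⟩, v₂, hvN₂, hv₂0, hv₂⟩ := (e1.and e2).exists
  have hbb : φ₂ (pt 0 b₂) = φ (pt 0 b) := he
  have hρeq : ρ (φ v) = ρ (φ₂ v₂) := by
    rw [hv, hv₂, hder, hder₂, heq, hbb]
  have hvh : v ∈ N ∩ halfPlane := ⟨hvN, hv0.le⟩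
  have hvh₂ : v₂ ∈ N₂ ∩ halfPlane := ⟨hvN₂, hv₂0.le⟩
  have hφeq : φ v = φ₂ v₂ := by
    rw [← (hret' _ (hNT v hvh)).2, hρeq, (hret' _ (hNT₂ v₂ hvh₂)).2]
  have hvW : v ∈ W ∩ halfPlane := ⟨hNW hvN, hv0.le⟩
  have hmem₂ := (h₂.mapsTo ⟨hNW₂ hvN₂, hv₂0.le⟩).1
  rw [← hφeq] at hmem₂
  refine hmem₂.2 ⟨(h.mapsTo hvW).1, fun hΓ => hv0.ne' ((h.mem_iff_mem_edge hvW).1 hΓ)⟩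

/-- Near a regular boundary point, the flat part of a flat extension is one side of the
envelope. -/
theorem exists_mem_iff_envelope (h : IsLocalParam ∞ S Γ V W φ) (hΓS : Γ ⊆ S) {b : ℝ}
    (hb : b ∈ regularParams W φ) {ρ : E3 → E2} {O : Set E3} {B : Set E2} (hO : IsOpen O)
    (hB : IsOpen B) (hbB : pt 0 b ∈ B) (hBr : B ⊆ {u | u 1 ∈ regularParams W φ})
    (hρ : ContDiffOn ℝ 1 ρ O) (hleft : ∀ v ∈ B, envelope φ v ∈ O ∧ ρ (envelope φ v) = v)
    {U T : Set E3} (hbU : edgeCurve φ b ∈ U) (hT : IsFlatExtension S Γ U T) :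
    ∃ V₀ : Set E3, IsOpen V₀ ∧ edgeCurve φ b ∈ V₀ ∧
      ∀ y ∈ V₀, y ∈ T \ (S \ Γ) ↔ y ∈ envelope φ '' (B ∩ halfPlane) := by
  obtain ⟨V₂, W₂, φ₂, b₂, τ, h₂, hK, hb₂, hτb, hτc, hτ⟩ := h.exists_flat_param hΓS hb hbU hT
  have hee : edgeCurve φ₂ b₂ = edgeCurve φ b := by have := hτ.self_of_nhds.1; rwa [hτb] at this
  have hxO : edgeCurve φ b ∈ O := by
    rw [← envelope_pt_zero]; exact (hleft _ hbB).1
  have hρx : ρ (edgeCurve φ b) = pt 0 b := by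
    rw [← envelope_pt_zero]; exact (hleft _ hbB).2
  -- near the point, the flat part lies in the patch of the envelope
  obtain ⟨r, hr, hrB⟩ := mem_nhds_pt (hB.mem_nhds hbB)
  obtain ⟨δ, hδ, ε, hε, hsmall⟩ := h.exists_small_param hb hr
  obtain ⟨V', hV', hxV', hV'c⟩ := h.exists_subset_iUnion_edgeChar hΓS hb hbU hT
    (δ := min δ r) (by positivity)
  have hpatch : ∀ y ∈ (T \ (S \ Γ)) ∩ (V' ∩ Metric.ball (edgeCurve φ b) ε),
      ρ y ∈ B ∧ envelope φ (ρ y) = y ∧ y ∈ O := by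
    rintro y ⟨hyT, hyV, hyε⟩
    obtain ⟨t, ht, hyc⟩ := hV'c y ⟨hyT, hyV⟩
    have ht1 := lt_of_lt_of_le ht (min_le_left _ _)
    have ht2 := lt_of_lt_of_le ht (min_le_right _ _)
    have htr : t ∈ regularParams W φ := hBr (hrB 0 t (by simpa using hr) ht2)
    rw [h.edgeChar_eq htr] at hyc
    obtain ⟨s, rfl⟩ := hyc
    have hsB := hrB s t (hsmall s t ht1 hyε) ht2
    change ρ (envelope φ (pt s t)) ∈ B ∧ envelope φ (ρ (envelope φ (pt s t))) = _ ∧ _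
    rw [(hleft _ hsB).2]
    exact ⟨hsB, rfl, (hleft _ hsB).1⟩
  have hOV : IsOpen (V' ∩ Metric.ball (edgeCurve φ b) ε) := hV'.inter Metric.isOpen_ball
  obtain ⟨N, hN, hbN, hNsub⟩ := mem_nhdsWithin.1 (h₂.eventually_mem (mem_of_pt hb₂.1) hOV
    (show edgeCurve φ₂ b₂ ∈ _ by rw [hee]; exact ⟨hxV', Metric.mem_ball_self hε⟩))
  have hτB : ∀ᶠ t in 𝓝 b₂, pt 0 (τ t) ∈ B :=
    (contDiff_pt_zero.continuous.continuousAt.comp hτc).eventually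
      (by simp only [Function.comp, hτb]; exact hB.mem_nhds hbB)
  obtain ⟨J, hJsub, hJ, hbJ⟩ := mem_nhds_iff.1 (hτ.and hτB)
  let W' : Set E2 := (N ∩ W₂) ∩ {u | u 1 ∈ J}
  have hW' : IsOpen W' := (hN.inter h₂.isOpen_source).inter (isOpen_coord_preimage hJ 1)
  have hbW' : pt 0 b₂ ∈ W' := ⟨⟨hbN, hb₂.1⟩, hbJ⟩
  have hW'p : ∀ v ∈ W' ∩ halfPlane, ρ (φ₂ v) ∈ B ∧ envelope φ (ρ (φ₂ v)) = φ₂ v ∧ φ₂ v ∈ O :=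
    fun v hv => hpatch _ (hNsub ⟨hv.1.1.1, hv.2⟩)
  -- The flat part read in the parameters of the envelope. It maps edge to edge, and the sign of the
  -- first coordinate of its inward derivative decides the side.
  let κ : E2 → E2 := fun v => ρ (φ₂ v)
  have hκ : ContDiffOn ℝ 1 κ (W' ∩ halfPlane) :=
    hρ.comp ((h₂.contDiffOn.of_le (by simp)).mono (inter_subset_inter_left _ fun v hv => hv.1.2))
      fun v hv => (hW'p v hv).2.2
  have hκb : κ (pt 0 b₂) = pt 0 b := by
    change ρ (edgeCurve φ₂ b₂) = _; rw [hee, hρx]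
  have hκe : ∀ t ∈ J, κ (pt 0 t) = pt 0 (τ t) := fun t ht => by
    obtain ⟨⟨he, -⟩, htB⟩ := hJsub ht
    change ρ (edgeCurve φ₂ t) = _
    rw [he, ← envelope_pt_zero]; exact (hleft _ htB).2
  have hedge : ∀ u ∈ W' ∩ edge, κ u ∈ edge := fun u hu => by
    rw [eq_pt_of_mem_edge hu.2, hκe _ hu.1.2]; exact pt_mem_edge _
  have hbh : pt 0 b₂ ∈ W' ∩ halfPlane := mem_of_pt hbW'
  have hκd : HasFDerivWithinAt κ (fderivWithin ℝ κ halfPlane (pt 0 b₂)) halfPlane (pt 0 b₂) := by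
    have := hκ.differentiableOn one_ne_zero _ hbh
    rw [inter_comm, differentiableWithinAt_inter (hW'.mem_nhds hbW')] at this
    exact this.hasFDerivWithinAt
  have hRd : HasFDerivAt (envelope φ) (fderiv ℝ (envelope φ) (pt 0 b)) (κ (pt 0 b₂)) := by
    rw [hκb]
    exact ((h.contDiffOn_envelope.contDiffAt ((isOpen_coord_preimage
      h.isOpen_regularParams 1).mem_nhds (show pt 0 b 1 ∈ _ from hb))).differentiableAt
      (by simp)).hasFDerivAt
  have hφ₂d : fderivWithin ℝ φ₂ halfPlane (pt 0 b₂) =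
      (fderiv ℝ (envelope φ) (pt 0 b)).comp (fderivWithin ℝ κ halfPlane (pt 0 b₂)) := by
    have h1 := hRd.comp_hasFDerivWithinAt (pt 0 b₂) hκd
    refine (HasFDerivWithinAt.congr_of_eventuallyEq h1 ?_ (hW'p _ hbh).2.1.symm).fderivWithin
      (uniqueDiffOn_halfPlane _ hbh.2)
    filter_upwards [self_mem_nhdsWithin, mem_nhdsWithin_of_mem_nhds (hW'.mem_nhds hbW')]
      with v hv hv' using (hW'p v ⟨hv', hv⟩).2.1.symm
  have hκinj : Function.Injective (fderivWithin ℝ κ halfPlane (pt 0 b₂)) := by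
    have := h₂.immersive' (mem_of_pt hb₂.1)
    rw [hφ₂d] at this
    exact Function.Injective.of_comp (f := fderiv ℝ (envelope φ) (pt 0 b)) this
  set a := fderivWithin ℝ κ halfPlane (pt 0 b₂) (ee 0) with ha
  have hκ1 : fderivWithin ℝ κ halfPlane (pt 0 b₂) (ee 1) 0 = 0 := by
    have h1 : HasDerivAt (fun t => κ (pt 0 t) 0)
        (fderivWithin ℝ κ halfPlane (pt 0 b₂) (ee 1) 0) b₂ :=
      (cc 0).hasFDerivAt.comp_hasDerivAt b₂ (hasDerivAt_comp_pt hκd.differentiableWithinAt)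
    have h2 : (fun t => κ (pt 0 t) 0) =ᶠ[𝓝 b₂] fun _ => (0 : ℝ) := by
      filter_upwards [hJ.mem_nhds hbJ] with t ht
      rw [hκe t ht, pt_zero]
    exact h1.unique ((hasDerivAt_const b₂ (0 : ℝ)).congr_of_eventuallyEq h2)
  have ha0 : a 0 ≠ 0 := by
    intro h0
    set a' := fderivWithin ℝ κ halfPlane (pt 0 b₂) (ee 1) with ha'
    have h1 : fderivWithin ℝ κ halfPlane (pt 0 b₂) (pt (a' 1) (-a 1)) = 0 := by
      rw [map_E2]
      apply E2_ext
      · simp [← ha, ← ha', h0, hκ1]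
      · simp [← ha, ← ha']; ring
    have h2 := hκinj (h1.trans (map_zero _).symm)
    have h3 : a' 1 = 0 := by simpa using congrArg (fun u : E2 => u 0) h2
    have h4 : ee 1 = 0 := hκinj (by
      rw [map_zero]; exact E2_ext hκ1 h3)
    simpa using congrArg (fun u : E2 => u 1) h4
  -- For a₀ < 0 the inward derivative a₀ ξ + a₁ γ' of the flat part equals -a₀ ∂₀φ + (a₁ + a₀
  -- `edgeShear`) γ', an inward derivative of `S`. This is excluded.
  have hapos : 0 < a 0 := by
    by_contra hneg
    have hneg' : a 0 < 0 := lt_of_le_of_ne (not_lt.1 hneg) ha0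
    refine h.fderivWithin_ne_of_isFlatExtension hb.1 hbU hT h₂ hb₂.1 hee
      (z := pt (-a 0) (a 1 + a 0 * edgeShear φ b)) (z₂ := ee 0) (by simpa using hneg') (by simp) ?_
    rw [hφ₂d, ContinuousLinearMap.comp_apply, ← ha, h.fderiv_envelope hb, map_E2]
    have hd := h.deriv_edgeCurve hb.1
    simp only [pt_zero, pt_one]
    change -a 0 • partialD halfPlane 0 φ (pt 0 b) +
      (a 1 + a 0 * edgeShear φ b) • partialD halfPlane 1 φ (pt 0 b) = _
    rw [← hd]
    simp [ruling]
    module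
  obtain ⟨N', hN', hN'W, hN'h, hsurj⟩ :=
    exists_half_homeomorph hW' hκ hbW' hκb hκinj hedge hapos
  obtain ⟨V₃, hV₃, -, him⟩ := h₂.exists_image_eq (B := interior N' ∩ W₂)
    (isOpen_interior.inter h₂.isOpen_source) inter_subset_right
  obtain ⟨G, hGsub, hG, hbG⟩ := mem_nhds_iff.1 hsurj
  refine ⟨V₃ ∩ (O ∩ ρ ⁻¹' G), hV₃.inter (hρ.continuousOn.isOpen_inter_preimage hO hG), ?_, ?_⟩
  · refine ⟨?_, hxO, by rw [mem_preimage, hρx]; exact hbG⟩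
    have : φ₂ (pt 0 b₂) ∈ T \ (S \ Γ) ∩ V₃ := him ▸ mem_image_of_mem φ₂
      ⟨⟨mem_interior_iff_mem_nhds.2 hN', hb₂.1⟩, edge_subset_halfPlane (pt_mem_edge b₂)⟩
    rw [← hee]; exact this.2
  · rintro y ⟨hyV, hyO, hyG⟩
    constructor
    · intro hyT
      have : y ∈ φ₂ '' (interior N' ∩ W₂ ∩ halfPlane) := him ▸ ⟨hyT, hyV⟩
      obtain ⟨v, hv, rfl⟩ := this
      have hvN := interior_subset hv.1.1
      have hp := hW'p v ⟨hN'W hvN, hv.2⟩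
      exact ⟨κ v, ⟨hp.1, hN'h v ⟨hvN, hv.2⟩⟩, hp.2.1⟩
    · rintro ⟨u, hu, rfl⟩
      rw [mem_preimage, (hleft u hu.1).2] at hyG
      obtain ⟨v, hv, rfl⟩ := hGsub hyG hu.2
      rw [(hW'p v hv).2.1]
      exact (h₂.mapsTo ⟨hv.1.1.2, hv.2⟩).1

/-- Flat extensions are locally unique. -/
theorem exists_inter_eq_of_isFlatExtension (h : IsLocalParam ∞ S Γ V W φ) (hΓS : Γ ⊆ S) {b : ℝ}
    (hb : b ∈ regularParams W φ) {U₁ T₁ U₂ T₂ : Set E3} (hb₁ : edgeCurve φ b ∈ U₁)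
    (hT₁ : IsFlatExtension S Γ U₁ T₁) (hb₂ : edgeCurve φ b ∈ U₂)
    (hT₂ : IsFlatExtension S Γ U₂ T₂) :
    ∃ V' : Set E3, IsOpen V' ∧ edgeCurve φ b ∈ V' ∧ T₁ ∩ V' = T₂ ∩ V' := by
  obtain ⟨ρ, O, B, hO, hB, hbB, hBr, hρ, hleft, -⟩ := h.exists_envelope_leftInverse hb
  obtain ⟨Y₁, hY₁, hbY₁, hm₁⟩ :=
    h.exists_mem_iff_envelope hΓS hb hO hB hbB hBr hρ hleft hb₁ hT₁
  obtain ⟨Y₂, hY₂, hbY₂, hm₂⟩ :=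
    h.exists_mem_iff_envelope hΓS hb hO hB hbB hBr hρ hleft hb₂ hT₂
  refine ⟨(Y₁ ∩ Y₂) ∩ (U₁ ∩ U₂), (hY₁.inter hY₂).inter (hT₁.isOpen.inter hT₂.isOpen),
    ⟨⟨hbY₁, hbY₂⟩, hb₁, hb₂⟩, ?_⟩
  ext y
  refine and_congr_left fun hy => ?_
  rw [hT₁.mem_iff hy.2.1, hT₂.mem_iff hy.2.2, hm₁ y hy.1.1, hm₂ y hy.1.2]

end IsLocalParam

end
end FlatExt

/-! ### From patches to embeddings of a manifold with boundary. -/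

namespace FlatExt
noncomputable section

/-! ### Parametrisations given by the charts of a manifold -/

section Charts

variable {M : Type*} [TopologicalSpace M] [ChartedSpace (EuclideanHalfSpace 2) M]

/-- An open subset of the plane which meets the half plane in the target of the chart at `p`. -/
def chartDomain (p : M) : Set E2 :=
  (𝓡∂ 2).symm ⁻¹' (chartAt (EuclideanHalfSpace 2) p).target

theorem isOpen_chartDomain (p : M) : IsOpen (chartDomain p) :=
  (chartAt (EuclideanHalfSpace 2) p).open_target.preimage (𝓡∂ 2).continuous_symm

theorem chartDomain_inter_halfPlane (p : M) :
    chartDomain p ∩ halfPlane = (extChartAt (𝓡∂ 2) p).target := by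
  rw [extChartAt_target, halfPlane_eq_range]; rfl

theorem interior_halfPlane : interior halfPlane = {u : E2 | 0 < u 0} := by
  rw [halfPlane_eq_range, interior_range_modelWithCornersEuclideanHalfSpace]

/-- Being an interior point can be tested in any chart of the atlas, so each chart sees the boundary
of `M` exactly as its edge. -/
theorem symm_mem_boundary_iff [IsManifold (𝓡∂ 2) ∞ M] {p : M} {u : E2}
    (hu : u ∈ chartDomain p ∩ halfPlane) :
    (extChartAt (𝓡∂ 2) p).symm u ∈ (𝓡∂ 2).boundary M ↔ u ∈ edge := by
  have hu' := hu
  rw [chartDomain_inter_halfPlane] at hu'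
  have hs : (extChartAt (𝓡∂ 2) p).symm u ∈ (chartAt (EuclideanHalfSpace 2) p).source := by
    have := (extChartAt (𝓡∂ 2) p).map_target hu'
    rwa [extChartAt_source] at this
  have h1 := ModelWithCorners.isInteriorPoint_iff_of_mem_atlas (n := ∞) (I := 𝓡∂ 2) (by simp)
    (chart_mem_atlas (EuclideanHalfSpace 2) p) hs
  have h2 : (chartAt (EuclideanHalfSpace 2) p).extend (𝓡∂ 2) ((extChartAt (𝓡∂ 2) p).symm u) = u :=
    (extChartAt (𝓡∂ 2) p).right_inv hu'
  have h3 : ((chartAt (EuclideanHalfSpace 2) p).extend (𝓡∂ 2)).target = chartDomain p ∩ halfPlane :=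
    (chartDomain_inter_halfPlane p).symm
  rw [h2, h3, interior_inter, (isOpen_chartDomain p).interior_eq, interior_halfPlane] at h1
  have h4 := ModelWithCorners.isInteriorPoint_iff_not_isBoundaryPoint (I := 𝓡∂ 2)
    ((extChartAt (𝓡∂ 2) p).symm u)
  have h5 : (0 : ℝ) ≤ u 0 := hu.2
  have h6 : u ∈ edge ↔ ¬ (0 < u 0) := by
    change u 0 = 0 ↔ _
    constructor
    · intro h; simp [h]
    · intro h; linarith
  change (𝓡∂ 2).IsBoundaryPoint _ ↔ _
  rw [h6]
  have h7 : u ∈ chartDomain p ∩ {u : E2 | 0 < u 0} ↔ 0 < u 0 := ⟨fun h => h.2, fun h => ⟨hu.1, h⟩⟩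
  rw [h7] at h1
  rw [← h1, h4, not_not]

theorem contMDiff_comp_extChartAt_symm [IsManifold (𝓡∂ 2) ∞ M] {f : M → E3}
    (hf : ContMDiff (𝓡∂ 2) 𝓘(ℝ, E3) ∞ f) (p : M) :
    ContDiffOn ℝ ∞ (fun u => f ((extChartAt (𝓡∂ 2) p).symm u)) (chartDomain p ∩ halfPlane) := by
  rw [chartDomain_inter_halfPlane, ← contMDiffOn_iff_contDiffOn]
  exact hf.comp_contMDiffOn (contMDiffOn_extChartAt_symm p)

theorem fderivWithin_comp_extChartAt_symm [IsManifold (𝓡∂ 2) ∞ M] {f : M → E3}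
    (hf : ContMDiff (𝓡∂ 2) 𝓘(ℝ, E3) ∞ f) {p : M} {u : E2} (hu : u ∈ chartDomain p ∩ halfPlane) :
    fderivWithin ℝ (fun u => f ((extChartAt (𝓡∂ 2) p).symm u)) halfPlane u =
      (mfderiv (𝓡∂ 2) 𝓘(ℝ, E3) f ((extChartAt (𝓡∂ 2) p).symm u)).comp
        (mfderivWithin 𝓘(ℝ, E2) (𝓡∂ 2) (extChartAt (𝓡∂ 2) p).symm (range (𝓡∂ 2)) u) := by
  have hu' := hu
  rw [chartDomain_inter_halfPlane] at hu'
  rw [halfPlane_eq_range, ← mfderivWithin_eq_fderivWithin]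
  refine mfderiv_comp_mfderivWithin u (hf.mdifferentiableAt (by simp))
    ((mdifferentiableWithinAt_extChartAt_symm hu')) ?_
  rw [← halfPlane_eq_range]
  exact (uniqueDiffOn_halfPlane u hu.2).uniqueMDiffWithinAt

end Charts

namespace Surface

variable {M : Type*} [TopologicalSpace M] [ChartedSpace (EuclideanHalfSpace 2) M]

theorem contMDiff (f : Surface M) : ContMDiff (𝓡∂ 2) 𝓘(ℝ, E3) ∞ f.toMap := f.1.contMDiff

theorem bdry_subset_carrier (f : Surface M) : f.bdry ⊆ f.carrier := image_subset_range _ _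

theorem mfderiv_toMap_eq (f : Surface M) (p : M) : mfderiv (𝓡∂ 2) 𝓘(ℝ, E3) f.toMap p =
    fderivWithin ℝ (f.localParam p) halfPlane (extChartAt (𝓡∂ 2) p p) := by
  rw [halfPlane_eq_range, (f.contMDiff.mdifferentiableAt (by simp)).mfderiv]
  rfl

variable [IsManifold (𝓡∂ 2) ∞ M]

theorem injective_fderivWithin_localParam (f : Surface M) {p : M} {u : E2}
    (hu : u ∈ chartDomain p ∩ halfPlane) :
    Function.Injective (fderivWithin ℝ (f.localParam p) halfPlane u) := by
  have h := fderivWithin_comp_extChartAt_symm f.contMDiff hu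
  have hu' := hu
  rw [chartDomain_inter_halfPlane] at hu'
  change Function.Injective (fderivWithin ℝ (fun u => f.toMap ((extChartAt (𝓡∂ 2) p).symm u))
    halfPlane u)
  rw [h]
  exact (f.2.2 _).comp (isInvertible_mfderivWithin_extChartAt_symm hu').injective

/-- As `f` is an embedding, some open `V` of space meets the surface only in the image of the chart
domain. All results on patches become applicable through this. -/
theorem isLocalParam (f : Surface M) (p : M) :
    ∃ V, IsLocalParam ∞ f.carrier f.bdry V (chartDomain p) (f.localParam p) := by
  obtain ⟨V, hV, hVs⟩ := f.2.1.isInducing.isOpen_iff.1 (isOpen_extChartAt_source (I := 𝓡∂ 2) p)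
  have hVs' : ∀ x, f.toMap x ∈ V ↔ x ∈ (extChartAt (𝓡∂ 2) p).source := fun x => by
    rw [← hVs]; rfl
  have hinj : Function.Injective f.toMap := f.2.1.injective
  refine ⟨V, hV, isOpen_chartDomain p, contMDiff_comp_extChartAt_symm f.contMDiff p, ?_, ?_, ?_, ?_⟩
  · intro u hu
    rw [fderivWithin_inter_halfPlane (isOpen_chartDomain p) hu.1]
    exact f.injective_fderivWithin_localParam hu
  · have h1 : Topology.IsEmbedding
        ((chartDomain p ∩ halfPlane).domRestrict (extChartAt (𝓡∂ 2) p).symm) := by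
      rw [chartDomain_inter_halfPlane]
      exact isEmbedding_domRestrict_of_leftInvOn (continuousOn_extChartAt_symm p)
        (continuousOn_extChartAt p) fun v hv =>
          ⟨(extChartAt (𝓡∂ 2) p).map_target hv, (extChartAt (𝓡∂ 2) p).right_inv hv⟩
    exact f.2.1.comp h1
  · rw [chartDomain_inter_halfPlane]
    ext y
    constructor
    · rintro ⟨u, hu, rfl⟩
      exact ⟨mem_range_self _, (hVs' _).2 ((extChartAt (𝓡∂ 2) p).map_target hu)⟩
    · rintro ⟨⟨x, rfl⟩, hx⟩
      have hx' := (hVs' _).1 hx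
      exact ⟨_, (extChartAt (𝓡∂ 2) p).map_source hx', by
        change f.toMap _ = _; rw [(extChartAt (𝓡∂ 2) p).left_inv hx']⟩
  · ext y
    constructor
    · rintro ⟨u, ⟨hu, hue⟩, rfl⟩
      have hu1 : u ∈ chartDomain p ∩ halfPlane := ⟨hu, edge_subset_halfPlane hue⟩
      refine ⟨mem_image_of_mem _ ((symm_mem_boundary_iff hu1).2 hue), ?_⟩
      rw [chartDomain_inter_halfPlane] at hu1
      exact (hVs' _).2 ((extChartAt (𝓡∂ 2) p).map_target hu1)
    · rintro ⟨⟨x, hxb, rfl⟩, hx⟩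
      have hx' := (hVs' _).1 hx
      have hl := (extChartAt (𝓡∂ 2) p).left_inv hx'
      have hm := (extChartAt (𝓡∂ 2) p).map_source hx'
      rw [← chartDomain_inter_halfPlane] at hm
      refine ⟨_, ⟨hm.1, (symm_mem_boundary_iff hm).1 (by rwa [hl])⟩, ?_⟩
      change f.toMap _ = _; rw [hl]

end Surface

/-! ### The boundary curve in terms of a parametrisation -/

section Boundary

variable {M : Type*} [TopologicalSpace M] [ChartedSpace (EuclideanHalfSpace 2) M]

/-- The parameter, in the chart at `p`, of a boundary point `q`. -/
def edgeParam (p q : M) : ℝ := extChartAt (𝓡∂ 2) p q 1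

theorem extChartAt_eq_pt [IsManifold (𝓡∂ 2) ∞ M] {p q : M} (hq : q ∈ (extChartAt (𝓡∂ 2) p).source)
    (hb : q ∈ (𝓡∂ 2).boundary M) : extChartAt (𝓡∂ 2) p q = pt 0 (edgeParam p q) := by
  have hm := (extChartAt (𝓡∂ 2) p).map_source hq
  rw [← chartDomain_inter_halfPlane] at hm
  refine eq_pt_of_mem_edge ((symm_mem_boundary_iff hm).1 ?_)
  rwa [(extChartAt (𝓡∂ 2) p).left_inv hq]

theorem pt_edgeParam_mem [IsManifold (𝓡∂ 2) ∞ M] {p q : M}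
    (hq : q ∈ (extChartAt (𝓡∂ 2) p).source) (hb : q ∈ (𝓡∂ 2).boundary M) :
    pt 0 (edgeParam p q) ∈ chartDomain p := by
  rw [← extChartAt_eq_pt hq hb]
  have hm := (extChartAt (𝓡∂ 2) p).map_source hq
  rw [← chartDomain_inter_halfPlane] at hm
  exact hm.1

theorem edgePoint_eq_pt [IsManifold (𝓡∂ 2) ∞ M] {p : M} (hb : p ∈ (𝓡∂ 2).boundary M) (t : ℝ) :
    Surface.edgePoint p t = pt 0 (edgeParam p p + t) := by
  rw [Surface.edgePoint, extChartAt_eq_pt (mem_extChartAt_source p) hb]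
  apply E2_ext <;> simp

variable [IsManifold (𝓡∂ 2) ∞ M]

namespace Surface

variable (f : Surface M) {p q : M}

theorem bdryCurve_eq (hb : p ∈ (𝓡∂ 2).boundary M) :
    f.bdryCurve p = fun t => edgeCurve (f.localParam p) (edgeParam p p + t) :=
  funext fun t => by rw [bdryCurve, edgePoint_eq_pt hb]; rfl

theorem bdryNormal_eq (hb : p ∈ (𝓡∂ 2).boundary M) :
    f.bdryNormal p = fun t => edgeNormal (f.localParam p) (edgeParam p p + t) :=
  funext fun t => by rw [bdryNormal, edgePoint_eq_pt hb]; rfl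

theorem edgeCurve_edgeParam (hq : q ∈ (extChartAt (𝓡∂ 2) p).source)
    (hb : q ∈ (𝓡∂ 2).boundary M) :
    edgeCurve (f.localParam p) (edgeParam p q) = f.toMap q := by
  rw [edgeCurve, ← extChartAt_eq_pt hq hb, localParam, (extChartAt (𝓡∂ 2) p).left_inv hq]

theorem deriv_bdryCurve (hb : p ∈ (𝓡∂ 2).boundary M) :
    deriv (f.bdryCurve p) 0 = deriv (edgeCurve (f.localParam p)) (edgeParam p p) := by
  rw [f.bdryCurve_eq hb, deriv_comp_const_add, add_zero]

theorem iteratedDeriv_bdryCurve (hb : p ∈ (𝓡∂ 2).boundary M) :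
    iteratedDeriv 2 (f.bdryCurve p) 0 =
      deriv (deriv (edgeCurve (f.localParam p))) (edgeParam p p) := by
  rw [f.bdryCurve_eq hb, iteratedDeriv_comp_const_add]
  simp only [add_zero]
  rw [iteratedDeriv_succ, iteratedDeriv_one]

theorem hasOsculatingPlane_iff_self (hb : p ∈ (𝓡∂ 2).boundary M) :
    f.HasOsculatingPlane p ↔ edgeBinormal (f.localParam p) (edgeParam p p) ≠ 0 := by
  rw [HasOsculatingPlane, f.deriv_bdryCurve hb, f.iteratedDeriv_bdryCurve hb,
    linearIndependent_iff_cross_ne_zero]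
  rfl

theorem characteristic_eq_self (hb : p ∈ (𝓡∂ 2).boundary M) :
    f.characteristic p = edgeChar (f.localParam p) (edgeParam p p) := by
  obtain ⟨V, h⟩ := f.isLocalParam p
  have hm := pt_edgeParam_mem (mem_extChartAt_source (I := 𝓡∂ 2) p) hb
  ext x
  simp only [characteristic, edgeChar, mem_ofPred_eq, f.bdryCurve_eq hb, f.bdryNormal_eq hb,
    add_zero]
  rw [deriv_comp_const_add
    (fun t => inner ℝ (x - edgeCurve (f.localParam p) t) (edgeNormal (f.localParam p) t)),
    add_zero, h.deriv_inner_sub_edgeCurve hm]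

/-- The parametrisations of the boundary given by two charts differ by a change of parameter. -/
theorem exists_edge_reparam (hq : q ∈ (extChartAt (𝓡∂ 2) p).source)
    (hb : q ∈ (𝓡∂ 2).boundary M) :
    ∃ τ : ℝ → ℝ, τ (edgeParam q q) = edgeParam p q ∧ ContinuousAt τ (edgeParam q q) ∧
      ∀ᶠ t in 𝓝 (edgeParam q q), pt 0 (τ t) ∈ chartDomain p ∧ DifferentiableAt ℝ τ t ∧
        edgeCurve (f.localParam q) t = edgeCurve (f.localParam p) (τ t) := by
  obtain ⟨V, h⟩ := f.isLocalParam p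
  obtain ⟨V', h'⟩ := f.isLocalParam q
  have hqq := mem_extChartAt_source (I := 𝓡∂ 2) q
  exact h.exists_reparam h' (by simp) Subset.rfl f.bdry_subset_carrier (pt_edgeParam_mem hq hb)
    (pt_edgeParam_mem hqq hb)
    ((f.edgeCurve_edgeParam hq hb).trans (f.edgeCurve_edgeParam hqq hb).symm)

/-- The definitions use at each boundary point its own preferred chart. This and `characteristic_eq`
bring nearby points into one fixed chart. -/
theorem hasOsculatingPlane_iff (hq : q ∈ (extChartAt (𝓡∂ 2) p).source)
    (hb : q ∈ (𝓡∂ 2).boundary M) :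
    f.HasOsculatingPlane q ↔ edgeBinormal (f.localParam p) (edgeParam p q) ≠ 0 := by
  obtain ⟨V, h⟩ := f.isLocalParam p
  obtain ⟨V', h'⟩ := f.isLocalParam q
  have hqq := mem_extChartAt_source (I := 𝓡∂ 2) q
  obtain ⟨τ, hτb, -, hτ⟩ := f.exists_edge_reparam hq hb
  rw [f.hasOsculatingPlane_iff_self hb, ← hτb]
  exact edgeBinormal_reparam h h' hτ.self_of_nhds.1 (pt_edgeParam_mem hqq hb)
    hτ.self_of_nhds.2.1 (hτ.mono fun t ht => ht.2.2) (hτ.mono fun t ht => ht.2.1)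

theorem characteristic_eq (hq : q ∈ (extChartAt (𝓡∂ 2) p).source)
    (hb : q ∈ (𝓡∂ 2).boundary M) :
    f.characteristic q = edgeChar (f.localParam p) (edgeParam p q) := by
  obtain ⟨V, h⟩ := f.isLocalParam p
  obtain ⟨V', h'⟩ := f.isLocalParam q
  have hqq := pt_edgeParam_mem (mem_extChartAt_source (I := 𝓡∂ 2) q) hb
  obtain ⟨τ, hτb, -, hτ⟩ := f.exists_edge_reparam hq hb
  rw [f.characteristic_eq_self hb, ← hτb]
  refine edgeChar_reparam h h' hτ.self_of_nhds.1 hqq hτ.self_of_nhds.2.1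
    (hτ.mono fun t ht => ht.2.2) ?_
  filter_upwards [hτ, (isOpen_pt_preimage (isOpen_chartDomain q)).mem_nhds hqq] with t ht htW
  have hm := IsLocalParam.mem_of_pt htW
  have hm' := IsLocalParam.mem_of_pt ht.1
  refine h'.exists_normalVec_eq_smul (by simp) hm hm'.2
    (h.differentiableWithinAt (by simp) hm') (h.immersive' hm') ht.2.2.symm ?_
  exact (h.eventually_mem hm' isOpen_univ (mem_univ _)).mono fun v hv => hv.1

theorem mem_tangentPlane_iff (hb : p ∈ (𝓡∂ 2).boundary M) {x : E3} :
    x ∈ f.tangentPlane p ↔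
      inner ℝ x (edgeNormal (f.localParam p) (edgeParam p p)) = 0 := by
  obtain ⟨V, h⟩ := f.isLocalParam p
  have hps := mem_extChartAt_source (I := 𝓡∂ 2) p
  have hm := pt_edgeParam_mem hps hb
  have key : x ∈ f.tangentPlane p ↔
      ∃ y, fderivWithin ℝ (f.localParam p) halfPlane (pt 0 (edgeParam p p)) y = x := by
    rw [tangentPlane, f.mfderiv_toMap_eq p, extChartAt_eq_pt hps hb]
    rfl
  rw [key]
  constructor
  · rintro ⟨y, rfl⟩
    exact inner_fderivWithin_normalVec _ _ _ _
  · intro hx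
    obtain ⟨r, s, hrs⟩ := eq_smul_add_smul_of_inner_eq_zero (h.edgeNormal_ne_zero hm)
      (h.edgeNormal_ne_zero hm) (inner_partialD_normalVec _ _ _ 0)
      (inner_partialD_normalVec _ _ _ 1) hx
    exact ⟨r • ee 0 + s • ee 1, by rw [hrs, map_add, map_smul, map_smul]; rfl⟩

/-- If ⟨γ', n'⟩ = 0 then ⟨γ'', n⟩ = 0, so the independent vectors γ', γ'' span the orthogonal
complement of n; that is the tangent plane, and the point would be osculating-tangent. -/
theorem edgeParam_mem_regularParams (hb : p ∈ (𝓡∂ 2).boundary M) (ho : f.HasOsculatingPlane p)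
    (ht : ¬ f.IsOsculatingTangent p) :
    edgeParam p p ∈ regularParams (chartDomain p) (f.localParam p) := by
  obtain ⟨V, h⟩ := f.isLocalParam p
  have hps := mem_extChartAt_source (I := 𝓡∂ 2) p
  have hm := pt_edgeParam_mem hps hb
  refine ⟨hm, fun h0 => ht ?_⟩
  have h1 := h.inner_deriv_deriv_edgeCurve_edgeNormal hm
  rw [h0, neg_zero] at h1
  have h2 := h.inner_deriv_edgeCurve_edgeNormal hm
  ext x
  rw [f.mem_tangentPlane_iff hb, osculatingPlane, f.deriv_bdryCurve hb,
    f.iteratedDeriv_bdryCurve hb, Submodule.mem_span_pair]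
  constructor
  · intro hx
    obtain ⟨r, s, hrs⟩ := eq_smul_add_smul_of_inner_eq_zero
      ((f.hasOsculatingPlane_iff_self hb).1 ho) (h.edgeNormal_ne_zero hm) h2 h1 hx
    exact ⟨r, s, hrs.symm⟩
  · rintro ⟨r, s, rfl⟩
    rw [inner_add_left, inner_smul_left, inner_smul_left, h1, h2]
    simp

/-- `N` consists of the points of `N₀` whose edge parameter in the chart at `p` is within `r` of
that of `p`. The envelope over `N` is then the union of the characteristic lines over an interval.
-/
theorem exists_flat_boundaryEnvelope (hb : p ∈ (𝓡∂ 2).boundary M)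
    (hr : edgeParam p p ∈ regularParams (chartDomain p) (f.localParam p)) {U T : Set E3}
    (hU : f.toMap p ∈ U) (hT : IsFlatExtension f.carrier f.bdry U T) {N₀ : Set M} (hN₀ : N₀ ∈ 𝓝 p) :
    ∃ N ∈ 𝓝 p, N ⊆ N₀ ∧ ∃ V : Set E3, IsOpen V ∧ f.toMap p ∈ V ∧
      IsFlatSurface (f.boundaryEnvelope N ∩ V) ∅ ∧
      (T \ (f.carrier \ f.bdry)) ∩ V ⊆ f.boundaryEnvelope N := by
  obtain ⟨V, h⟩ := f.isLocalParam p
  have hps := mem_extChartAt_source (I := 𝓡∂ 2) p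
  have hpe := f.edgeCurve_edgeParam hps hb
  have hsymm : (extChartAt (𝓡∂ 2) p).symm (pt 0 (edgeParam p p)) = p := by
    rw [← extChartAt_eq_pt hps hb, (extChartAt (𝓡∂ 2) p).left_inv hps]
  obtain ⟨δ, hδ, hreg, ε, hε, hflat⟩ := h.exists_isFlatSurface_envelope hr
  -- parameters whose points lie in `N₀`
  have hcont : ContinuousWithinAt (extChartAt (𝓡∂ 2) p).symm halfPlane (pt 0 (edgeParam p p)) := by
    rw [halfPlane_eq_range, ← extChartAt_eq_pt hps hb]
    exact (continuousAt_extChartAt_symm p).continuousWithinAt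
  have hcont' : ContinuousAt (fun t => (extChartAt (𝓡∂ 2) p).symm (pt 0 t)) (edgeParam p p) :=
    hcont.tendsto.comp (tendsto_nhdsWithin_iff.2 ⟨contDiff_pt_zero.continuous.continuousAt,
      Filter.Eventually.of_forall fun t => edge_subset_halfPlane (pt_mem_edge t)⟩)
  have hN₁ : ∀ᶠ t in 𝓝 (edgeParam p p), (extChartAt (𝓡∂ 2) p).symm (pt 0 t) ∈ N₀ :=
    hcont'.eventually (by simp only [hsymm]; exact hN₀)
  obtain ⟨δ₁, hδ₁, hδN⟩ := Metric.eventually_nhds_iff.1 hN₁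
  set r := min δ δ₁ with hrdef
  have hr0 : 0 < r := lt_min hδ hδ₁
  let N : Set M := N₀ ∩ ((extChartAt (𝓡∂ 2) p).source ∩
    {q | |edgeParam p q - edgeParam p p| < r})
  have hN : N ∈ 𝓝 p := by
    refine Filter.inter_mem hN₀ (Filter.inter_mem (extChartAt_source_mem_nhds p) ?_)
    have hc : ContinuousAt (fun q => |edgeParam p q - edgeParam p p|) p :=
      (((cc 1).continuous.continuousAt.comp (continuousAt_extChartAt p)).sub
        continuousAt_const).abs
    exact hc.eventually_lt_const (by simpa using hr0)
  have henv : f.boundaryEnvelope N =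
      ⋃ t ∈ Metric.ball (edgeParam p p) r, edgeChar (f.localParam p) t := by
    ext y
    simp only [boundaryEnvelope, mem_iUnion, exists_prop]
    constructor
    · rintro ⟨q, ⟨hqN, hqb⟩, hy⟩
      rw [f.characteristic_eq hqN.2.1 hqb] at hy
      exact ⟨_, hqN.2.2, hy⟩
    · rintro ⟨t, ht, hy⟩
      rw [Metric.mem_ball, Real.dist_eq] at ht
      have htW : pt 0 t ∈ chartDomain p := (hreg t (ht.trans_le (min_le_left _ _))).1
      have htm := IsLocalParam.mem_of_pt htW
      have htm' := htm
      rw [chartDomain_inter_halfPlane] at htm'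
      have hq := (extChartAt (𝓡∂ 2) p).map_target htm'
      have hqb := (symm_mem_boundary_iff htm).2 (pt_mem_edge t)
      have hqt : edgeParam p ((extChartAt (𝓡∂ 2) p).symm (pt 0 t)) = t := by
        rw [edgeParam, (extChartAt (𝓡∂ 2) p).right_inv htm', pt_one]
      refine ⟨_, ⟨⟨hδN ?_, hq, ?_⟩, hqb⟩, ?_⟩
      · rw [Real.dist_eq]; exact ht.trans_le (min_le_right _ _)
      · change |_ - _| < r; rw [hqt]; exact ht
      · rw [f.characteristic_eq hq hqb, hqt]; exact hy
  obtain ⟨V', hV', hpV', hsub⟩ := h.exists_subset_iUnion_edgeChar f.bdry_subset_carrier hr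
    (by rwa [hpe]) hT hr0
  refine ⟨N, hN, inter_subset_left, Metric.ball (f.toMap p) ε ∩ V', Metric.isOpen_ball.inter hV',
    ⟨Metric.mem_ball_self hε, by rwa [← hpe]⟩, ?_, ?_⟩
  · rw [henv]
    exact hflat _ Metric.isOpen_ball (fun t ht => by
        rw [Metric.mem_ball, Real.dist_eq] at ht; exact ht.trans_le (min_le_left _ _)) _
      (Metric.isOpen_ball.inter hV') (by rw [hpe]; exact inter_subset_left)
  · rintro y ⟨hyT, -, hyV⟩
    obtain ⟨t, ht, hy⟩ := hsub y ⟨hyT, hyV⟩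
    rw [henv, mem_iUnion₂]
    exact ⟨t, by rwa [Metric.mem_ball, Real.dist_eq], hy⟩

end Surface

end Boundary

end
end FlatExt

/-! ### Genericity of the osculating condition: openness and density. -/

namespace FlatExt
noncomputable section

/-! ### Locally finite covers -/

/-- A locally finite sequence of open sets, subordinate to a given system of neighbourhoods, and
compact subsets which still cover the space. -/
theorem exists_locallyFinite_compact_cover {X : Type*} [TopologicalSpace X] [T2Space X]
    [SecondCountableTopology X] [LocallyCompactSpace X] [Nonempty X] {U : X → Set X}
    (hU : ∀ x, U x ∈ 𝓝 x) :
    ∃ (x : ℕ → X) (B K : ℕ → Set X), (∀ n, IsOpen (B n)) ∧ (∀ n, B n ⊆ U (x n)) ∧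
      LocallyFinite B ∧ (∀ n, IsCompact (closure (B n))) ∧ (∀ n, IsCompact (K n)) ∧
      (∀ n, K n ⊆ B n) ∧ ⋃ n, K n = univ := by
  have h1 : ∀ x, ∃ C : Set X, C ∈ 𝓝 x ∧ C ⊆ U x ∧ IsCompact C := fun x => by
    obtain ⟨C, hC, hCU, hC'⟩ := local_compact_nhds (hU x)
    exact ⟨C, hC, hCU, hC'⟩
  choose C hC hCU hCc using h1
  obtain ⟨s, hs, hsU⟩ := TopologicalSpace.countable_cover_nhds
    (f := fun x => interior (C x)) fun x => interior_mem_nhds.2 (hC x)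
  have hne : s.Nonempty := by
    rw [nonempty_iff_ne_empty]; rintro rfl
    simp only [mem_empty_iff_false, iUnion_of_empty, iUnion_empty] at hsU
    exact empty_ne_univ hsU
  obtain ⟨x, rfl⟩ := hs.exists_eq_range hne
  rw [biUnion_range] at hsU
  obtain ⟨B, hB, hBu, hBf, hBC⟩ := precise_refinement (fun n => interior (C (x n)))
    (fun n => isOpen_interior) hsU
  obtain ⟨K, hKu, hK, hKB⟩ := exists_iUnion_eq_closed_subset hB (fun y => hBf.point_finite y) hBu
  have hBC' : ∀ n, B n ⊆ C (x n) := fun n => (hBC n).trans interior_subset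
  exact ⟨x, B, K, hB, fun n => (hBC' n).trans (hCU _), hBf,
    fun n => (hCc (x n)).of_isClosed_subset isClosed_closure
      (closure_minimal (hBC' n) (hCc (x n)).isClosed),
    fun n => (hCc (x n)).of_isClosed_subset (hK n) ((hKB n).trans (hBC' n)), hKB, hKu⟩

/-! ### Derivatives of maps on a manifold, in charts -/

section Jets

variable {M : Type*} [TopologicalSpace M] {F : Type*} [NormedAddCommGroup F] [NormedSpace ℝ F]

/-- The `j`-th derivative of `g` at `x`, measured in the chart `e`. -/
def chartJet (e : OpenPartialHomeomorph M (EuclideanHalfSpace 2)) (j : ℕ) (g : M → F) (x : M) :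
    E2 [×j]→L[ℝ] F :=
  iteratedFDerivWithin ℝ j (fun u => g ((e.extend (𝓡∂ 2)).symm u)) (range (𝓡∂ 2))
    (e.extend (𝓡∂ 2) x)

variable {e : OpenPartialHomeomorph M (EuclideanHalfSpace 2)} {x : M} {j : ℕ}

theorem chartJet_congr {g h : M → F} (hx : x ∈ e.source) (hgh : g =ᶠ[𝓝 x] h) :
    chartJet e j g x = chartJet e j h x := by
  have hc : Filter.Tendsto (e.extend (𝓡∂ 2)).symm (𝓝[range (𝓡∂ 2)] (e.extend (𝓡∂ 2) x)) (𝓝 x) := by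
    have := (e.continuousAt_extend_symm (I := 𝓡∂ 2) hx).continuousWithinAt
      (s := range (𝓡∂ 2))
    rw [ContinuousWithinAt, e.extend_left_inv hx] at this
    exact this
  refine Filter.EventuallyEq.iteratedFDerivWithin_eq
    (hgh.comp_tendsto hc) ?_ j
  simpa only [Function.comp_apply, e.extend_left_inv hx] using hgh.self_of_nhds

theorem chartJet_eq_zero {g : M → F} (hx : x ∈ e.source) (hg : ∀ᶠ y in 𝓝 x, g y = 0) :
    chartJet e j g x = 0 := by
  rw [chartJet_congr (h := fun _ => 0) hx hg]
  change iteratedFDerivWithin ℝ j (fun _ => (0 : F)) _ _ = 0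
  simp

variable [ChartedSpace (EuclideanHalfSpace 2) M]

theorem contDiffOn_comp_extend_symm (he : e ∈ IsManifold.maximalAtlas (𝓡∂ 2) ∞ M) {g : M → F}
    (hg : ContMDiff (𝓡∂ 2) 𝓘(ℝ, F) ∞ g) :
    ContDiffOn ℝ ∞ (fun u => g ((e.extend (𝓡∂ 2)).symm u)) (e.extend (𝓡∂ 2)).target := by
  rw [← contMDiffOn_iff_contDiffOn]
  have := contMDiffOn_extend_symm (I := 𝓡∂ 2) he
  rw [← e.extend_target'] at this
  exact hg.comp_contMDiffOn this

theorem contDiffWithinAt_comp_extend_symm (he : e ∈ IsManifold.maximalAtlas (𝓡∂ 2) ∞ M) {g : M → F}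
    (hg : ContMDiff (𝓡∂ 2) 𝓘(ℝ, F) ∞ g) (hx : x ∈ e.source) (n : ℕ) :
    ContDiffWithinAt ℝ n (fun u => g ((e.extend (𝓡∂ 2)).symm u)) (range (𝓡∂ 2))
      (e.extend (𝓡∂ 2) x) := by
  have hm : e.extend (𝓡∂ 2) x ∈ (e.extend (𝓡∂ 2)).target :=
    (e.extend (𝓡∂ 2)).map_source (by rwa [e.extend_source])
  exact ((contDiffOn_comp_extend_symm he hg _ hm).mono_of_mem_nhdsWithin
    (e.extend_target_mem_nhdsWithin hx)).of_le (by exact_mod_cast le_top)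

theorem chartJet_add (he : e ∈ IsManifold.maximalAtlas (𝓡∂ 2) ∞ M) {g h : M → F}
    (hg : ContMDiff (𝓡∂ 2) 𝓘(ℝ, F) ∞ g) (hh : ContMDiff (𝓡∂ 2) 𝓘(ℝ, F) ∞ h)
    (hx : x ∈ e.source) :
    chartJet e j (fun x => g x + h x) x = chartJet e j g x + chartJet e j h x :=
  iteratedFDerivWithin_add_apply (contDiffWithinAt_comp_extend_symm he hg hx j)
    (contDiffWithinAt_comp_extend_symm he hh hx j) (𝓡∂ 2).uniqueDiffOn (mem_range_self _)

theorem chartJet_sub (he : e ∈ IsManifold.maximalAtlas (𝓡∂ 2) ∞ M) {g h : M → F}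
    (hg : ContMDiff (𝓡∂ 2) 𝓘(ℝ, F) ∞ g) (hh : ContMDiff (𝓡∂ 2) 𝓘(ℝ, F) ∞ h)
    (hx : x ∈ e.source) :
    chartJet e j (fun x => g x - h x) x = chartJet e j g x - chartJet e j h x :=
  iteratedFDerivWithin_sub_apply (contDiffWithinAt_comp_extend_symm he hg hx j)
    (contDiffWithinAt_comp_extend_symm he hh hx j) (𝓡∂ 2).uniqueDiffOn (mem_range_self _)

theorem norm_chartJet_smul_const_le (he : e ∈ IsManifold.maximalAtlas (𝓡∂ 2) ∞ M) {g : M → ℝ}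
    (hg : ContMDiff (𝓡∂ 2) 𝓘(ℝ, ℝ) ∞ g) (hx : x ∈ e.source) (v : F) :
    ‖chartJet e j (fun x => g x • v) x‖ ≤ ‖v‖ * ‖chartJet e j g x‖ := by
  rw [chartJet, iteratedFDerivWithin_smul_const_apply
    (contDiffWithinAt_comp_extend_symm he hg hx j) (𝓡∂ 2).uniqueDiffOn (mem_range_self _)]
  refine (ContinuousLinearMap.norm_compContinuousMultilinearMap_le _ _).trans ?_
  gcongr
  · refine ContinuousLinearMap.opNorm_le_bound _ (norm_nonneg _) fun y => ?_
    simp [norm_smul, mul_comm]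
  · exact le_rfl

theorem continuousOn_chartJet (he : e ∈ IsManifold.maximalAtlas (𝓡∂ 2) ∞ M) {g : M → F}
    (hg : ContMDiff (𝓡∂ 2) 𝓘(ℝ, F) ∞ g) (j : ℕ) : ContinuousOn (chartJet e j g) e.source := by
  have hopen : ∃ O : Set E2, IsOpen O ∧ (e.extend (𝓡∂ 2)).target = range (𝓡∂ 2) ∩ O :=
    ⟨(𝓡∂ 2).symm ⁻¹' e.target, e.open_target.preimage (𝓡∂ 2).continuous_symm, by
      rw [e.extend_target, inter_comm]⟩
  obtain ⟨O, hO, hOt⟩ := hopen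
  have h1 : ContinuousOn (iteratedFDerivWithin ℝ j (fun u => g ((e.extend (𝓡∂ 2)).symm u))
      (range (𝓡∂ 2))) (e.extend (𝓡∂ 2)).target := by
    have hs := contDiffOn_comp_extend_symm he hg
    rw [hOt] at hs ⊢
    refine (hs.continuousOn_iteratedFDerivWithin (m := j) (by exact_mod_cast le_top)
      ((𝓡∂ 2).uniqueDiffOn.inter hO)).congr fun u hu => ?_
    exact (iteratedFDerivWithin_inter_open hO hu.2).symm
  have h2 : ContinuousOn (e.extend (𝓡∂ 2)) e.source := by
    have := e.continuousOn_extend (I := 𝓡∂ 2)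
    rwa [e.extend_source] at this
  exact h1.comp h2 fun x hx => (e.extend (𝓡∂ 2)).map_source (by rwa [e.extend_source])

/-- The derivatives of a map along the edge of the half plane. -/
theorem hasDerivAt_iteratedFDerivWithin_pt {φ : E2 → F} {W : Set E2} (hW : IsOpen W)
    (hφ : ContDiffOn ℝ ∞ φ (W ∩ halfPlane)) {t : ℝ} (ht : pt 0 t ∈ W) (j : ℕ) :
    HasDerivAt (fun t => iteratedFDerivWithin ℝ j φ halfPlane (pt 0 t) fun _ => ee 1)
      (iteratedFDerivWithin ℝ (j + 1) φ halfPlane (pt 0 t) fun _ => ee 1) t := by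
  have hm : pt 0 t ∈ halfPlane := edge_subset_halfPlane (pt_mem_edge t)
  have h1 : ContDiffWithinAt ℝ ∞ φ halfPlane (pt 0 t) :=
    (hφ _ ⟨ht, hm⟩).mono_of_mem_nhdsWithin
      (Filter.inter_mem (mem_nhdsWithin_of_mem_nhds (hW.mem_nhds ht)) self_mem_nhdsWithin)
  have h2 : DifferentiableWithinAt ℝ (iteratedFDerivWithin ℝ j φ halfPlane) halfPlane (pt 0 t) :=
    h1.differentiableWithinAt_iteratedFDerivWithin (by exact_mod_cast ENat.natCast_lt_top j)
      (by rw [insert_eq_of_mem hm]; exact uniqueDiffOn_halfPlane)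
  have h3 := hasDerivAt_comp_pt h2
  have h4 := (ContinuousMultilinearMap.apply ℝ (fun _ : Fin j => E2) F (fun _ => ee 1)).hasFDerivAt.comp_hasDerivAt t h3
  exact h4

/-- The derivatives of the boundary curve are values of jets on `ee 1`, so genericity is a condition
on 2-jets in charts. -/
theorem deriv_edgeCurve_eq {φ : E2 → E3} {W : Set E2} (hW : IsOpen W)
    (hφ : ContDiffOn ℝ ∞ φ (W ∩ halfPlane)) {t : ℝ} (ht : pt 0 t ∈ W) :
    deriv (edgeCurve φ) t = iteratedFDerivWithin ℝ 1 φ halfPlane (pt 0 t) fun _ => ee 1 := by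
  have := (hasDerivAt_iteratedFDerivWithin_pt hW hφ ht 0).deriv
  simp only [iteratedFDerivWithin_zero_apply] at this
  exact this

theorem deriv_deriv_edgeCurve_eq {φ : E2 → E3} {W : Set E2} (hW : IsOpen W)
    (hφ : ContDiffOn ℝ ∞ φ (W ∩ halfPlane)) {t : ℝ} (ht : pt 0 t ∈ W) :
    deriv (deriv (edgeCurve φ)) t =
      iteratedFDerivWithin ℝ 2 φ halfPlane (pt 0 t) fun _ => ee 1 := by
  rw [← (hasDerivAt_iteratedFDerivWithin_pt hW hφ ht 1).deriv]
  apply Filter.EventuallyEq.deriv_eq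
  filter_upwards [(isOpen_pt_preimage hW).mem_nhds ht] with s hs using deriv_edgeCurve_eq hW hφ hs

end Jets

/-! ### Genericity as a condition on derivatives -/

section Generic

variable {M : Type*} [TopologicalSpace M] [ChartedSpace (EuclideanHalfSpace 2) M]

/-- At `q`, the first two derivatives of `g` along the boundary direction of the chart at `p` are
linearly independent. -/
def GenericAt (g : M → E3) (p q : M) : Prop :=
  cross (chartJet (chartAt (EuclideanHalfSpace 2) p) 1 g q fun _ => ee 1)
    (chartJet (chartAt (EuclideanHalfSpace 2) p) 2 g q fun _ => ee 1) ≠ 0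

theorem norm_apply_ee_le {F : Type*} [NormedAddCommGroup F] [NormedSpace ℝ F] {j : ℕ}
    (m : E2 [×j]→L[ℝ] F) : ‖m fun _ => ee 1‖ ≤ ‖m‖ := by
  have := m.le_opNorm fun _ => ee 1
  simpa using this

variable [IsManifold (𝓡∂ 2) ∞ M] {p q : M}

theorem genericAt_iff {g : M → E3} (hg : ContMDiff (𝓡∂ 2) 𝓘(ℝ, E3) ∞ g)
    (hq : q ∈ (extChartAt (𝓡∂ 2) p).source) (hb : q ∈ (𝓡∂ 2).boundary M) :
    GenericAt g p q ↔
      edgeBinormal (fun u => g ((extChartAt (𝓡∂ 2) p).symm u)) (edgeParam p q) ≠ 0 := by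
  have hφ := contMDiff_comp_extChartAt_symm hg p
  have hm := pt_edgeParam_mem hq hb
  rw [edgeBinormal, deriv_edgeCurve_eq (isOpen_chartDomain p) hφ hm,
    deriv_deriv_edgeCurve_eq (isOpen_chartDomain p) hφ hm, ← extChartAt_eq_pt hq hb,
    halfPlane_eq_range]
  rfl

theorem Surface.hasOsculatingPlane_iff_genericAt (f : Surface M)
    (hq : q ∈ (extChartAt (𝓡∂ 2) p).source) (hb : q ∈ (𝓡∂ 2).boundary M) :
    f.HasOsculatingPlane q ↔ GenericAt f.toMap p q := by
  rw [f.hasOsculatingPlane_iff hq hb, genericAt_iff f.contMDiff hq hb]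
  rfl

theorem isOpen_cross_ne_zero : IsOpen {v : E3 × E3 | cross v.1 v.2 ≠ 0} := by
  have : Continuous fun v : E3 × E3 => cross v.1 v.2 := by
    have h : Continuous fun v : E3 × E3 => crossL v.1 v.2 :=
      (crossL.continuous.comp continuous_fst).clm_apply continuous_snd
    simpa only [crossL_apply] using h
  exact isOpen_ne_fun this continuous_const

/-- Genericity along the boundary points in a compact set is stable. -/
theorem exists_genericAt_of_norm_lt {g : M → E3} (hg : ContMDiff (𝓡∂ 2) 𝓘(ℝ, E3) ∞ g) {K : Set M}
    (hK : IsCompact K) (hKp : K ⊆ (chartAt (EuclideanHalfSpace 2) p).source)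
    (hgen : ∀ q ∈ K ∩ (𝓡∂ 2).boundary M, GenericAt g p q) :
    ∃ ε > 0, ∀ h : M → E3, ContMDiff (𝓡∂ 2) 𝓘(ℝ, E3) ∞ h →
      (∀ x ∈ K, ∀ j ≤ 2,
        ‖chartJet (chartAt (EuclideanHalfSpace 2) p) j (fun y => h y - g y) x‖ < ε) →
      ∀ q ∈ K ∩ (𝓡∂ 2).boundary M, GenericAt h p q := by
  let e := chartAt (EuclideanHalfSpace 2) p
  have he : e ∈ IsManifold.maximalAtlas (𝓡∂ 2) ∞ M := IsManifold.chart_mem_maximalAtlas p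
  let Q : (M → E3) → M → E3 × E3 := fun h x =>
    (chartJet e 1 h x fun _ => ee 1, chartJet e 2 h x fun _ => ee 1)
  have hcont : ContinuousOn (Q g) (K ∩ (𝓡∂ 2).boundary M) := by
    have h1 : ∀ j, ContinuousOn (fun x => chartJet e j g x fun _ => ee 1)
        (K ∩ (𝓡∂ 2).boundary M) := fun j =>
      (ContinuousMultilinearMap.apply ℝ (fun _ : Fin j => E2) E3
        (fun _ => ee 1)).continuous.comp_continuousOn
        ((continuousOn_chartJet he hg j).mono (inter_subset_left.trans hKp))
    exact (h1 1).prodMk (h1 2)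
  have hKb : IsCompact (K ∩ (𝓡∂ 2).boundary M) :=
    hK.inter_right (ModelWithCorners.isClosed_boundary (n := ∞) (by simp))
  -- The jets along the compact set form a compact subset of the open set of independent pairs, so
  -- some thickening stays inside.
  obtain ⟨ε, hε, hthick⟩ := (hKb.image_of_continuousOn hcont).exists_thickening_subset_open
    isOpen_cross_ne_zero (by rintro _ ⟨q, hq, rfl⟩; exact hgen q hq)
  refine ⟨ε, hε, fun h hh hclose q hq => ?_⟩
  change Q h q ∈ {v : E3 × E3 | cross v.1 v.2 ≠ 0}
  refine hthick (Metric.mem_thickening_iff.2 ⟨Q g q, mem_image_of_mem _ hq, ?_⟩)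
  have h1 : ∀ j ≤ 2, dist (chartJet e j h q fun _ => ee 1) (chartJet e j g q fun _ => ee 1) < ε := by
    intro j hj
    rw [dist_eq_norm]
    have h2 := hclose q hq.1 j hj
    rw [chartJet_sub he hh hg (hKp hq.1)] at h2
    exact (norm_apply_ee_le (chartJet e j h q - chartJet e j g q)).trans_lt h2
  rw [Prod.dist_eq]
  exact max_lt (h1 1 (by norm_num)) (h1 2 le_rfl)

/-- The generic embeddings form an open set. -/
theorem isOpen_setOf_isGeneric [T2Space M] [SecondCountableTopology M] :
    IsOpen {f : Surface M | f.IsGeneric} := by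
  rcases isEmpty_or_nonempty M with hM | hM
  · have : {f : Surface M | f.IsGeneric} = univ :=
      eq_univ_of_forall fun f p _ => hM.elim p
    rw [this]; exact isOpen_univ
  have := Manifold.locallyCompact_of_finiteDimensional (M := M) (𝓡∂ 2)
  rw [isOpen_iff_mem_nhds]
  intro f hf
  obtain ⟨x, B, K, -, hBU, hBf, -, hK, hKB, hKu⟩ := exists_locallyFinite_compact_cover
    (X := M) (U := fun x => (chartAt (EuclideanHalfSpace 2) x).source) 
    (fun x => chart_source_mem_nhds (EuclideanHalfSpace 2) x)
  have hKs : ∀ n, K n ⊆ (chartAt (EuclideanHalfSpace 2) (x n)).source := fun n =>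
    (hKB n).trans (hBU n)
  have h1 : ∀ n, ∃ ε > 0, ∀ h : M → E3, ContMDiff (𝓡∂ 2) 𝓘(ℝ, E3) ∞ h →
      (∀ y ∈ K n, ∀ j ≤ 2,
        ‖chartJet (chartAt (EuclideanHalfSpace 2) (x n)) j (fun y => h y - f.toMap y) y‖ < ε) →
      ∀ q ∈ K n ∩ (𝓡∂ 2).boundary M, GenericAt h (x n) q := fun n =>
    exists_genericAt_of_norm_lt f.contMDiff (hK n) (hKs n) fun q hq =>
      (f.hasOsculatingPlane_iff_genericAt (by rw [extChartAt_source]; exact hKs n hq.1) hq.2).1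
        (hf q hq.2)
  choose ε hε hgen using h1
  -- Because the cover is locally finite, the tolerances on all the `K n` together define a single
  -- generating set of the Whitney topology, with r = 2.
  let N : Set (SmoothMaps M) :=
    whitneyNhd f.1 2 (fun n => chartAt (EuclideanHalfSpace 2) (x n)) K ε
  have hN : IsOpen[whitneyTopology M] N :=
    TopologicalSpace.isOpen_generateFrom_of_mem ⟨f.1, 2, _, K, ε,
      fun n => IsManifold.chart_mem_maximalAtlas _, fun n => ⟨hK n, hKs n⟩,
      hBf.subset hKB, hε, rfl⟩
  have hN' : IsOpen (Subtype.val ⁻¹' N : Set (Surface M)) :=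
    @isOpen_induced _ _ (whitneyTopology M) _ _ hN
  refine Filter.mem_of_superset (hN'.mem_nhds ?_) ?_
  · intro n y hy j _
    change ‖chartJet (chartAt (EuclideanHalfSpace 2) (x n)) j (fun y => f.1 y - f.1 y) y‖ < ε n
    rw [chartJet_eq_zero (hKs n hy) (by simp), norm_zero]
    exact hε n
  · intro h hh q hq
    obtain ⟨n, hn⟩ := mem_iUnion.1 (hKu ▸ mem_univ q : q ∈ ⋃ n, K n)
    rw [h.hasOsculatingPlane_iff_genericAt (p := x n)
      (by rw [extChartAt_source]; exact hKs n hn) hq]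
    exact hgen n h.toMap h.contMDiff (fun y hy j hj => hh n y hy j hj) q ⟨hn, hq⟩

end Generic

end
end FlatExt

namespace FlatExt
noncomputable section

/-! ### Perturbing a curve -/

/-- For almost all `v`, the first two derivatives of the curve `γ + l • v.1 + (l ^ 2 / 2) • v.2` are
nowhere such that the second one is a multiple of the first one. -/
theorem dense_setOf_deriv_ne {J : Set ℝ} (hJ : IsOpen J) (hJc : Convex ℝ J) {γ : ℝ → E3}
    {l : ℝ → ℝ} (hγ : ContDiffOn ℝ ∞ γ J) (hl : ContDiffOn ℝ ∞ l J) (hl' : ∀ t ∈ J, deriv l t ≠ 0) :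
    Dense {v : E3 × E3 | ∀ t ∈ J, ∀ k : ℝ,
      deriv (deriv γ) t + deriv (deriv l) t • (v.1 + l t • v.2) + (deriv l t) ^ 2 • v.2 ≠
        k • (deriv γ t + deriv l t • (v.1 + l t • v.2))} := by
  -- Suppose the perturbed curve has velocity w at t and second derivative k w. As l' ≠ 0 one can
  -- solve for v: first v₁ + l v₂ = `s`, then v₂ = `b`. Bad values of v therefore lie in the image
  -- `Φ '' D`, and `D` has dimension 1 + 3 + 1 = 5 < 6.
  let D : Set (ℝ × E3 × ℝ) := J ×ˢ univ
  let s : ℝ × E3 × ℝ → E3 := fun z => (deriv l z.1)⁻¹ • (z.2.1 - deriv γ z.1)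
  let b : ℝ × E3 × ℝ → E3 := fun z => ((deriv l z.1)⁻¹) ^ 2 •
    (z.2.2 • z.2.1 - deriv (deriv γ) z.1 - deriv (deriv l) z.1 • s z)
  let Φ : ℝ × E3 × ℝ → E3 × E3 := fun z => (s z - l z.1 • b z, b z)
  have hγ1 : ContDiffOn ℝ ∞ (deriv γ) J := hγ.deriv_of_isOpen hJ (by simp)
  have hγ2 : ContDiffOn ℝ ∞ (deriv (deriv γ)) J := hγ1.deriv_of_isOpen hJ (by simp)
  have hl1 : ContDiffOn ℝ ∞ (deriv l) J := hl.deriv_of_isOpen hJ (by simp)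
  have hl2 : ContDiffOn ℝ ∞ (deriv (deriv l)) J := hl1.deriv_of_isOpen hJ (by simp)
  have hfst : ContDiffOn ℝ ∞ (fun z : ℝ × E3 × ℝ => z.1) D := contDiff_fst.contDiffOn
  have hm : MapsTo (fun z : ℝ × E3 × ℝ => z.1) D J := fun z hz => hz.1
  have hw : ContDiffOn ℝ ∞ (fun z : ℝ × E3 × ℝ => z.2.1) D :=
    (contDiff_fst.comp contDiff_snd).contDiffOn
  have hk : ContDiffOn ℝ ∞ (fun z : ℝ × E3 × ℝ => z.2.2) D :=
    (contDiff_snd.comp contDiff_snd).contDiffOn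
  have hinv : ContDiffOn ℝ ∞ (fun z : ℝ × E3 × ℝ => (deriv l z.1)⁻¹) D :=
    (hl1.comp hfst hm).inv fun z hz => hl' _ hz.1
  have hs : ContDiffOn ℝ ∞ s D := hinv.smul (hw.sub (hγ1.comp hfst hm))
  have hb : ContDiffOn ℝ ∞ b D := (hinv.pow 2).smul
    (((hk.smul hw).sub (hγ2.comp hfst hm)).sub ((hl2.comp hfst hm).smul hs))
  have hΦ : ContDiffOn ℝ 1 Φ D :=
    ((hs.sub ((hl.comp hfst hm).smul hb)).prodMk hb).of_le (by simp)
  have hdim : dimH D < (Module.finrank ℝ (E3 × E3) : ENNReal) := by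
    refine (dimH_mono (subset_univ D)).trans_lt ?_
    rw [Real.dimH_univ_eq_finrank]
    simp only [Module.finrank_prod, finrank_euclideanSpace, Fintype.card_fin, Module.finrank_self]
    norm_num
  refine (hΦ.dense_compl_image_of_dimH_lt_finrank (hJc.prod convex_univ) Subset.rfl hdim).mono ?_
  intro v hv t ht k hk
  apply hv
  set w := deriv γ t + deriv l t • (v.1 + l t • v.2) with hwdef
  have h0 := hl' t ht
  have hsz : s (t, w, k) = v.1 + l t • v.2 := by
    change (deriv l t)⁻¹ • (w - deriv γ t) = _
    rw [hwdef, add_sub_cancel_left, smul_smul, inv_mul_cancel₀ h0, one_smul]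
  have hbz : b (t, w, k) = v.2 := by
    change ((deriv l t)⁻¹) ^ 2 • (k • w - deriv (deriv γ) t - deriv (deriv l) t • s (t, w, k)) = _
    rw [hsz, ← hk, inv_pow]
    rw [show deriv (deriv γ) t + deriv (deriv l) t • (v.1 + l t • v.2) + (deriv l t) ^ 2 • v.2 -
      deriv (deriv γ) t - deriv (deriv l) t • (v.1 + l t • v.2) = (deriv l t) ^ 2 • v.2 by abel,
      smul_smul, inv_mul_cancel₀ (pow_ne_zero 2 h0), one_smul]
  refine ⟨(t, w, k), ⟨ht, mem_univ _⟩, ?_⟩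
  change (s (t, w, k) - l t • b (t, w, k), b (t, w, k)) = v
  rw [hsz, hbz, add_sub_cancel_right]

/-- The first two derivatives of a perturbed curve. -/
theorem deriv_perturbed_curve {J : Set ℝ} (hJ : IsOpen J) {γ η : ℝ → E3} {l : ℝ → ℝ}
    (hγ : ContDiffOn ℝ ∞ γ J) (hl : ContDiffOn ℝ ∞ l J) {t : ℝ} (ht : t ∈ J) {v : E3 × E3}
    (hη : ∀ᶠ s in 𝓝 t, η s = γ s + (l s • v.1 + (l s ^ 2 / 2) • v.2)) :
    deriv η t = deriv γ t + deriv l t • (v.1 + l t • v.2) ∧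
    deriv (deriv η) t =
      deriv (deriv γ) t + deriv (deriv l) t • (v.1 + l t • v.2) + (deriv l t) ^ 2 • v.2 := by
  have hγ1 : ContDiffOn ℝ ∞ (deriv γ) J := hγ.deriv_of_isOpen hJ (by simp)
  have hl1 : ContDiffOn ℝ ∞ (deriv l) J := hl.deriv_of_isOpen hJ (by simp)
  have dγ : ∀ s ∈ J, HasDerivAt γ (deriv γ s) s := fun s hs =>
    ((hγ.contDiffAt (hJ.mem_nhds hs)).differentiableAt (by simp)).hasDerivAt
  have dl : ∀ s ∈ J, HasDerivAt l (deriv l s) s := fun s hs =>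
    ((hl.contDiffAt (hJ.mem_nhds hs)).differentiableAt (by simp)).hasDerivAt
  have dγ1 : HasDerivAt (deriv γ) (deriv (deriv γ) t) t :=
    ((hγ1.contDiffAt (hJ.mem_nhds ht)).differentiableAt (by simp)).hasDerivAt
  have dl1 : HasDerivAt (deriv l) (deriv (deriv l) t) t :=
    ((hl1.contDiffAt (hJ.mem_nhds ht)).differentiableAt (by simp)).hasDerivAt
  have h1 : ∀ᶠ s in 𝓝 t, deriv η s = deriv γ s + deriv l s • (v.1 + l s • v.2) := by
    filter_upwards [hη.eventually_nhds, hJ.mem_nhds ht] with s hs hsJ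
    rw [Filter.EventuallyEq.deriv_eq hs]
    have hd := (dγ s hsJ).add (((dl s hsJ).smul_const v.1).add
      ((((dl s hsJ).pow 2).div_const 2).smul_const v.2))
    refine hd.deriv.trans ?_
    rw [smul_add, smul_smul]
    congr 3
    simp; ring
  refine ⟨h1.self_of_nhds, ?_⟩
  rw [Filter.EventuallyEq.deriv_eq h1]
  have hd := dγ1.add (dl1.smul (((dl t ht).smul_const v.2).const_add v.1))
  refine hd.deriv.trans ?_
  rw [smul_smul, ← pow_two]
  abel

end
end FlatExt

namespace FlatExt
noncomputable section

/-! ### Perturbations of Euclidean space -/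

section Perturb

variable {A C : ℕ → E3 → ℝ} {c c' : ℕ → E3 × E3} {n : ℕ}

/-- The sum of the identity and of finitely many perturbations. -/
def perturb (A C : ℕ → E3 → ℝ) (c : ℕ → E3 × E3) (n : ℕ) (y : E3) : E3 :=
  y + ∑ m ∈ Finset.range n, (A m y • (c m).1 + C m y • (c m).2)

theorem perturb_succ (y : E3) : perturb A C c (n + 1) y =
    perturb A C c n y + (A n y • (c n).1 + C n y • (c n).2) := by
  rw [perturb, perturb, Finset.sum_range_succ, add_assoc]

theorem perturb_congr (h : ∀ m < n, c m = c' m) : perturb A C c n = perturb A C c' n := by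
  funext y
  rw [perturb, perturb]
  congr 1
  refine Finset.sum_congr rfl fun m hm => ?_
  rw [h m (Finset.mem_range.1 hm)]

theorem perturb_eq_of_le {n' : ℕ} (hn : n ≤ n') {y : E3}
    (h : ∀ m, n ≤ m → A m y = 0 ∧ C m y = 0) : perturb A C c n' y = perturb A C c n y := by
  induction n', hn using Nat.le_induction with
  | base => rfl
  | succ k hk ih => rw [perturb_succ, ih, (h k hk).1, (h k hk).2]; simp

theorem contDiff_perturb (hA : ∀ m, ContDiff ℝ ∞ (A m)) (hC : ∀ m, ContDiff ℝ ∞ (C m)) :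
    ContDiff ℝ ∞ (perturb A C c n) :=
  contDiff_id.add (ContDiff.sum fun m _ =>
    ((hA m).smul contDiff_const).add ((hC m).smul contDiff_const))

/-- A Lipschitz condition on the members of the sum. -/
def SmallParam (LA LC : ℕ → NNReal) (m : ℕ) : Set (E3 × E3) :=
  {v | LA m * ‖v.1‖ + LC m * ‖v.2‖ < (1 / 2) ^ (m + 2)}

theorem smallParam_mem_nhds (LA LC : ℕ → NNReal) (m : ℕ) : SmallParam LA LC m ∈ 𝓝 0 := by
  have hc : Continuous fun v : E3 × E3 => (LA m : ℝ) * ‖v.1‖ + LC m * ‖v.2‖ := by fun_prop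
  exact hc.continuousAt.eventually_lt_const (by simp)

variable {LA LC : ℕ → NNReal}

/-- `SmallParam` makes the m-th term Lipschitz with constant less than 2^(-(m+2)). These sum to at
most 1/2, so the perturbation is the identity plus a contraction. -/
theorem norm_perturb_sub_le (hA : ∀ m, LipschitzWith (LA m) (A m))
    (hC : ∀ m, LipschitzWith (LC m) (C m)) (hc : ∀ m < n, c m ∈ SmallParam LA LC m) (y z : E3) :
    ‖(perturb A C c n y - y) - (perturb A C c n z - z)‖ ≤ (1 / 2) * ‖y - z‖ := by
  have h1 : (perturb A C c n y - y) - (perturb A C c n z - z) =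
      ∑ m ∈ Finset.range n, ((A m y - A m z) • (c m).1 + (C m y - C m z) • (c m).2) := by
    rw [perturb, perturb, add_sub_cancel_left, add_sub_cancel_left, ← Finset.sum_sub_distrib]
    refine Finset.sum_congr rfl fun m _ => ?_
    rw [sub_smul, sub_smul]; abel
  have h2 : ∀ m ∈ Finset.range n, ‖(A m y - A m z) • (c m).1 + (C m y - C m z) • (c m).2‖ ≤
      (1 / 2) ^ (m + 2) * ‖y - z‖ := by
    intro m hm
    refine (norm_add_le _ _).trans ?_
    rw [norm_smul, norm_smul]
    have hA' := (hA m).norm_sub_le y z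
    have hC' := (hC m).norm_sub_le y z
    have hcm : LA m * ‖(c m).1‖ + LC m * ‖(c m).2‖ < (1 / 2) ^ (m + 2) :=
      hc m (Finset.mem_range.1 hm)
    calc ‖A m y - A m z‖ * ‖(c m).1‖ + ‖C m y - C m z‖ * ‖(c m).2‖
        ≤ (LA m * ‖y - z‖) * ‖(c m).1‖ + (LC m * ‖y - z‖) * ‖(c m).2‖ := by gcongr
      _ = (LA m * ‖(c m).1‖ + LC m * ‖(c m).2‖) * ‖y - z‖ := by ring
      _ ≤ _ := by gcongr
  have h3 : ∑ m ∈ Finset.range n, (1 / 2 : ℝ) ^ (m + 2) ≤ 1 / 2 := by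
    have : ∀ k, ∑ m ∈ Finset.range k, (1 / 2 : ℝ) ^ (m + 2) = 1 / 2 - (1 / 2) ^ (k + 1) := by
      intro k
      induction k with
      | zero => norm_num
      | succ k ih => rw [Finset.sum_range_succ, ih]; ring
    rw [this]
    have : (0 : ℝ) ≤ (1 / 2) ^ (n + 1) := by positivity
    linarith
  rw [h1]
  refine (norm_sum_le_of_le _ h2).trans ?_
  rw [← Finset.sum_mul]
  gcongr

/-- The bound does not depend on `n`, so it survives the passage to locally finite infinite sums; it
gives injectivity and continuity of the inverse at once. -/
theorem norm_sub_le_perturb (hA : ∀ m, LipschitzWith (LA m) (A m))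
    (hC : ∀ m, LipschitzWith (LC m) (C m)) (hc : ∀ m < n, c m ∈ SmallParam LA LC m) (y z : E3) :
    ‖y - z‖ ≤ 2 * ‖perturb A C c n y - perturb A C c n z‖ := by
  have h1 := norm_perturb_sub_le hA hC hc y z
  have h2 : y - z = (perturb A C c n y - perturb A C c n z) -
      ((perturb A C c n y - y) - (perturb A C c n z - z)) := by abel
  have h3 := norm_sub_le (perturb A C c n y - perturb A C c n z)
    ((perturb A C c n y - y) - (perturb A C c n z - z))
  rw [← h2] at h3
  linarith

/-- In a kernel direction `D` would move points by o(t) only, against the expansion bound. -/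
theorem injective_fderiv_of_norm_sub_le {D : E3 → E3} {y : E3} (hD : DifferentiableAt ℝ D y)
    (h : ∀ z w, ‖z - w‖ ≤ 2 * ‖D z - D w‖) : Function.Injective (fderiv ℝ D y) := by
  rw [injective_iff_map_eq_zero]
  intro v hv
  by_contra hv0
  have h1 : HasDerivAt (fun t : ℝ => D (y + t • v)) 0 0 := by
    have h2 : HasDerivAt (fun t : ℝ => y + t • v) v 0 := by
      simpa using ((hasDerivAt_id (0 : ℝ)).smul_const v).const_add y
    have h3 : HasFDerivAt D (fderiv ℝ D y) (y + (0 : ℝ) • v) := by simpa using hD.hasFDerivAt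
    have h4 := h3.comp_hasDerivAt (0 : ℝ) h2
    rwa [hv] at h4
  have h5 := (hasDerivAt_iff_tendsto.1 h1)
  have h6 : ∀ᶠ t in 𝓝 (0 : ℝ), ‖t - 0‖⁻¹ * ‖D (y + t • v) - D (y + (0 : ℝ) • v) - (t - 0) • (0 : E3)‖ <
      ‖v‖ / 2 := h5.eventually_lt_const (by positivity)
  obtain ⟨δ, hδ, hball⟩ := Metric.eventually_nhds_iff.1 h6
  have h7 := hball (y := δ / 2) (by rw [Real.dist_eq, sub_zero, abs_of_pos (by positivity)]; linarith)
  have h8 := h (y + (δ / 2) • v) (y + (0 : ℝ) • v)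
  simp only [sub_zero, smul_zero, zero_smul, add_zero, add_sub_cancel_left, norm_smul] at h7 h8
  rw [Real.norm_of_nonneg (by positivity : (0 : ℝ) ≤ δ / 2)] at h7 h8
  rw [inv_mul_lt_iff₀ (by positivity)] at h7
  nlinarith

end Perturb

/-! ### Perturbed surfaces -/

section PerturbedSurface

variable {M : Type*} [TopologicalSpace M] {A C : ℕ → E3 → ℝ} {S : ℕ → Set M}

/-- The perturbation of `f` by a locally finite sum. -/
def perturbMap (f : M → E3) (A C : ℕ → E3 → ℝ) (S : ℕ → Set M) (c : ℕ → E3 × E3) (x : M) : E3 :=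
  perturb A C c (sInf {n | ∀ m, n ≤ m → x ∉ S m}) (f x)

/-- Near `x` only indices below `n` contribute, by local finiteness. The truncation index may vary
from point to point, but the terms in between are zero. -/
theorem perturbMap_eventuallyEq {f : M → E3} (hS : LocallyFinite S) (hSc : ∀ m, IsClosed (S m))
    (hAS : ∀ m x, x ∉ S m → A m (f x) = 0) (hCS : ∀ m x, x ∉ S m → C m (f x) = 0)
    (c : ℕ → E3 × E3) {x : M} {n : ℕ} (hx : ∀ m, n ≤ m → x ∉ S m) :
    perturbMap f A C S c =ᶠ[𝓝 x] perturb A C c n ∘ f := by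
  have hZ : IsClosed (⋃ m : {m // n ≤ m}, S m) :=
    (hS.comp_injective Subtype.val_injective).isClosed_iUnion fun m => hSc m
  have hxZ : (⋃ m : {m // n ≤ m}, S m)ᶜ ∈ 𝓝 x := hZ.isOpen_compl.mem_nhds (by
    simp only [mem_compl_iff, mem_iUnion, Subtype.exists, not_exists]
    exact hx)
  filter_upwards [hxZ] with y hy
  simp only [mem_compl_iff, mem_iUnion, Subtype.exists, not_exists] at hy
  have hne : {n | ∀ m, n ≤ m → y ∉ S m}.Nonempty := ⟨n, hy⟩
  have h1 := Nat.sInf_mem hne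
  have h2 : sInf {n | ∀ m, n ≤ m → y ∉ S m} ≤ n := Nat.sInf_le hy
  exact (perturb_eq_of_le h2 fun m hm => ⟨hAS m y (h1 m hm), hCS m y (h1 m hm)⟩).symm

theorem exists_forall_notMem_of_isCompact (hS : LocallyFinite S) {K : Set M} (hK : IsCompact K) :
    ∃ n, ∀ m, n ≤ m → ∀ x ∈ K, x ∉ S m := by
  obtain ⟨n, hn⟩ := (hS.finite_nonempty_inter_compact hK).bddAbove
  exact ⟨n + 1, fun m hm x hxK hxS => by
    have := hn (a := m) ⟨x, hxS, hxK⟩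
    omega⟩

variable [ChartedSpace (EuclideanHalfSpace 2) M]

/-- A map which locally is the composition of an embedding with an expanding smooth map of space
is an embedding, if it is expanding on the whole. -/
theorem Surface.exists_of_local_comp (f : Surface M) {h : M → E3}
    (hloc : ∀ x, ∃ D : E3 → E3, ContDiff ℝ ∞ D ∧ (∀ y z, ‖y - z‖ ≤ 2 * ‖D y - D z‖) ∧
      h =ᶠ[𝓝 x] D ∘ f.toMap)
    (hexp : ∀ x y, ‖f.toMap x - f.toMap y‖ ≤ 2 * ‖h x - h y‖) :
    ∃ g : Surface M, g.toMap = h := by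
  have hsm : ContMDiff (𝓡∂ 2) 𝓘(ℝ, E3) ∞ h := fun x => by
    obtain ⟨D, hD, -, he⟩ := hloc x
    exact (hD.contMDiff.comp f.contMDiff).contMDiffAt.congr_of_eventuallyEq he
  refine ⟨⟨⟨h, hsm⟩, ⟨?_, ?_⟩, ?_⟩, rfl⟩
  · rw [Topology.isInducing_iff_nhds]
    intro x
    refine le_antisymm (hsm.continuous.tendsto x).le_comap ?_
    rw [f.2.1.isInducing.nhds_eq_comap, ← Filter.tendsto_iff_comap, tendsto_iff_norm_sub_tendsto_zero]
    have h1 : Filter.Tendsto h (Filter.comap h (𝓝 (h x))) (𝓝 (h x)) := Filter.tendsto_comap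
    have h2 := (tendsto_iff_norm_sub_tendsto_zero.1 h1).const_mul 2
    rw [mul_zero] at h2
    exact squeeze_zero (fun _ => norm_nonneg _) (fun y => hexp y x) h2
  · intro x y hxy
    have h1 := hexp x y
    have hxy' : h x = h y := hxy
    rw [hxy', sub_self, norm_zero, mul_zero] at h1
    exact f.2.1.injective (sub_eq_zero.1 (norm_le_zero_iff.1 h1))
  · intro x
    obtain ⟨D, hD, hexpD, he⟩ := hloc x
    have hd : DifferentiableAt ℝ D (f.toMap x) := hD.differentiable (by simp) _
    have h1 : mfderiv (𝓡∂ 2) 𝓘(ℝ, E3) h x =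
        (fderiv ℝ D (f.toMap x)).comp (mfderiv (𝓡∂ 2) 𝓘(ℝ, E3) f.toMap x) := by
      rw [Filter.EventuallyEq.mfderiv_eq he,
        mfderiv_comp x hd.mdifferentiableAt (f.contMDiff.mdifferentiableAt (by simp)),
        mfderiv_eq_fderiv]
      rfl
    change Function.Injective (mfderiv (𝓡∂ 2) 𝓘(ℝ, E3) h x)
    rw [h1]
    exact (injective_fderiv_of_norm_sub_le hd hexpD).comp (f.2.2 x)

theorem Surface.exists_perturbMap (f : Surface M) (hS : LocallyFinite S) (hSc : ∀ m, IsClosed (S m))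
    (hAS : ∀ m x, x ∉ S m → A m (f.toMap x) = 0) (hCS : ∀ m x, x ∉ S m → C m (f.toMap x) = 0)
    (hA : ∀ m, ContDiff ℝ ∞ (A m)) (hC : ∀ m, ContDiff ℝ ∞ (C m)) {LA LC : ℕ → NNReal}
    (hLA : ∀ m, LipschitzWith (LA m) (A m)) (hLC : ∀ m, LipschitzWith (LC m) (C m))
    {c : ℕ → E3 × E3} (hc : ∀ m, c m ∈ SmallParam LA LC m) :
    ∃ g : Surface M, g.toMap = perturbMap f.toMap A C S c := by
  have hn : ∀ x, ∃ n, ∀ m, n ≤ m → x ∉ S m := fun x => by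
    obtain ⟨n, hn⟩ := exists_forall_notMem_of_isCompact hS (isCompact_singleton (x := x))
    exact ⟨n, fun m hm => hn m hm x rfl⟩
  have hev := fun x n hx => perturbMap_eventuallyEq hS hSc hAS hCS c (x := x) (n := n) hx
  refine f.exists_of_local_comp (fun x => ?_) fun x y => ?_
  · obtain ⟨n, hn⟩ := hn x
    exact ⟨_, contDiff_perturb hA hC, norm_sub_le_perturb hLA hLC fun m _ => hc m, hev x n hn⟩
  · obtain ⟨n, hnx⟩ := hn x
    obtain ⟨k, hky⟩ := hn y
    have h1 := (hev x (max n k) fun m hm => hnx m ((le_max_left _ _).trans hm)).self_of_nhds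
    have h2 := (hev y (max n k) fun m hm => hky m ((le_max_right _ _).trans hm)).self_of_nhds
    rw [h1, h2]
    exact norm_sub_le_perturb hLA hLC (fun m _ => hc m) _ _

theorem Surface.exists_perturb (f : Surface M)
    (hA : ∀ m, ContDiff ℝ ∞ (A m)) (hC : ∀ m, ContDiff ℝ ∞ (C m)) {LA LC : ℕ → NNReal}
    (hLA : ∀ m, LipschitzWith (LA m) (A m)) (hLC : ∀ m, LipschitzWith (LC m) (C m))
    {c : ℕ → E3 × E3} {n : ℕ} (hc : ∀ m < n, c m ∈ SmallParam LA LC m) :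
    ∃ g : Surface M, g.toMap = perturb A C c n ∘ f.toMap :=
  f.exists_of_local_comp (fun _ => ⟨_, contDiff_perturb hA hC, norm_sub_le_perturb hLA hLC hc,
    Filter.EventuallyEq.rfl⟩) fun _ _ => norm_sub_le_perturb hLA hLC hc _ _

end PerturbedSurface

end
end FlatExt

namespace FlatExt
noncomputable section

/-! ### Perturbations in the Whitney topology -/

section Whitney

variable {M : Type*} [TopologicalSpace M] [ChartedSpace (EuclideanHalfSpace 2) M]

theorem contMDiff_smul_add_smul {a b : M → ℝ} (ha : ContMDiff (𝓡∂ 2) 𝓘(ℝ, ℝ) ∞ a)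
    (hb : ContMDiff (𝓡∂ 2) 𝓘(ℝ, ℝ) ∞ b) (v : E3 × E3) :
    ContMDiff (𝓡∂ 2) 𝓘(ℝ, E3) ∞ fun y => a y • v.1 + b y • v.2 :=
  (ha.smul contMDiff_const).add (hb.smul contMDiff_const)

theorem eventually_norm_chartJet_lt {e : OpenPartialHomeomorph M (EuclideanHalfSpace 2)}
    (he : e ∈ IsManifold.maximalAtlas (𝓡∂ 2) ∞ M) {K : Set M} (hK : IsCompact K)
    (hKe : K ⊆ e.source) {a b : M → ℝ} (ha : ContMDiff (𝓡∂ 2) 𝓘(ℝ, ℝ) ∞ a)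
    (hb : ContMDiff (𝓡∂ 2) 𝓘(ℝ, ℝ) ∞ b) (j : ℕ) {ε : ℝ} (hε : 0 < ε) :
    ∀ᶠ v in 𝓝 (0 : E3 × E3), ∀ x ∈ K,
      ‖chartJet e j (fun y => a y • v.1 + b y • v.2) x‖ < ε := by
  obtain ⟨Ca, hCa⟩ := hK.exists_bound_of_continuousOn ((continuousOn_chartJet he ha j).mono hKe)
  obtain ⟨Cb, hCb⟩ := hK.exists_bound_of_continuousOn ((continuousOn_chartJet he hb j).mono hKe)
  have hc : Continuous fun v : E3 × E3 => ‖v.1‖ * Ca + ‖v.2‖ * Cb := by fun_prop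
  have h1 : ∀ᶠ v in 𝓝 (0 : E3 × E3), ‖v.1‖ * Ca + ‖v.2‖ * Cb < ε :=
    hc.continuousAt.eventually_lt_const (by simpa using hε)
  filter_upwards [h1] with v hv x hx
  have hs : ∀ {g : M → ℝ}, ContMDiff (𝓡∂ 2) 𝓘(ℝ, ℝ) ∞ g → ∀ w : E3,
      ContMDiff (𝓡∂ 2) 𝓘(ℝ, E3) ∞ fun y => g y • w := fun hg w => hg.smul contMDiff_const
  rw [chartJet_add he (hs ha v.1) (hs hb v.2) (hKe hx)]
  refine (norm_add_le _ _).trans_lt (lt_of_le_of_lt (add_le_add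
    (norm_chartJet_smul_const_le he ha (hKe hx) _)
    (norm_chartJet_smul_const_le he hb (hKe hx) _)) (lt_of_le_of_lt ?_ hv))
  gcongr
  · exact hCa x hx
  · exact hCb x hx

variable {A C : ℕ → E3 → ℝ} {S : ℕ → Set M}

/-- Sufficiently small perturbations stay in a Whitney neighbourhood. -/
theorem exists_perturbMap_mem_whitneyNhd (f : Surface M) (hS : LocallyFinite S)
    (hSc : ∀ m, IsClosed (S m)) (hSk : ∀ m, IsCompact (S m))
    (hAS : ∀ m x, x ∉ S m → A m (f.toMap x) = 0) (hCS : ∀ m x, x ∉ S m → C m (f.toMap x) = 0)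
    (hA : ∀ m, ContDiff ℝ ∞ (A m)) (hC : ∀ m, ContDiff ℝ ∞ (C m)) {f₀ : SmoothMaps M} {r : ℕ}
    {e : ℕ → OpenPartialHomeomorph M (EuclideanHalfSpace 2)} {K : ℕ → Set M} {ε : ℕ → ℝ}
    (he : ∀ i, e i ∈ IsManifold.maximalAtlas (𝓡∂ 2) ∞ M)
    (hK : ∀ i, IsCompact (K i) ∧ K i ⊆ (e i).source) (hKf : LocallyFinite K)
    (hf : f.1 ∈ whitneyNhd f₀ r e K ε) :
    ∃ O : ℕ → Set (E3 × E3), (∀ m, O m ∈ 𝓝 0) ∧ ∀ c : ℕ → E3 × E3, (∀ m, c m ∈ O m) →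
      ∀ g : SmoothMaps M, (g : M → E3) = perturbMap f.toMap A C S c →
        g ∈ whitneyNhd f₀ r e K ε := by
  have hA' : ∀ m, ContMDiff (𝓡∂ 2) 𝓘(ℝ, ℝ) ∞ fun y => A m (f.toMap y) := fun m =>
    (hA m).contMDiff.comp f.contMDiff
  have hC' : ∀ m, ContMDiff (𝓡∂ 2) 𝓘(ℝ, ℝ) ∞ fun y => C m (f.toMap y) := fun m =>
    (hC m).contMDiff.comp f.contMDiff
  have hff₀ : ContMDiff (𝓡∂ 2) 𝓘(ℝ, E3) ∞ fun y => f.toMap y - f₀ y :=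
    f.contMDiff.sub f₀.contMDiff
  -- The strict inequalities for `f` leave room on each compact set; the perturbations will share
  -- it.
  have hslack : ∀ i j, ∃ η > 0, j ≤ r → ∀ x ∈ K i,
      ‖chartJet (e i) j (fun y => f.toMap y - f₀ y) x‖ + η ≤ ε i := by
    intro i j
    by_cases hj : j ≤ r
    · rcases (K i).eq_empty_or_nonempty with hemp | hne
      · exact ⟨1, one_pos, fun _ x hx => by rw [hemp] at hx; exact hx.elim⟩
      obtain ⟨z, hz, hmax⟩ := (hK i).1.exists_isMaxOn hne
        ((continuousOn_chartJet (he i) hff₀ j).mono (hK i).2).norm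
      refine ⟨ε i - ‖chartJet (e i) j (fun y => f.toMap y - f₀ y) z‖,
        sub_pos.2 (hf i z hz j hj), fun _ x hx => ?_⟩
      have : ‖_‖ ≤ ‖_‖ := hmax hx
      linarith
    · exact ⟨1, one_pos, fun h => absurd h hj⟩
  choose η hη hslack using hslack
  let T : ℕ → E3 × E3 → M → E3 := fun m v y => A m (f.toMap y) • v.1 + C m (f.toMap y) • v.2
  have hT : ∀ m v, ContMDiff (𝓡∂ 2) 𝓘(ℝ, E3) ∞ (T m v) := fun m v =>
    contMDiff_smul_add_smul (hA' m) (hC' m) v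
  -- The m-th term may use the fraction 2^(-(m+2)) of the room, less than one half altogether. Only
  -- finitely many `K i` meet `S m`, so finitely many conditions restrict each `v`.
  refine ⟨fun m => {v | ∀ i, ∀ x ∈ K i, ∀ j ≤ r,
    ‖chartJet (e i) j (T m v) x‖ ≤ η i j * (1 / 2) ^ (m + 2)}, fun m => ?_, ?_⟩
  · have hfin := hKf.finite_nonempty_inter_compact (hSk m)
    have h1 : ∀ᶠ v in 𝓝 (0 : E3 × E3), ∀ i ∈ {i | (K i ∩ S m).Nonempty}, ∀ j ∈ Iic r, ∀ x ∈ K i,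
        ‖chartJet (e i) j (T m v) x‖ < η i j * (1 / 2) ^ (m + 2) := by
      rw [Filter.eventually_all_finite hfin]
      intro i _
      rw [Filter.eventually_all_finite (finite_Iic r)]
      intro j _
      exact eventually_norm_chartJet_lt (he i) (hK i).1 (hK i).2 (hA' m) (hC' m) j
        (mul_pos (hη i j) (by positivity))
    filter_upwards [h1] with v hv i x hx j hj
    by_cases hi : (K i ∩ S m).Nonempty
    · exact (hv i hi j hj x hx).le
    · have hxS : x ∉ S m := fun h => hi ⟨x, hx, h⟩
      rw [chartJet_eq_zero ((hK i).2 hx), norm_zero]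
      · exact (mul_pos (hη i j) (by positivity)).le
      · filter_upwards [(hSc m).isOpen_compl.mem_nhds hxS] with y hy
        simp only [T]
        rw [hAS m y hy, hCS m y hy]
        simp
  · intro c hc g hg i x hx j hj
    obtain ⟨n, hn⟩ := exists_forall_notMem_of_isCompact hS (isCompact_singleton (x := x))
    have hev := perturbMap_eventuallyEq hS hSc hAS hCS c fun m hm => hn m hm x rfl
    change ‖chartJet (e i) j (fun y => g y - f₀ y) x‖ < ε i
    have hxe := (hK i).2 hx
    rw [chartJet_congr (h := fun y => perturb A C c n (f.toMap y) - f₀ y) hxe (by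
      filter_upwards [hev] with y hy
      rw [hg, hy]; rfl)]
    have hsum : ∀ n, ‖chartJet (e i) j (fun y => perturb A C c n (f.toMap y) - f₀ y) x‖ ≤
        ‖chartJet (e i) j (fun y => f.toMap y - f₀ y) x‖ + η i j * (1 / 2 - (1 / 2) ^ (n + 1)) := by
      intro n
      induction n with
      | zero => simp [perturb]
      | succ n ih =>
        have heq : (fun y => perturb A C c (n + 1) (f.toMap y) - f₀ y) =
            fun y => (perturb A C c n (f.toMap y) - f₀ y) + T n (c n) y := by
          funext y; rw [perturb_succ]; simp only [T]; abel
        have hp : ContMDiff (𝓡∂ 2) 𝓘(ℝ, E3) ∞ fun y => perturb A C c n (f.toMap y) - f₀ y :=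
          ((contDiff_perturb hA hC).contMDiff.comp f.contMDiff).sub f₀.contMDiff
        rw [heq, chartJet_add (he i) hp (hT n (c n)) hxe]
        refine (norm_add_le _ _).trans ((add_le_add ih (hc n i x hx j hj)).trans (le_of_eq ?_))
        ring
    refine (hsum n).trans_lt (lt_of_lt_of_le ?_ (hslack i j hj x hx))
    have h3 : (0 : ℝ) < (1 / 2) ^ (n + 1) := by positivity
    have h4 := hη i j
    nlinarith [mul_pos h4 h3]

end Whitney

/-! ### Sequences with prescribed initial segments -/

/-- Step `n` changes the entry `n` only and `P n` depends on the entries below `n`, so the diagonal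
sequence satisfies every `P n`. -/
theorem exists_seq_of_step {α : Type*} (P : ℕ → (ℕ → α) → Prop)
    (hcongr : ∀ n c c', (∀ m < n, c m = c' m) → P n c → P n c') (c₀ : ℕ → α) (h₀ : P 0 c₀)
    (step : ∀ n c, P n c → ∃ v, P (n + 1) (Function.update c n v)) : ∃ c, ∀ n, P n c := by
  choose v hv using step
  let s : ∀ n, {c // P n c} := fun n =>
    Nat.rec ⟨c₀, h₀⟩ (fun n c => ⟨Function.update c.1 n (v n c.1 c.2), hv n c.1 c.2⟩) n
  have hs : ∀ n, (s (n + 1)).1 = Function.update (s n).1 n (v n (s n).1 (s n).2) := fun _ => rfl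
  have hlt : ∀ n m, m < n → (s n).1 m = (s (m + 1)).1 m := by
    intro n
    induction n with
    | zero => intro m hm; omega
    | succ n ih =>
      intro m hm
      rcases Nat.lt_succ_iff_lt_or_eq.1 hm with h | rfl
      · rw [← ih m h, hs, Function.update_of_ne h.ne]
      · rfl
  exact ⟨fun m => (s (m + 1)).1 m, fun n => hcongr n _ _ (fun m hm => hlt n m hm) (s n).2⟩

/-! ### Making the boundary curve generic near a point -/

section Local

variable {M : Type*} [TopologicalSpace M] [ChartedSpace (EuclideanHalfSpace 2) M]

theorem continuousAt_symm_pt {p : M} {t : ℝ} (ht : pt 0 t ∈ chartDomain p) :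
    ContinuousAt (fun t => (extChartAt (𝓡∂ 2) p).symm (pt 0 t)) t := by
  have h1 : ContinuousOn (extChartAt (𝓡∂ 2) p).symm (chartDomain p ∩ halfPlane) := by
    rw [chartDomain_inter_halfPlane]; exact continuousOn_extChartAt_symm p
  refine ContinuousOn.continuousAt (s := {t | pt 0 t ∈ chartDomain p}) (h1.comp
    contDiff_pt_zero.continuous.continuousOn fun s hs => IsLocalParam.mem_of_pt hs)
    ((isOpen_pt_preimage (isOpen_chartDomain p)).mem_nhds ht)

/-- Cut-off functions in space for compact subsets of a surface. -/
theorem Surface.exists_cutoff (f : Surface M) {B K : Set M} (hB : IsOpen B) (hK : IsCompact K)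
    (hKB : K ⊆ B) : ∃ (H : E3 → ℝ) (S : Set M), ContDiff ℝ ∞ H ∧ HasCompactSupport H ∧
      IsClosed S ∧ S ⊆ B ∧ (∀ x, x ∉ S → H (f.toMap x) = 0) ∧
      ∀ x ∈ K, ∀ᶠ y in 𝓝 (f.toMap x), H y = 1 := by
  -- The cut-off must be a function on space, for the perturbation is to be a composition of `f`
  -- with a map of space. The embedding property supplies the open set for its support.
  obtain ⟨O, hO, hOB⟩ := f.2.1.isInducing.isOpen_iff.1 hB
  have hfK : IsCompact (f.toMap '' K) := hK.image f.2.1.continuous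
  have hsub : f.toMap '' K ⊆ O := by
    rintro _ ⟨x, hx, rfl⟩
    have : x ∈ f.1 ⁻¹' O := by rw [hOB]; exact hKB hx
    exact this
  obtain ⟨L, hL, hKL, hLO⟩ := exists_compact_between hfK hO hsub
  obtain ⟨H, hH1, hH0, -⟩ := exists_contMDiffMap_one_nhds_of_subset_interior (n := ⊤) 𝓘(ℝ, E3)
    hfK.isClosed hKL
  refine ⟨H, f.toMap ⁻¹' L, H.contMDiff.contDiff, HasCompactSupport.intro hL hH0,
    hL.isClosed.preimage f.2.1.continuous, ?_, fun x hx => hH0 _ hx, fun x hx => ?_⟩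
  · rw [← hOB]; exact preimage_mono hLO
  · exact (eventually_nhdsSet_iff_forall.1 hH1) _ (mem_image_of_mem _ hx)

variable [IsManifold (𝓡∂ 2) ∞ M]

/-- Near a point, some linear function has nonzero derivative along the boundary curve. -/
theorem Surface.exists_nhds_inner_deriv_ne_zero (f : Surface M) (x : M) :
    ∃ U ∈ 𝓝 x, ∃ (J : Set ℝ) (w : E3), IsOpen J ∧ Convex ℝ J ∧
      U ⊆ (chartAt (EuclideanHalfSpace 2) x).source ∧
      (∀ t ∈ J, pt 0 t ∈ chartDomain x ∧
        (inner ℝ (deriv (edgeCurve (f.localParam x)) t) w : ℝ) ≠ 0) ∧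
      ∀ q ∈ U ∩ (𝓡∂ 2).boundary M, edgeParam x q ∈ J := by
  have hsrc := chart_source_mem_nhds (EuclideanHalfSpace 2) x
  by_cases hx : x ∈ (𝓡∂ 2).boundary M
  · obtain ⟨V, h⟩ := f.isLocalParam x
    have hm := pt_edgeParam_mem (mem_extChartAt_source (I := 𝓡∂ 2) x) hx
    set w := deriv (edgeCurve (f.localParam x)) (edgeParam x x)
    have hne : (inner ℝ w w : ℝ) ≠ 0 := by
      simpa using h.deriv_edgeCurve_ne_zero hm
    have h1 : ∀ᶠ t in 𝓝 (edgeParam x x), pt 0 t ∈ chartDomain x ∧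
        (inner ℝ (deriv (edgeCurve (f.localParam x)) t) w : ℝ) ≠ 0 :=
      Filter.Eventually.and ((isOpen_pt_preimage (isOpen_chartDomain x)).mem_nhds hm)
        (((h.hasDerivAt_deriv_edgeCurve hm).continuousAt.inner
          continuousAt_const).eventually_ne hne)
    obtain ⟨δ, hδ, hball⟩ := Metric.eventually_nhds_iff_ball.1 h1
    refine ⟨_, Filter.inter_mem hsrc (?_ : {q | edgeParam x q ∈ Metric.ball (edgeParam x x) δ} ∈ 𝓝 x),
      Metric.ball (edgeParam x x) δ, w, Metric.isOpen_ball, convex_ball _ _, inter_subset_left,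
      hball, fun q hq => hq.1.2⟩
    have hc : ContinuousAt (fun q => edgeParam x q) x :=
      (cc 1).continuous.continuousAt.comp (continuousAt_extChartAt x)
    exact hc.eventually (Metric.ball_mem_nhds _ hδ)
  -- Around an interior point there is no boundary to treat, and the empty interval serves.
  · refine ⟨_, Filter.inter_mem hsrc ((ModelWithCorners.isClosed_boundary (n := ∞) (by
      simp)).isOpen_compl.mem_nhds hx), ∅, 0, isOpen_empty, convex_empty, inter_subset_left,
      fun t ht => ht.elim, fun q hq => (hq.1.2 hq.2).elim⟩

/-- Adding almost any quadratic function of `⟨f - y₀, w⟩` makes a map generic. -/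
theorem Surface.dense_genericAt (f : Surface M) {p : M} {J : Set ℝ} {y₀ w : E3} (hJ : IsOpen J)
    (hJc : Convex ℝ J) (hJp : ∀ t ∈ J, pt 0 t ∈ chartDomain p ∧
      (inner ℝ (deriv (edgeCurve (f.localParam p)) t) w : ℝ) ≠ 0)
    {K : Set M} (hKp : K ⊆ (chartAt (EuclideanHalfSpace 2) p).source)
    (hKJ : ∀ q ∈ K ∩ (𝓡∂ 2).boundary M, edgeParam p q ∈ J) {g : M → E3}
    (hg : ContMDiff (𝓡∂ 2) 𝓘(ℝ, E3) ∞ g) {a b : M → ℝ}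
    (hab : ∀ q ∈ K, ∀ᶠ y in 𝓝 q, a y = inner ℝ (f.toMap y - y₀) w ∧
      b y = (inner ℝ (f.toMap y - y₀) w) ^ 2 / 2) :
    Dense {v : E3 × E3 | ∀ h : Surface M, h.toMap = (fun y => g y + (a y • v.1 + b y • v.2)) →
      ∀ q ∈ K ∩ (𝓡∂ 2).boundary M, GenericAt h.toMap p q} := by
  let γ := edgeCurve fun u => g ((extChartAt (𝓡∂ 2) p).symm u)
  let l : ℝ → ℝ := fun t => inner ℝ (edgeCurve (f.localParam p) t - y₀) w
  obtain ⟨V, hf⟩ := f.isLocalParam p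
  have hJW : J ⊆ {t | pt 0 t ∈ chartDomain p} := fun t ht => (hJp t ht).1
  have hγ : ContDiffOn ℝ ∞ γ J :=
    (contDiffOn_comp_pt (contMDiff_comp_extChartAt_symm hg p)).mono hJW
  have hl : ContDiffOn ℝ ∞ l J :=
    ((hf.contDiffOn_edgeCurve.mono hJW).sub contDiffOn_const).inner ℝ contDiffOn_const
  have hl' : ∀ t ∈ J, deriv l t ≠ 0 := fun t ht => by
    have hd := hf.hasDerivAt_edgeCurve (hJp t ht).1
    have h1 := ((hd.sub_const y₀).inner ℝ (hasDerivAt_const t w)).deriv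
    rw [inner_zero_right, zero_add] at h1
    change deriv (fun t => inner ℝ (edgeCurve (f.localParam p) t - y₀) w) t ≠ 0
    rw [h1, ← hd.deriv]
    exact (hJp t ht).2
  refine (dense_setOf_deriv_ne hJ hJc hγ hl hl').mono fun v hv h hh q hq => ?_
  have hqs : q ∈ (extChartAt (𝓡∂ 2) p).source := by rw [extChartAt_source]; exact hKp hq.1
  have ht := hKJ q hq
  set t := edgeParam p q
  have hsymm : (extChartAt (𝓡∂ 2) p).symm (pt 0 t) = q := by
    rw [← extChartAt_eq_pt hqs hq.2, (extChartAt (𝓡∂ 2) p).left_inv hqs]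
  have htend := continuousAt_symm_pt (hJp t ht).1
  rw [ContinuousAt, hsymm] at htend
  have hη : ∀ᶠ s in 𝓝 t, edgeCurve (h.localParam p) s =
      γ s + (l s • v.1 + (l s ^ 2 / 2) • v.2) := by
    filter_upwards [htend.eventually (hab q hq.1)] with s hs
    change h.toMap _ = g _ + _
    rw [hh]
    simp only
    rw [hs.1, hs.2]
    rfl
  obtain ⟨d1, d2⟩ := deriv_perturbed_curve hJ hγ hl ht hη
  obtain ⟨V', hP⟩ := h.isLocalParam p
  -- The perturbed map is an immersion, so its boundary curve has nonzero velocity; dependence could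
  -- then only mean that the second derivative is a multiple of the first.
  have hne := hP.deriv_edgeCurve_ne_zero (hJp t ht).1
  rw [genericAt_iff h.contMDiff hqs hq.2]
  change cross (deriv (edgeCurve (h.localParam p)) t)
    (deriv (deriv (edgeCurve (h.localParam p))) t) ≠ 0
  rw [← linearIndependent_iff_cross_ne_zero, LinearIndependent.pair_iff' hne]
  intro k hk
  refine hv t ht k ?_
  rw [← d1, ← d2, hk]

end Local

end
end FlatExt

namespace FlatExt
noncomputable section

/-! ### Density of the generic embeddings -/

section Density

variable {M : Type*} [TopologicalSpace M] [ChartedSpace (EuclideanHalfSpace 2) M]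

variable {A C : ℕ → E3 → ℝ} {S : ℕ → Set M}

/-- Sufficiently small perturbations stay in a neighbourhood in the Whitney topology. -/
theorem exists_perturbMap_mem_nhds (f : Surface M) (hS : LocallyFinite S)
    (hSc : ∀ m, IsClosed (S m)) (hSk : ∀ m, IsCompact (S m))
    (hAS : ∀ m x, x ∉ S m → A m (f.toMap x) = 0) (hCS : ∀ m x, x ∉ S m → C m (f.toMap x) = 0)
    (hA : ∀ m, ContDiff ℝ ∞ (A m)) (hC : ∀ m, ContDiff ℝ ∞ (C m)) {N : Set (Surface M)}
    (hN : N ∈ 𝓝 f) :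
    ∃ O : ℕ → Set (E3 × E3), (∀ m, O m ∈ 𝓝 0) ∧ ∀ c : ℕ → E3 × E3, (∀ m, c m ∈ O m) →
      ∀ g : Surface M, g.toMap = perturbMap f.toMap A C S c → g ∈ N := by
  -- The sets that contain all sufficiently small perturbations form a filter, so only generating
  -- sets of the Whitney topology need to be examined.
  let 𝓕 : Filter (SmoothMaps M) :=
    { sets := {s | ∃ O : ℕ → Set (E3 × E3), (∀ m, O m ∈ 𝓝 0) ∧ ∀ c : ℕ → E3 × E3,
        (∀ m, c m ∈ O m) → ∀ g : SmoothMaps M, (g : M → E3) = perturbMap f.toMap A C S c → g ∈ s}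
      univ_sets := ⟨fun _ => univ, fun _ => Filter.univ_mem, fun _ _ _ _ => mem_univ _⟩
      sets_of_superset := by
        rintro s t ⟨O, hO, h⟩ hst
        exact ⟨O, hO, fun c hc g hg => hst (h c hc g hg)⟩
      inter_sets := by
        rintro s t ⟨O, hO, h⟩ ⟨O', hO', h'⟩
        exact ⟨fun m => O m ∩ O' m, fun m => Filter.inter_mem (hO m) (hO' m), fun c hc g hg =>
          ⟨h c (fun m => (hc m).1) g hg, h' c (fun m => (hc m).2) g hg⟩⟩ }
  have hle : 𝓕 ≤ @nhds _ (whitneyTopology M) f.1 := by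
    rw [TopologicalSpace.nhds_generateFrom]
    refine le_iInf₂ fun s hs => Filter.le_principal_iff.2 ?_
    obtain ⟨hfs, f₀, r, e, K, ε, he, hK, hKf, -, rfl⟩ := hs
    exact exists_perturbMap_mem_whitneyNhd f hS hSc hSk hAS hCS hA hC he hK hKf hfs
  rw [@nhds_induced _ _ (whitneyTopology M)] at hN
  obtain ⟨N', hN', hsub⟩ := hN
  obtain ⟨O, hO, h⟩ := hle hN'
  exact ⟨O, hO, fun c hc g hg => hsub (h c hc g.1 hg)⟩

variable [IsManifold (𝓡∂ 2) ∞ M]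

/-- The generic embeddings form a dense set. -/
theorem dense_setOf_isGeneric [T2Space M] [SecondCountableTopology M] :
    Dense {f : Surface M | f.IsGeneric} := by
  intro f
  rw [mem_closure_iff_nhds]
  intro N hN
  rcases isEmpty_or_nonempty M with hM | hM
  · exact ⟨f, mem_of_mem_nhds hN, fun p _ => hM.elim p⟩
  have := Manifold.locallyCompact_of_finiteDimensional (M := M) (𝓡∂ 2)
  choose U hU J w hJ hJc hUs hJp hUJ using f.exists_nhds_inner_deriv_ne_zero
  obtain ⟨x, B, K, hB, hBU, hBf, hBc, hK, hKB, hKu⟩ := exists_locallyFinite_compact_cover hU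
  choose H S hH hHc hSc hSB hHS hHK using fun n => f.exists_cutoff (hB n) (hK n) (hKB n)
  let l : ℕ → E3 → ℝ := fun n y => inner ℝ (y - f.toMap (x n)) (w (x n))
  have hl : ∀ n, ContDiff ℝ ∞ (l n) := fun n =>
    (contDiff_id.sub contDiff_const).inner ℝ contDiff_const
  -- Where the cut-off is 1, the n-th term is l v₁ + (l² / 2) v₂, the perturbation treated in
  -- `dense_setOf_deriv_ne`.
  let A : ℕ → E3 → ℝ := fun n y => H n y * l n y
  let C : ℕ → E3 → ℝ := fun n y => H n y * (l n y ^ 2 / 2)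
  have hA : ∀ n, ContDiff ℝ ∞ (A n) := fun n => (hH n).mul (hl n)
  have hC : ∀ n, ContDiff ℝ ∞ (C n) := fun n => (hH n).mul (((hl n).pow 2).div_const 2)
  have hAS : ∀ m y, y ∉ S m → A m (f.toMap y) = 0 := fun m y hy => by
    simp only [A, hHS m y hy, zero_mul]
  have hCS : ∀ m y, y ∉ S m → C m (f.toMap y) = 0 := fun m y hy => by
    simp only [C, hHS m y hy, zero_mul]
  have hSf : LocallyFinite S := hBf.subset hSB
  have hSk : ∀ m, IsCompact (S m) := fun m =>
    (hBc m).of_isClosed_subset (hSc m) ((hSB m).trans subset_closure)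
  choose LA hLA using fun n => (hA n).lipschitzWith_of_hasCompactSupport
    ((hHc n).mul_right (f' := l n)) (by simp)
  choose LC hLC using fun n => (hC n).lipschitzWith_of_hasCompactSupport
    ((hHc n).mul_right (f' := fun y => l n y ^ 2 / 2)) (by simp)
  obtain ⟨O, hO, hON⟩ := exists_perturbMap_mem_nhds f hSf hSc hSk hAS hCS hA hC hN
  have hKs : ∀ n, K n ⊆ (chartAt (EuclideanHalfSpace 2) (x n)).source := fun n =>
    (hKB n).trans ((hBU n).trans (hUs _))
  -- After `n` steps the partial sum is generic on the first `n` compact sets, and all coefficients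
  -- are admissible.
  let P : ℕ → (ℕ → E3 × E3) → Prop := fun n c =>
    (∀ m < n, c m ∈ O m ∩ SmallParam LA LC m) ∧
      ∀ i < n, ∀ q ∈ K i ∩ (𝓡∂ 2).boundary M, GenericAt (perturb A C c n ∘ f.toMap) (x i) q
  have hstep : ∀ n c, P n c → ∃ v, P (n + 1) (Function.update c n v) := by
    rintro n c ⟨hc, hgen⟩
    have hg : ContMDiff (𝓡∂ 2) 𝓘(ℝ, E3) ∞ (perturb A C c n ∘ f.toMap) :=
      (contDiff_perturb hA hC).contMDiff.comp f.contMDiff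
    have hA' : ContMDiff (𝓡∂ 2) 𝓘(ℝ, ℝ) ∞ fun y => A n (f.toMap y) :=
      (hA n).contMDiff.comp f.contMDiff
    have hC' : ContMDiff (𝓡∂ 2) 𝓘(ℝ, ℝ) ∞ fun y => C n (f.toMap y) :=
      (hC n).contMDiff.comp f.contMDiff
    let G : E3 × E3 → M → E3 := fun v y => (perturb A C c n ∘ f.toMap) y +
      (A n (f.toMap y) • v.1 + C n (f.toMap y) • v.2)
    have hGsm : ∀ v, ContMDiff (𝓡∂ 2) 𝓘(ℝ, E3) ∞ (G v) := fun v =>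
      hg.add (contMDiff_smul_add_smul hA' hC' v)
    have hold : ∀ᶠ v in 𝓝 (0 : E3 × E3), ∀ i ∈ Iio n, ∀ q ∈ K i ∩ (𝓡∂ 2).boundary M,
        GenericAt (G v) (x i) q := by
      rw [Filter.eventually_all_finite (finite_Iio n)]
      intro i hi
      obtain ⟨ε, hε, hstab⟩ := exists_genericAt_of_norm_lt hg (hK i) (hKs i) (hgen i hi)
      have h1 : ∀ᶠ v in 𝓝 (0 : E3 × E3), ∀ j ∈ Iic 2, ∀ y ∈ K i,
          ‖chartJet (chartAt (EuclideanHalfSpace 2) (x i)) j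
            (fun y => A n (f.toMap y) • v.1 + C n (f.toMap y) • v.2) y‖ < ε := by
        rw [Filter.eventually_all_finite (finite_Iic 2)]
        exact fun j _ => eventually_norm_chartJet_lt (IsManifold.chart_mem_maximalAtlas _) (hK i)
          (hKs i) hA' hC' j hε
      filter_upwards [h1] with v hv
      refine hstab (G v) (hGsm v) fun y hy j hj => ?_
      have : (fun y => G v y - (perturb A C c n ∘ f.toMap) y) =
          fun y => A n (f.toMap y) • v.1 + C n (f.toMap y) • v.2 := by
        funext y; simp only [G, add_sub_cancel_left]
      rw [this]
      exact hv j hj y hy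
    have hnew := f.dense_genericAt (y₀ := f.toMap (x n)) (hJ (x n)) (hJc (x n)) (hJp (x n)) (hKs n)
      (fun q hq => hUJ (x n) q ⟨hBU n (hKB n hq.1), hq.2⟩) hg
      (a := fun y => A n (f.toMap y)) (b := fun y => C n (f.toMap y)) fun q hq => by
        filter_upwards [f.2.1.continuous.continuousAt.eventually (hHK n q hq)] with y hy
        have hy' : H n (f.toMap y) = 1 := hy
        simp only [A, C, l, hy', one_mul, and_self]
    -- Preserving the earlier genericity and smallness are conditions on a neighbourhood of 0;
    -- genericity on `K n` holds on a dense set. The two meet.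
    obtain ⟨v, hv, hvd⟩ := hnew.exists_mem_open isOpen_interior
      (⟨0, mem_interior_iff_mem_nhds.2 (Filter.inter_mem (Filter.inter_mem (hO n)
        (smallParam_mem_nhds LA LC n)) hold)⟩ : (interior _).Nonempty)
    obtain ⟨hvO, hvold⟩ := interior_subset hvd
    have hcu : ∀ m < n + 1, Function.update c n v m ∈ O m ∩ SmallParam LA LC m := by
      intro m hm
      rcases Nat.lt_succ_iff_lt_or_eq.1 hm with h | rfl
      · rw [Function.update_of_ne h.ne]; exact hc m h
      · rw [Function.update_self]; exact hvO
    have hGv : perturb A C (Function.update c n v) (n + 1) ∘ f.toMap = G v := by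
      funext y
      rw [Function.comp_apply, perturb_succ, Function.update_self,
        perturb_congr (c' := c) fun m hm => Function.update_of_ne hm.ne _ _]
      rfl
    refine ⟨v, hcu, fun i hi q hq => ?_⟩
    rw [hGv]
    rcases Nat.lt_succ_iff_lt_or_eq.1 hi with h | rfl
    · exact hvold i h q hq
    · obtain ⟨h, hh⟩ := f.exists_perturb hA hC hLA hLC fun m hm => (hcu m hm).2
      rw [hGv] at hh
      rw [← hh]
      exact hv h hh q hq
  obtain ⟨c, hc⟩ := exists_seq_of_step P (fun n c c' hcc' ⟨h1, h2⟩ => ⟨fun m hm => by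
    rw [← hcc' m hm]; exact h1 m hm, by rw [← perturb_congr hcc']; exact h2⟩) 0
    ⟨fun m hm => absurd hm (Nat.not_lt_zero m), fun i hi => absurd hi (Nat.not_lt_zero i)⟩ hstep
  have hcm : ∀ m, c m ∈ O m ∩ SmallParam LA LC m := fun m => (hc (m + 1)).1 m (Nat.lt_succ_self m)
  obtain ⟨g, hg⟩ := f.exists_perturbMap hSf hSc hAS hCS hA hC hLA hLC fun m => (hcm m).2
  refine ⟨g, hON c (fun m => (hcm m).1) g hg, fun q hq => ?_⟩
  obtain ⟨i, hi⟩ := mem_iUnion.1 (hKu ▸ mem_univ q : q ∈ ⋃ n, K n)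
  obtain ⟨n, hn⟩ := exists_forall_notMem_of_isCompact hSf (hK i)
  rw [g.hasOsculatingPlane_iff_genericAt (p := x i) (by rw [extChartAt_source]; exact hKs i hi) hq]
  -- Only finitely many terms act near `K i`, so the limit agrees near `q` with a partial sum;
  -- taking more than `i` terms makes that sum generic on `K i`.
  have hev := perturbMap_eventuallyEq hSf hSc hAS hCS c (x := q) (n := max n (i + 1)) fun m hm =>
    hn m ((le_max_left _ _).trans hm) q hi
  have hgen := (hc (max n (i + 1))).2 i (lt_of_lt_of_le (Nat.lt_succ_self i) (le_max_right _ _)) q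
    ⟨hi, hq⟩
  rw [GenericAt, hg, chartJet_congr (hKs i hi) hev, chartJet_congr (hKs i hi) hev]
  exact hgen

end Density

end
end FlatExt

open FlatExt in
theorem mainTheorem1 (M : Type*) [TopologicalSpace M] [T2Space M] [SecondCountableTopology M]
    [ChartedSpace (EuclideanHalfSpace 2) M] [IsManifold (𝓡∂ 2) ∞ M] :
    -- the condition `IsGeneric` is indeed generic
    (IsOpen {f : Surface M | f.IsGeneric} ∧ Dense {f : Surface M | f.IsGeneric}) ∧
    ∀ f : Surface M, f.IsGeneric → ∀ p ∈ (𝓡∂ 2).boundary M, ¬ f.IsOsculatingTangent p →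
      -- local existence
      (∃ U T : Set E3, f.toMap p ∈ U ∧ IsFlatExtension f.carrier f.bdry U T) ∧
      -- local uniqueness
      (∀ U₁ T₁ U₂ T₂ : Set E3,
        f.toMap p ∈ U₁ → IsFlatExtension f.carrier f.bdry U₁ T₁ →
        f.toMap p ∈ U₂ → IsFlatExtension f.carrier f.bdry U₂ T₂ →
        ∃ V : Set E3, IsOpen V ∧ f.toMap p ∈ V ∧ T₁ ∩ V = T₂ ∩ V) ∧
      -- the extending flat surface is a piece of the boundary-envelope, which is regular there
      (∀ U T : Set E3, f.toMap p ∈ U → IsFlatExtension f.carrier f.bdry U T →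
        ∀ N₀ ∈ 𝓝 p, ∃ N ∈ 𝓝 p, N ⊆ N₀ ∧ ∃ V : Set E3, IsOpen V ∧ f.toMap p ∈ V ∧
          IsFlatSurface (f.boundaryEnvelope N ∩ V) ∅ ∧
          (T \ (f.carrier \ f.bdry)) ∩ V ⊆ f.boundaryEnvelope N) := by
  refine ⟨⟨isOpen_setOf_isGeneric, dense_setOf_isGeneric⟩, fun f hf p hp ht => ?_⟩
  have hr := f.edgeParam_mem_regularParams hp (hf p hp) ht
  obtain ⟨V, h⟩ := f.isLocalParam p
  have hpe := f.edgeCurve_edgeParam (mem_extChartAt_source (I := 𝓡∂ 2) p) hp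
  refine ⟨?_, fun U₁ T₁ U₂ T₂ h₁ hT₁ h₂ hT₂ => ?_, fun U T hU hT N₀ hN₀ =>
    f.exists_flat_boundaryEnvelope hp hr hU hT hN₀⟩
  · obtain ⟨U, T, hU, hT⟩ := h.exists_isFlatExtension f.bdry_subset_carrier hr
    exact ⟨U, T, hpe ▸ hU, hT⟩
  · rw [← hpe] at h₁ h₂ ⊢
    exact h.exists_inter_eq_of_isFlatExtension f.bdry_subset_carrier hr h₁ hT₁ h₂ hT₂
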